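/- Let $\mathbb T^2=\mathbb R^2/\mathbb Z^2$, $K=2\pi\mathbb Z^2\setminus\{0\}$, $e_k(x)=e^{i\langle k,x\rangle}$, and for $m\in\mathbb N_0$ let $C^m(\mathbb T^2)$ be the space of real $C^m$-functions on $\mathbb T^2$ with norm $|f|_{C^m}=\sum_{|\delta|\le m}\sup_x|D^\delta f(x)|$. Let $\nu>0$, $H\in(0,1)$, and let $(\alpha_k)_{k\in K}$, $(\lambda_k)_{k\in K}$ be real families with $\alpha_k=\alpha_{-k}\ge c>0$, $\alpha_k\to\infty$ as $|k|\to\infty$, and $0\le\lambda_k=\lambda_{-k}$ bounded. Put $Ae_k=-\alpha_ke_k$, $Q^{1/2}e_k=\sqrt{\lambda_k}\,e_k$, $S(t)e_k=e^{-t\nu\alpha_k}e_k$. Suppose that for some $\gamma\in(0,1)$ $$\sum_{k\in K}\lambda_k\alpha_k^{2\gamma-2H}|k|^{2m}<\infty,\qquad \sum_{k\in K}\lambda_k\alpha_k^{-2H}|k|^{2m+2\gamma}<\infty .$$ Let $B^H=\sum_{k\in K}\beta_k^He_k$ be an infinite-dimensional two-sided fractional Brownian motion on some probability space: $\sqrt2\,\mathrm{Re}\,\beta^H_k$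 and $\sqrt2\,\mathrm{Im}\,\beta^H_k$ are independent real normalized fractional Brownian motions on $\mathbb R$ with Hurst parameter $H$, $\beta^H_{-k}=\overline{\beta^H_k}$, and the $\beta_k^H$ are otherwise independent. Let $\Omega=C(\mathbb R,C^m(\mathbb T^2))$ with the compact-open topology, $\mathcal F$ its Borel $\sigma$-algebra, $(\theta(t)\psi)(s)=\psi(t+s)$, and write $|\psi|_{C([T_1,T_2],C^m)}=\sup_{T_1\le s\le T_2}|\psi(s)|_{C^m}$. Consider the strictly stationary mild solution on $\mathbb R$ of $$d\psi_t=\nu A\psi_t\,dt+\nu^HQ^{1/2}dB^H_t,$$ i.e. the strictly stationary process with values in the mean-zero functions such that, for all $s\le t$, almost surely $$\psi(t)=S(t-s)\psi(s)+\sum_{k\in K}\sqrt{\lambda_k}\,\nu^H\int_s^te^{-(t-u)\nu\alpha_k}\,d\beta_k^H(u)\,e_k,$$ the integrals being pathwise Riemann--Stieltjes integrals. Every such $B^H$ admits such a solution that is an $\Omega$-valued random variable; let $\mathbb P$ be its distribution on $(\Omega,\mathcal F)$. Then: (i) For all $T_1<t<T_2$ the maps $\psi\mapsto|\psi(t)|_{C^m}$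 and $\psi\mapsto|\psi|_{C([T_1,T_2],C^m)}$ are $\mathcal F$-measurable, and for all $T_1<T_2$ there is a constant $C>0$, depending only on $m,H,\nu,\gamma,(\alpha_k),(\lambda_k),T_1,T_2$, such that for all $t\in(T_1,T_2)$ $$\int_\Omega|\psi(t)|_{C^m}^2\,d\mathbb P(\psi)\le\int_\Omega|\psi|^2_{C([T_1,T_2],C^m)}\,d\mathbb P(\psi)\le C .$$ (ii) There is a set $\Omega_0\in\mathcal F$ with $\mathbb P(\Omega_0)=1$ and $\theta(t)^{-1}\Omega_0=\Omega_0$ for all $t\in\mathbb R$, such that for all $\delta>0$ and $\psi\in\Omega_0$ there is a constant $C(\psi,\delta)>0$ with $$|\psi(t)|_{C^m}\le\delta|t|+C(\psi,\delta)\qquad\text{for all }t\in\mathbb R .$$ In particular, for every $\tau>0$ the integral $\int_{-\infty}^0e^{s/\tau}|\psi(s)|_{C^m}^2\,ds$ is finite for all $\psi\in\Omega_0$, and the map equal to this integral for $\psi\in\Omega_0$ and to $0$ for $\psi\notin\Omega_0$ is $\mathcal F$-measurable. -/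

import Mathlib

open MeasureTheory ProbabilityTheory Filter Topology

universe u

noncomputable section

namespace FracField

/-! ### The Banach space `C^m(𝕋²)`

The torus is `𝕋² = ℝ² / ℤ²`, and functions on it are the `ℤ²`-periodic functions on `ℝ²`. -/

/-- Real-valued `ℤ²`-periodic functions on `ℝ²` of class `C^m`. -/
def periodicCm (m : ℕ) : Submodule ℝ (ℝ × ℝ → ℝ) where
  carrier := {f | ContDiff ℝ m f ∧
    ∀ (n : ℤ × ℤ) (x : ℝ × ℝ), f (x + ((n.1 : ℝ), (n.2 : ℝ))) = f x}
  zero_mem' := ⟨contDiff_const, fun _ _ => rfl⟩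
  add_mem' := fun hf hg => ⟨hf.1.add hg.1, fun n x => by
    simp only [Pi.add_apply, hf.2 n x, hg.2 n x]⟩
  smul_mem' := fun c _ hf => ⟨contDiff_const.smul hf.1, fun n x => by
    simp only [Pi.smul_apply, hf.2 n x]⟩

/-- The space `C^m(𝕋²)`. -/
def CmTorus (m : ℕ) : Type := periodicCm m

namespace CmTorus

variable {m : ℕ}

instance : AddCommGroup (CmTorus m) := inferInstanceAs (AddCommGroup (periodicCm m))

instance : Module ℝ (CmTorus m) := inferInstanceAs (Module ℝ (periodicCm m))

/-- The underlying periodic function on `ℝ²`. -/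
def toFun (f : CmTorus m) : ℝ × ℝ → ℝ := Subtype.val f

instance : CoeFun (CmTorus m) (fun _ => ℝ × ℝ → ℝ) := ⟨toFun⟩

end CmTorus

/-- The partial derivative `D^δ f = ∂^{|δ|} f / ∂x₁^{δ₁} ∂x₂^{δ₂}` for a multi-index `δ`. -/
def partialDeriv (δ : ℕ × ℕ) (f : ℝ × ℝ → ℝ) (x : ℝ × ℝ) : ℝ :=
  iteratedFDeriv ℝ (δ.1 + δ.2) f x
    (fun i => if (i : ℕ) < δ.1 then ((1 : ℝ), (0 : ℝ)) else ((0 : ℝ), (1 : ℝ)))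

/-- The multi-indices `δ ∈ ℕ₀²` with `|δ| ≤ m`. -/
def multiIndices (m : ℕ) : Finset (ℕ × ℕ) :=
  (Finset.range (m + 1) ×ˢ Finset.range (m + 1)).filter (fun δ => δ.1 + δ.2 ≤ m)

namespace CmTorus

variable {m : ℕ}

/-- The norm `|f|_{C^m} = ∑_{|δ| ≤ m} sup_x |D^δ f(x)|`. -/
instance : Norm (CmTorus m) :=
  ⟨fun f => ∑ δ ∈ multiIndices m, ⨆ x : ℝ × ℝ, |partialDeriv δ f x|⟩

lemma norm_def (f : CmTorus m) :
    ‖f‖ = ∑ δ ∈ multiIndices m, ⨆ x : ℝ × ℝ, |partialDeriv δ f x| := rfl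

lemma contDiff (f : CmTorus m) : ContDiff ℝ m f := f.2.1

lemma contDiff_of_mem (f : CmTorus m) {δ : ℕ × ℕ} (hδ : δ ∈ multiIndices m) :
    ContDiff ℝ (δ.1 + δ.2 : ℕ) f :=
  f.contDiff.of_le (by exact_mod_cast (Finset.mem_filter.1 hδ).2)

lemma bddAbove_partialDeriv (f : CmTorus m) {δ : ℕ × ℕ} (hδ : δ ∈ multiIndices m) :
    BddAbove (Set.range fun x : ℝ × ℝ => |partialDeriv δ f x|) := by
  have hcont : Continuous (partialDeriv δ f) := by
    have h := (f.contDiff_of_mem hδ).continuous_iteratedFDeriv (m := δ.1 + δ.2) le_rfl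
    exact (ContinuousMultilinearMap.apply ℝ (fun _ : Fin (δ.1 + δ.2) => ℝ × ℝ) ℝ
      (fun i => if (i : ℕ) < δ.1 then ((1 : ℝ), (0 : ℝ))
        else ((0 : ℝ), (1 : ℝ)))).continuous.comp h
  have hper : ∀ (n : ℤ × ℤ) (x : ℝ × ℝ),
      partialDeriv δ f (x + ((n.1 : ℝ), (n.2 : ℝ))) = partialDeriv δ f x := by
    intro n x
    have h1 : (fun z => f.toFun (z + ((n.1 : ℝ), (n.2 : ℝ)))) = f.toFun :=
      funext fun z => f.2.2 n z
    unfold partialDeriv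
    rw [← iteratedFDeriv_comp_add_right, h1]
  obtain ⟨C, hC⟩ := (isCompact_Icc (a := ((0 : ℝ), (0 : ℝ))) (b := (1, 1))).bddAbove_image
    hcont.abs.continuousOn
  refine ⟨C, ?_⟩
  rintro _ ⟨x, rfl⟩
  have hx := hper (-⌊x.1⌋, -⌊x.2⌋) x
  dsimp only
  rw [← hx]
  refine hC ⟨_, ⟨⟨?_, ?_⟩, ⟨?_, ?_⟩⟩, rfl⟩
  · simpa using Int.floor_le x.1
  · simpa using Int.floor_le x.2
  · have := (Int.lt_floor_add_one x.1).le
    simp only [Prod.fst_add, Int.cast_neg]; linarith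
  · have := (Int.lt_floor_add_one x.2).le
    simp only [Prod.snd_add, Int.cast_neg]; linarith

lemma partialDeriv_add (f g : CmTorus m) {δ : ℕ × ℕ} (hδ : δ ∈ multiIndices m) (x : ℝ × ℝ) :
    partialDeriv δ (f + g : CmTorus m) x = partialDeriv δ f x + partialDeriv δ g x := by
  have h : (f + g : CmTorus m).toFun = f.toFun + g.toFun := rfl
  unfold partialDeriv
  rw [h, iteratedFDeriv_add_apply (f.contDiff_of_mem hδ).contDiffAt
    (g.contDiff_of_mem hδ).contDiffAt]
  rfl

lemma partialDeriv_smul (c : ℝ) (f : CmTorus m) {δ : ℕ × ℕ} (hδ : δ ∈ multiIndices m)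
    (x : ℝ × ℝ) : partialDeriv δ (c • f : CmTorus m) x = c * partialDeriv δ f x := by
  have h : (c • f : CmTorus m).toFun = c • f.toFun := rfl
  unfold partialDeriv
  rw [h, iteratedFDeriv_const_smul_apply (f.contDiff_of_mem hδ).contDiffAt]
  rfl

lemma norm_smul_eq (c : ℝ) (f : CmTorus m) : ‖c • f‖ = |c| * ‖f‖ := by
  rw [norm_def, norm_def, Finset.mul_sum]
  refine Finset.sum_congr rfl fun δ hδ => ?_
  rw [Real.mul_iSup_of_nonneg (abs_nonneg c)]
  simp only [partialDeriv_smul c f hδ, abs_mul]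

lemma norm_add_le' (f g : CmTorus m) : ‖f + g‖ ≤ ‖f‖ + ‖g‖ := by
  rw [norm_def, norm_def, norm_def, ← Finset.sum_add_distrib]
  refine Finset.sum_le_sum fun δ hδ => ciSup_le fun x => ?_
  rw [partialDeriv_add f g hδ]
  exact (abs_add_le _ _).trans (add_le_add (le_ciSup (f.bddAbove_partialDeriv hδ) x)
    (le_ciSup (g.bddAbove_partialDeriv hδ) x))

lemma eq_zero_of_norm (f : CmTorus m) (hf : ‖f‖ = 0) : f = 0 := by
  have h0 : ((0, 0) : ℕ × ℕ) ∈ multiIndices m := by simp [multiIndices]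
  rw [norm_def, Finset.sum_eq_zero_iff_of_nonneg
    (fun δ _ => Real.iSup_nonneg fun x => abs_nonneg _)] at hf
  refine Subtype.ext (funext fun x => ?_)
  have h1 : |partialDeriv (0, 0) f x| ≤ ⨆ y : ℝ × ℝ, |partialDeriv (0, 0) f y| :=
    le_ciSup (f.bddAbove_partialDeriv h0) x
  rw [hf _ h0] at h1
  have h2 : partialDeriv (0, 0) f x = f x := iteratedFDeriv_zero_apply _
  rw [h2] at h1
  exact abs_eq_zero.1 (le_antisymm h1 (abs_nonneg _))

instance : NormedAddCommGroup (CmTorus m) :=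
  AddGroupNorm.toNormedAddCommGroup
    { toFun := fun f => ‖f‖
      map_zero' := by simpa using norm_smul_eq (0 : ℝ) (0 : CmTorus m)
      add_le' := norm_add_le'
      neg' := fun f => by simpa using norm_smul_eq (-1 : ℝ) f
      eq_zero_of_map_eq_zero' := eq_zero_of_norm }

instance : NormedSpace ℝ (CmTorus m) where
  norm_smul_le c f := (norm_smul_eq c f).le

instance : MeasurableSpace (CmTorus m) := borel _

instance : BorelSpace (CmTorus m) := ⟨rfl⟩

end CmTorus

/-! ### The path space and its shifts -/

/-- The space `Ω = C(ℝ, C^m(𝕋²))`, with the compact-open topology. -/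
abbrev PathSpace (m : ℕ) : Type := C(ℝ, CmTorus m)

instance (m : ℕ) : MeasurableSpace (PathSpace m) := borel _

instance (m : ℕ) : BorelSpace (PathSpace m) := ⟨rfl⟩

/-- The shift `(θ(t) ψ)(s) = ψ(t + s)`. -/
def shift {m : ℕ} (t : ℝ) (ψ : PathSpace m) : PathSpace m :=
  ψ.comp ⟨fun s => t + s, continuous_const.add continuous_id⟩

/-- The norm of `C([T₁, T₂], C^m(𝕋²))`. -/
def supNorm {m : ℕ} (T₁ T₂ : ℝ) (ψ : PathSpace m) : ℝ :=
  ⨆ s : Set.Icc T₁ T₂, ‖ψ s‖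

/-! ### Fourier modes -/

/-- The nonzero `k ∈ ℤ²`; the corresponding wave vector is `2πk`. -/
abbrev Mode : Type := {k : ℤ × ℤ // k ≠ 0}

/-- The mode `-k`. -/
def Mode.neg (k : Mode) : Mode := ⟨-k.1, neg_ne_zero.2 k.2⟩

/-- The Euclidean length of the wave vector `2πk`. -/
def Mode.length (k : Mode) : ℝ :=
  2 * Real.pi * Real.sqrt ((k.1.1 : ℝ) ^ 2 + (k.1.2 : ℝ) ^ 2)

/-- The Fourier coefficient `∫_{𝕋²} f(x) e^{-2πi⟨k,x⟩} dx`, the inner product of `f` with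
`e^{2πi⟨k,x⟩}` in `L²(𝕋²)`. -/
def fourierCoef (k : ℤ × ℤ) (f : ℝ × ℝ → ℝ) : ℂ :=
  ∫ x in Set.Icc (0 : ℝ) 1 ×ˢ Set.Icc (0 : ℝ) 1,
    (f x : ℂ) * Complex.exp (-(2 * Real.pi * Complex.I * (k.1 * x.1 + k.2 * x.2)))

/-! ### Fractional Brownian motion -/

/-- A real normalized (two-sided) fractional Brownian motion with Hurst parameter `H`. -/
structure IsRealFBM {S : Type*} [MeasurableSpace S] (H : ℝ) (B : ℝ → S → ℝ)
    (μ : Measure S) : Prop where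
  measurable : ∀ t, Measurable (B t)
  gaussian : IsGaussianProcess B μ
  start : ∀ᵐ ω ∂μ, B 0 ω = 0
  mean : ∀ t, ∫ ω, B t ω ∂μ = 0
  cov : ∀ s t, ∫ ω, B t ω * B s ω ∂μ =
    (1 / 2 : ℝ) * (|t| ^ (2 * H) + |s| ^ (2 * H) - |t - s| ^ (2 * H))
  continuous_paths : ∀ᵐ ω ∂μ, Continuous fun t => B t ω

/-- The coefficients `(β_k)` of the infinite-dimensional fractional Brownian motion
`B^H(t) = ∑_k β_k(t) e_k`: each `β_k` is a complex normalized fractional Brownian motion,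
`β_{-k}` is the conjugate of `β_k`, and the `β_k` are otherwise independent, i.e. any family of
them in which no `β_k` occurs together with `β_{-k}` is independent. -/
structure IsInfDimFBM {S : Type*} [MeasurableSpace S] (H : ℝ) (β : Mode → ℝ → S → ℂ)
    (μ : Measure S) : Prop where
  re_fbm : ∀ k, IsRealFBM H (fun t ω => Real.sqrt 2 * (β k t ω).re) μ
  im_fbm : ∀ k, IsRealFBM H (fun t ω => Real.sqrt 2 * (β k t ω).im) μ
  indep_re_im : ∀ k, IndepFun (fun ω (t : ℝ) => (β k t ω).re) (fun ω (t : ℝ) => (β k t ω).im) μ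
  conj : ∀ k t, ∀ᵐ ω ∂μ, β k.neg t ω = (starRingEnd ℂ) (β k t ω)
  indep : ∀ T : Set Mode, (∀ k ∈ T, k.neg ∉ T) →
    iIndepFun (fun (k : T) (ω : S) (t : ℝ) => β k t ω) μ

/-- `I` is the Riemann-Stieltjes integral `∫_a^b f dg`, where `a ≤ b`. -/
def HasStieltjesIntegral (f : ℝ → ℝ) (g : ℝ → ℂ) (a b : ℝ) (I : ℂ) : Prop :=
  ∀ ε > 0, ∃ δ > 0, ∀ (n : ℕ) (p ξ : ℕ → ℝ), p 0 = a → p n = b →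
    (∀ i < n, p i ≤ p (i + 1) ∧ p (i + 1) - p i < δ ∧ ξ i ∈ Set.Icc (p i) (p (i + 1))) →
    ‖∑ i ∈ Finset.range n, (f (ξ i) : ℂ) * (g (p (i + 1)) - g (p i)) - I‖ < ε

/-! ### The stationary mild solution -/

/-- Standing assumptions on the eigenvalues `-α_k` of `A` and `√λ_k` of `Q^{1/2}`. -/
structure SpectralAssumption (α lam : Mode → ℝ) : Prop where
  alpha_lower : ∃ c > 0, ∀ k, c ≤ α k
  alpha_symm : ∀ k : Mode, α k.neg = α k
  alpha_tendsto : Tendsto α cofinite atTop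
  lam_nonneg : ∀ k, 0 ≤ lam k
  lam_symm : ∀ k : Mode, lam k.neg = lam k
  lam_bdd : BddAbove (Set.range lam)

/-- `X` is a mild solution, with time set `ℝ` and values in the mean-zero functions, of
`dψ = ν A ψ dt + ν^H Q^{1/2} dB^H`, that is, almost surely
`X(t) = S(t-s) X(s) + ∫_s^t S(t-u) ν^H Q^{1/2} dB^H(u)` for `s ≤ t`. Here
`S(t) e_k = e^{-tνα_k} e_k`, and the stochastic integral is the series
`∑_k √λ_k ν^H (∫_s^t e^{-(t-u)να_k} dβ_k(u)) e_k`, so that the equation is written in terms of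
the Fourier coefficients. -/
structure IsMildSolution {S : Type*} [MeasurableSpace S] {m : ℕ} (H ν : ℝ) (α lam : Mode → ℝ)
    (β : Mode → ℝ → S → ℂ) (μ : Measure S) (X : S → PathSpace m) : Prop where
  mean_zero : ∀ t, ∀ᵐ ω ∂μ, fourierCoef 0 (X ω t) = 0
  mild : ∀ s t, s ≤ t → ∀ᵐ ω ∂μ, ∀ k : Mode, ∃ I : ℂ,
    HasStieltjesIntegral (fun u => Real.exp (-((t - u) * ν * α k))) (fun u => β k u ω) s t I ∧
    fourierCoef k.1 (X ω t) = (Real.exp (-((t - s) * ν * α k)) : ℂ) * fourierCoef k.1 (X ω s)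
      + ((Real.sqrt (lam k) * ν ^ H : ℝ) : ℂ) * I

/-- Strict stationarity: the finite-dimensional distributions are invariant under time shifts. -/
def IsStrictlyStationary {S : Type*} [MeasurableSpace S] {m : ℕ} (μ : Measure S)
    (X : S → PathSpace m) : Prop :=
  ∀ (n : ℕ) (t : Fin n → ℝ) (r : ℝ),
    μ.map (fun ω i => X ω (t i + r)) = μ.map (fun ω i => X ω (t i))

/-- `P` is the distribution on `C(ℝ, C^m(𝕋²))` of the strictly stationary mild solution. -/
def IsSolutionLaw {m : ℕ} (H ν : ℝ) (α lam : Mode → ℝ) (P : Measure (PathSpace m)) : Prop :=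
  ∃ (S : Type u) (_ : MeasurableSpace S) (μ : Measure S) (β : Mode → ℝ → S → ℂ)
    (X : S → PathSpace m), IsProbabilityMeasure μ ∧ IsInfDimFBM H β μ ∧ Measurable X ∧
    IsMildSolution H ν α lam β μ X ∧ IsStrictlyStationary μ X ∧ P = μ.map X

end FracField

end

open FracField

/-! Write a_k = να_k and σ_k = √λ_k ν^H. The stationary solution is the Fourier series with
coefficients σ_k Z_k(t), where Z_k(t) = ∫_{-∞}^t e^{-(t-u)a_k} dβ_k(u). Everything rests on one
formula: after integration by parts and the substitution u = t - r/a, Z(t) is the mean of β(t) - β(t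
- r/a) over an exponentially distributed r (`OUPath.ou_eq_integral`). By Jensen, moments of Z reduce
to those of increments of fractional Brownian motion, and no covariance of Z is ever computed. The
increment has variance of order (r/a)^{2H}. The rectangular increment behind Z(t) - Z(s) has
variance at most 4 min(|t-s|, r/a)^{2H}, hence at most 4|t-s|^{2γ}(r/a)^{2H-2γ} when γ ≤ H.

For a finite set of modes without a pair k, -k, each derivative D^δ of the field is a sum of
independent Gaussians. The two summability hypotheses are what control its increments in space and
in time; both are collected in `weight`. Since all Gaussian moments are comparable to powers of the
variance, dyadic chaining on the three-dimensional time-space cube gives E sup² ≤ K ∑ weight over a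
time interval, with K independent of the modes and of the position of the interval
(`exists_lintegral_supNorm_field_le`). Partial sums along an exhaustion with geometrically small
tails therefore converge almost surely in C(ℝ, C^m) (`exists_isModeSeries`), and Fatou keeps the
bound.

The limit is a mild solution because Z_k satisfies the variation-of-constants formula. It is
stationary because Z_k is a limit of linear combinations of β_k whose weights sum to zero, and the
variance of such a combination depends only on time differences (`fbmVar_add_const`). Two stationary
mild solutions with the same noise coincide: their Fourier coefficients differ by e^{-na_k} times a
difference at time t - n, where each solution has a law independent of n (`IsMildSolution.ae_eq`).
So every solution law inherits the moment bound of the series.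

Sublinear growth needs no ergodic theorem. As E sup² over [T, T+1] is bounded uniformly in T, the
series ∑ sup_{[n,n+1]}²/(n+1)² has finite mean, so almost surely sup_{[n,n+1]}/(n+1) → 0. The set of
sublinear paths is itself measurable and shift invariant, and serves as Ω₀. -/

namespace FracField

/-! ### Symmetry of iterated derivatives -/

section Symmetry

variable {E : Type} [NormedAddCommGroup E] [NormedSpace ℝ E]

/-- The norm of C^m sees each mixed derivative in one order of differentiation only, so symmetry is
needed to recover the full derivative from it. A transposition that avoids the first slot is handled
by the induction hypothesis at nearby points, followed by one more differentiation. The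
transposition of the first two slots is handled by peeling off the last slot instead, which passes
to `fderiv ℝ f`; this is why the target space F is quantified inside the induction. Only the second
derivative needs Schwarz's theorem. -/
lemma iteratedFDeriv_comp_swap (n : ℕ) : ∀ {F : Type} [NormedAddCommGroup F] [NormedSpace ℝ F]
    (f : E → F), ContDiff ℝ (n + 1 : ℕ) f → ∀ (x : E) (v : Fin (n + 1) → E) (i : Fin n),
    iteratedFDeriv ℝ (n + 1) f x (v ∘ Equiv.swap i.castSucc i.succ) =
      iteratedFDeriv ℝ (n + 1) f x v := by
  induction n with
  | zero => intro F _ _ f _ x v i; exact i.elim0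
  | succ n ih =>
    intro F _ _ f hf x v i
    cases i using Fin.cases with
    | succ j =>
      have hD : DifferentiableAt ℝ (iteratedFDeriv ℝ (n + 1) f) x :=
        (hf.differentiable_iteratedFDeriv (by exact_mod_cast Nat.lt_succ_self _)) x
      have key : ∀ w : Fin (n + 2) → E, iteratedFDeriv ℝ (n + 1 + 1) f x w =
          fderiv ℝ (fun y => iteratedFDeriv ℝ (n + 1) f y (Fin.tail w)) x (w 0) := by
        intro w
        rw [iteratedFDeriv_succ_apply_left]
        have h := (ContinuousMultilinearMap.apply ℝ (fun _ : Fin (n + 1) => E) F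
          (Fin.tail w)).hasFDerivAt.comp x hD.hasFDerivAt
        have h' := h.fderiv
        simp only [Function.comp_def, ContinuousMultilinearMap.apply_apply] at h'
        rw [h']
        rfl
      rw [key, key]
      have h0 : (v ∘ Equiv.swap j.succ.castSucc j.succ.succ) 0 = v 0 := by
        simp only [Function.comp_apply]
        rw [Equiv.swap_apply_of_ne_of_ne]
        · exact fun h => by simp [Fin.ext_iff] at h
        · exact fun h => by simp [Fin.ext_iff] at h
      have ht : Fin.tail (v ∘ Equiv.swap j.succ.castSucc j.succ.succ) =
          Fin.tail v ∘ Equiv.swap j.castSucc j.succ := by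
        funext l
        simp only [Fin.tail, Function.comp_apply]
        congr 1
        rw [(Fin.succ_injective _).map_swap]
        rfl
      rw [h0, ht]
      congr 2
      funext y
      exact ih f (hf.of_le (by exact_mod_cast Nat.le_succ _)) y _ j
    | zero =>
      cases n with
      | zero =>
        have h2 : IsSymmSndFDerivAt ℝ f x :=
          (hf.contDiffAt (x := x)).isSymmSndFDerivAt (by simp)
        rw [iteratedFDeriv_two_apply, iteratedFDeriv_two_apply]
        simpa using h2.eq (v 1) (v 0)
      | succ n =>
        have h0 : (v ∘ Equiv.swap (Fin.castSucc (0 : Fin (n + 2))) (Fin.succ 0)) (Fin.last _) =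
            v (Fin.last _) := by
          simp only [Function.comp_apply]
          rw [Equiv.swap_apply_of_ne_of_ne]
          · exact fun h => by simp [Fin.ext_iff] at h
          · exact fun h => by simp [Fin.ext_iff] at h
        have ht : Fin.init (v ∘ Equiv.swap (Fin.castSucc (0 : Fin (n + 2))) (Fin.succ 0)) =
            Fin.init v ∘ Equiv.swap (Fin.castSucc (0 : Fin (n + 1))) (Fin.succ 0) := by
          funext l
          simp only [Fin.init, Function.comp_apply]
          congr 1
          rw [(Fin.castSucc_injective _).map_swap]
          rfl
        refine (iteratedFDeriv_succ_apply_right (𝕜 := ℝ) (n := n + 2) (f := f) _).trans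
          (Eq.trans ?_ (iteratedFDeriv_succ_apply_right (𝕜 := ℝ) (n := n + 2) (f := f) _).symm)
        rw [h0, ht]
        exact congrArg (fun L : E →L[ℝ] F => L (v (Fin.last _)))
          (ih (fderiv ℝ f) (hf.fderiv_right (by norm_cast)) x (Fin.init v) 0)

lemma iteratedFDeriv_comp_perm_of_contDiff {F : Type} [NormedAddCommGroup F] [NormedSpace ℝ F]
    {n : ℕ} {f : E → F} (hf : ContDiff ℝ n f) (x : E) (v : Fin n → E)
    (σ : Equiv.Perm (Fin n)) :
    iteratedFDeriv ℝ n f x (v ∘ σ) = iteratedFDeriv ℝ n f x v := by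
  cases n with
  | zero => congr 1; exact Subsingleton.elim _ _
  | succ n =>
    have hσ : σ ∈ Submonoid.closure
        (Set.range fun i : Fin n => Equiv.swap i.castSucc i.succ) := by
      rw [Equiv.Perm.mclosure_swap_castSucc_succ]; trivial
    induction hσ using Submonoid.closure_induction generalizing v with
    | mem τ hτ => obtain ⟨i, rfl⟩ := hτ; exact iteratedFDeriv_comp_swap n f hf x v i
    | one => rfl
    | mul σ τ _ _ h1 h2 =>
      have : v ∘ ⇑(σ * τ) = (v ∘ σ) ∘ τ := rfl
      rw [this, h2, h1]

end Symmetry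

/-- The coordinate directions entering the derivative `D^δ`. -/
lemma exists_perm_piecewise {n : ℕ} (s : Finset (Fin n)) :
    ∃ σ : Equiv.Perm (Fin n), ∀ i, (σ i ∈ s ↔ (i : ℕ) < s.card) := by
  have hcard : Fintype.card {i : Fin n // (i : ℕ) < s.card} = Fintype.card {i : Fin n // i ∈ s} := by
    have hle : s.card ≤ n := by simpa using Finset.card_le_univ s
    rw [Fintype.card_coe, Fintype.card_subtype]
    have : (Finset.univ.filter fun i : Fin n => (i : ℕ) < s.card).card = s.card := by
      rw [Fin.card_filter_val_lt]; omega
    exact this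
  let e := Fintype.equivOfCardEq hcard
  refine ⟨e.extendSubtype, fun i => ?_⟩
  constructor
  · intro h
    by_contra hi
    exact e.extendSubtype_not_mem i hi h
  · exact fun h => e.extendSubtype_mem i h

lemma iteratedFDeriv_piecewise {n : ℕ} {f : ℝ × ℝ → ℝ} (hf : ContDiff ℝ n f) (x : ℝ × ℝ)
    (s : Finset (Fin n)) :
    iteratedFDeriv ℝ n f x (s.piecewise (fun _ => ((1 : ℝ), (0 : ℝ))) fun _ => (0, 1)) =
      partialDeriv (s.card, n - s.card) f x := by
  obtain ⟨σ, hσ⟩ := exists_perm_piecewise s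
  rw [← iteratedFDeriv_comp_perm_of_contDiff hf x _ σ]
  have hle : s.card ≤ n := by simpa using Finset.card_le_univ s
  have h1 : ((s.piecewise (fun _ => ((1 : ℝ), (0 : ℝ))) fun _ => (0, 1)) ∘ σ) =
      fun i : Fin n => if (i : ℕ) < s.card then ((1 : ℝ), (0 : ℝ)) else ((0 : ℝ), (1 : ℝ)) := by
    funext i
    simp only [Function.comp_apply, Finset.piecewise, hσ i]
  rw [h1]
  clear h1 hσ σ
  generalize s.card = c at hle
  clear s
  obtain ⟨k, rfl⟩ : ∃ k, n = c + k := ⟨n - c, by omega⟩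
  suffices h : ∀ j, j = k → iteratedFDeriv ℝ (c + k) f x
      (fun i => if (i : ℕ) < c then ((1 : ℝ), (0 : ℝ)) else ((0 : ℝ), (1 : ℝ))) =
      partialDeriv (c, j) f x from h _ (by omega)
  rintro _ rfl
  rfl

/-! ### Full derivatives bounded by the C^m norm, and completeness of C^m(𝕋²). -/

namespace CmTorus

variable {m : ℕ}

lemma abs_partialDeriv_le (f : CmTorus m) {δ : ℕ × ℕ} (hδ : δ ∈ multiIndices m) (x : ℝ × ℝ) :
    |partialDeriv δ f x| ≤ ‖f‖ := by
  rw [norm_def]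
  refine (le_ciSup (f.bddAbove_partialDeriv hδ) x).trans ?_
  exact Finset.single_le_sum (f := fun δ => ⨆ x : ℝ × ℝ, |partialDeriv δ f x|)
    (fun δ _ => Real.iSup_nonneg fun x => abs_nonneg _) hδ

lemma zero_mem_multiIndices : ((0, 0) : ℕ × ℕ) ∈ multiIndices m := by simp [multiIndices]

lemma partialDeriv_zero (f : ℝ × ℝ → ℝ) (x : ℝ × ℝ) : partialDeriv (0, 0) f x = f x :=
  iteratedFDeriv_zero_apply _

lemma abs_apply_le (f : CmTorus m) (x : ℝ × ℝ) : |f x| ≤ ‖f‖ := by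
  have := f.abs_partialDeriv_le zero_mem_multiIndices x
  rwa [partialDeriv_zero] at this

/-- Splitting each argument into its two coordinates expands the multilinear form into 2^n terms,
each a product of coordinates times a partial derivative of order n. This is the bound that the
termwise differentiation of series requires. -/
lemma norm_iteratedFDeriv_le (f : CmTorus m) {n : ℕ} (hn : n ≤ m) (x : ℝ × ℝ) :
    ‖iteratedFDeriv ℝ n f x‖ ≤ 2 ^ n * ‖f‖ := by
  have hf : ContDiff ℝ n f := f.contDiff.of_le (by exact_mod_cast hn)
  refine ContinuousMultilinearMap.opNorm_le_bound (by positivity) fun v => ?_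
  have hv : v = (fun i => (v i).1 • ((1 : ℝ), (0 : ℝ))) + fun i => (v i).2 • ((0 : ℝ), (1 : ℝ)) := by
    funext i; ext <;> simp
  have hexp : iteratedFDeriv ℝ n f x v = ∑ s : Finset (Fin n),
      (∏ i, s.piecewise (fun i => (v i).1) (fun i => (v i).2) i) *
        partialDeriv (s.card, n - s.card) f x := by
    conv_lhs => rw [hv]
    rw [ContinuousMultilinearMap.map_add_univ]
    refine Finset.sum_congr rfl fun s _ => ?_
    rw [← iteratedFDeriv_piecewise hf, ← smul_eq_mul, ← ContinuousMultilinearMap.map_smul_univ]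
    congr 1
    funext i
    by_cases hi : i ∈ s <;> simp [hi]
  rw [hexp]
  refine (norm_sum_le _ _).trans ?_
  have hterm : ∀ s ∈ (Finset.univ : Finset (Finset (Fin n))),
      ‖(∏ i, s.piecewise (fun i => (v i).1) (fun i => (v i).2) i) *
        partialDeriv (s.card, n - s.card) f x‖ ≤ (∏ i, ‖v i‖) * ‖f‖ := by
    intro s _
    have hle : s.card ≤ n := by simpa using Finset.card_le_univ s
    rw [norm_mul, norm_prod]
    refine mul_le_mul ?_ ?_ (norm_nonneg _) (Finset.prod_nonneg fun i _ => norm_nonneg _)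
    · refine Finset.prod_le_prod (fun i _ => norm_nonneg _) fun i _ => ?_
      by_cases hi : i ∈ s
      · simpa [hi] using norm_fst_le (v i)
      · simpa [hi] using norm_snd_le (v i)
    · refine f.abs_partialDeriv_le ?_ x
      simp only [multiIndices, Finset.mem_filter, Finset.mem_product, Finset.mem_range]
      omega
  refine (Finset.sum_le_sum hterm).trans (le_of_eq ?_)
  rw [Finset.sum_const]
  simp
  ring

lemma partialDeriv_tsum (u : ℕ → CmTorus m) (hu : Summable fun n => ‖u n‖) {δ : ℕ × ℕ}
    (hδ : δ ∈ multiIndices m) (x : ℝ × ℝ) :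
    partialDeriv δ (fun y => ∑' n, u n y) x = ∑' n, partialDeriv δ (u n) x := by
  have hle : δ.1 + δ.2 ≤ m := (Finset.mem_filter.1 hδ).2
  unfold partialDeriv
  rw [iteratedFDeriv_tsum_apply (N := m) (v := fun k n => 2 ^ k * ‖u n‖) (fun n => (u n).contDiff)
    (fun k _ => hu.mul_left _)
    (fun k n y hk => (u n).norm_iteratedFDeriv_le (by exact_mod_cast hk) y)
    (by exact_mod_cast hle)]
  have hs : Summable fun n => iteratedFDeriv ℝ (δ.1 + δ.2) (u n) x :=
    .of_norm_bounded (hu.mul_left (2 ^ (δ.1 + δ.2)))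
      fun n => (u n).norm_iteratedFDeriv_le hle x
  exact (ContinuousMultilinearMap.apply ℝ (fun _ : Fin (δ.1 + δ.2) => ℝ × ℝ) ℝ
    (fun i => if (i : ℕ) < δ.1 then ((1 : ℝ), (0 : ℝ)) else ((0 : ℝ), (1 : ℝ)))).map_tsum hs

/-- The pointwise sum of an absolutely convergent series in `C^m`. -/
noncomputable def tsumFun (u : ℕ → CmTorus m) (hu : Summable fun n => ‖u n‖) : CmTorus m :=
  ⟨fun y => ∑' n, u n y, contDiff_tsum (v := fun k n => 2 ^ k * ‖u n‖) (fun n => (u n).contDiff)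
    (fun k _ => hu.mul_left _)
    (fun k n y hk => (u n).norm_iteratedFDeriv_le (by exact_mod_cast hk) y),
    fun n x => tsum_congr fun i => (u i).2.2 n x⟩

lemma partialDeriv_sum (u : ℕ → CmTorus m) (n : ℕ) {δ : ℕ × ℕ} (hδ : δ ∈ multiIndices m)
    (x : ℝ × ℝ) : partialDeriv δ (∑ i ∈ Finset.range n, u i : CmTorus m) x =
      ∑ i ∈ Finset.range n, partialDeriv δ (u i) x := by
  induction n with
  | zero =>
    have := partialDeriv_smul (m := m) 0 0 hδ x
    simpa using this
  | succ n ih => rw [Finset.sum_range_succ, Finset.sum_range_succ, partialDeriv_add _ _ hδ, ih]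

lemma norm_le_of_forall (f : CmTorus m) {c : ℝ}
    (h : ∀ δ ∈ multiIndices m, ∀ x, |partialDeriv δ f x| ≤ c) :
    ‖f‖ ≤ (multiIndices m).card * c := by
  rw [norm_def, ← nsmul_eq_mul]
  exact Finset.sum_le_card_nsmul _ _ _ fun δ hδ => ciSup_le fun x => h δ hδ x

/-- Each derivative of the remainder is the tail of the series of derivatives, hence at most the
tail of ∑ ‖u n‖; summing over the multi-indices costs a constant factor. -/
lemma tendsto_sum_tsumFun (u : ℕ → CmTorus m) (hu : Summable fun n => ‖u n‖) :
    Tendsto (fun n => ∑ i ∈ Finset.range n, u i) atTop (𝓝 (tsumFun u hu)) := by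
  rw [tendsto_iff_norm_sub_tendsto_zero]
  have h0 : Tendsto (fun n => ((multiIndices m).card : ℝ) * ∑' k, ‖u (k + n)‖) atTop (𝓝 0) := by
    have h := (tendsto_sum_nat_add fun n => ‖u n‖).const_mul ((multiIndices m).card : ℝ)
    rwa [mul_zero] at h
  refine squeeze_zero (fun _ => norm_nonneg _) (fun n => ?_) h0
  rw [norm_sub_rev]
  refine norm_le_of_forall _ fun δ hδ x => ?_
  have hs : Summable fun n => partialDeriv δ (u n) x :=
    .of_norm_bounded hu fun n => (u n).abs_partialDeriv_le hδ x
  have hsub : tsumFun u hu - ∑ i ∈ Finset.range n, u i =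
      tsumFun u hu + (-1 : ℝ) • ∑ i ∈ Finset.range n, u i := by
    rw [neg_one_smul, sub_eq_add_neg]
  rw [hsub]
  rw [partialDeriv_add _ _ hδ, partialDeriv_smul _ _ hδ, partialDeriv_sum _ _ hδ]
  have h1 : partialDeriv δ (tsumFun u hu) x = ∑' n, partialDeriv δ (u n) x :=
    partialDeriv_tsum u hu hδ x
  have h2 : Summable fun k => ‖u (k + n)‖ := (summable_nat_add_iff (f := fun k => ‖u k‖) n).2 hu
  have h3 : ‖∑' k, partialDeriv δ (u (k + n)) x‖ ≤ ∑' k, ‖u (k + n)‖ :=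
    tsum_of_norm_bounded h2.hasSum fun k => (u (k + n)).abs_partialDeriv_le hδ x
  rw [h1, ← hs.sum_add_tsum_nat_add n]
  rw [Real.norm_eq_abs] at h3
  refine le_trans (le_of_eq ?_) h3
  congr 1
  ring

instance : CompleteSpace (CmTorus m) := by
  refine NormedAddCommGroup.completeSpace_of_summable_imp_tendsto ?_
  intro u hu
  exact ⟨tsumFun u hu, tendsto_sum_tsumFun u hu⟩

end CmTorus

/-! ### Separability of C^m(𝕋²). -/

namespace CmTorus
variable {m : ℕ}

lemma continuous_partialDeriv (f : CmTorus m) {δ : ℕ × ℕ} (hδ : δ ∈ multiIndices m) :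
    Continuous (partialDeriv δ f) := by
  have h := (f.contDiff_of_mem hδ).continuous_iteratedFDeriv (m := δ.1 + δ.2) le_rfl
  exact (ContinuousMultilinearMap.apply ℝ (fun _ : Fin (δ.1 + δ.2) => ℝ × ℝ) ℝ
    (fun i => if (i : ℕ) < δ.1 then ((1 : ℝ), (0 : ℝ)) else ((0 : ℝ), (1 : ℝ)))).continuous.comp h

lemma partialDeriv_periodic (f : CmTorus m) (δ : ℕ × ℕ) (n : ℤ × ℤ) (x : ℝ × ℝ) :
    partialDeriv δ f (x + ((n.1 : ℝ), (n.2 : ℝ))) = partialDeriv δ f x := by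
  have h1 : (fun z => f.toFun (z + ((n.1 : ℝ), (n.2 : ℝ)))) = f.toFun :=
    funext fun z => f.2.2 n z
  unfold partialDeriv
  rw [← iteratedFDeriv_comp_add_right, h1]

/-- The fundamental domain `[0, 1]²`. -/
abbrev unitSquare : Set (ℝ × ℝ) := Set.Icc (0, 0) (1, 1)

lemma exists_mem_unitSquare (x : ℝ × ℝ) :
    ∃ n : ℤ × ℤ, x + ((n.1 : ℝ), (n.2 : ℝ)) ∈ unitSquare := by
  refine ⟨(-⌊x.1⌋, -⌊x.2⌋), ⟨⟨?_, ?_⟩, ⟨?_, ?_⟩⟩⟩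
  · simpa using Int.floor_le x.1
  · simpa using Int.floor_le x.2
  · have := (Int.lt_floor_add_one x.1).le
    simp only [Prod.fst_add, Int.cast_neg]; linarith
  · have := (Int.lt_floor_add_one x.2).le
    simp only [Prod.snd_add, Int.cast_neg]; linarith

lemma norm_le_of_forall_unitSquare (f : CmTorus m) {c : ℝ}
    (h : ∀ δ ∈ multiIndices m, ∀ x ∈ unitSquare, |partialDeriv δ f x| ≤ c) :
    ‖f‖ ≤ (multiIndices m).card * c := by
  refine norm_le_of_forall f fun δ hδ x => ?_
  obtain ⟨n, hn⟩ := exists_mem_unitSquare x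
  rw [← partialDeriv_periodic f δ n x]
  exact h δ hδ _ hn

/-- The restrictions of all derivatives of order at most `m` to the unit square. -/
noncomputable def jet (m : ℕ) : CmTorus m →ₗ[ℝ] (multiIndices m → C(unitSquare, ℝ)) where
  toFun f δ := ⟨fun x => partialDeriv δ f x, (f.continuous_partialDeriv δ.2).comp continuous_subtype_val⟩
  map_add' f g := by
    funext δ; ext x; exact partialDeriv_add f g δ.2 x
  map_smul' c f := by
    funext δ; ext x; exact partialDeriv_smul c f δ.2 x

lemma norm_jet_le (f : CmTorus m) : ‖jet m f‖ ≤ 1 * ‖f‖ := by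
  rw [one_mul, pi_norm_le_iff_of_nonneg (norm_nonneg f)]
  intro δ
  rw [ContinuousMap.norm_le _ (norm_nonneg f)]
  exact fun x => f.abs_partialDeriv_le δ.2 x

lemma norm_le_jet (f : CmTorus m) : ‖f‖ ≤ (multiIndices m).card * ‖jet m f‖ := by
  refine norm_le_of_forall_unitSquare f fun δ hδ x hx => ?_
  exact ((jet m f ⟨δ, hδ⟩).norm_coe_le_norm ⟨x, hx⟩).trans (norm_le_pi_norm (jet m f) ⟨δ, hδ⟩)

/-- The jet map is bi-Lipschitz into a finite product of spaces C([0,1]²), which are second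
countable, and the property passes to the induced topology. -/
instance : SecondCountableTopology (CmTorus m) := by
  have hlip : LipschitzWith 1 (jet m) :=
    AddMonoidHomClass.lipschitz_of_bound_nnnorm (jet m) 1 fun f => by
      exact_mod_cast norm_jet_le f
  have hanti : AntilipschitzWith (multiIndices m).card (jet m) :=
    AddMonoidHomClass.antilipschitz_of_bound (jet m) fun f => by
      exact_mod_cast norm_le_jet f
  exact (hanti.isUniformInducing hlip.uniformContinuous).isInducing.secondCountableTopology

end CmTorus

/-! ### Fourier modes -/

/-- The character `e^{2πi⟨k,x⟩}`. -/
noncomputable def character (k : ℤ × ℤ) (x : ℝ × ℝ) : ℂ :=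
  Complex.exp (((2 * Real.pi * (k.1 * x.1 + k.2 * x.2) : ℝ) : ℂ) * Complex.I)

lemma norm_character (k : ℤ × ℤ) (x : ℝ × ℝ) : ‖character k x‖ = 1 :=
  Complex.norm_exp_ofReal_mul_I _

lemma continuous_character (k : ℤ × ℤ) : Continuous (character k) := by
  unfold character; fun_prop

lemma character_periodic (k n : ℤ × ℤ) (x : ℝ × ℝ) :
    character k (x + ((n.1 : ℝ), (n.2 : ℝ))) = character k x := by
  unfold character
  rw [Complex.exp_eq_exp_iff_exists_int]
  refine ⟨k.1 * n.1 + k.2 * n.2, ?_⟩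
  push_cast
  simp only [Prod.fst_add, Prod.snd_add]
  push_cast
  ring

lemma iteratedDeriv_re_exp (z : ℂ) (n : ℕ) :
    iteratedDeriv n (fun s : ℝ => 2 * (z * Complex.exp ((s : ℂ) * Complex.I)).re) =
      fun s : ℝ => 2 * (z * Complex.I ^ n * Complex.exp ((s : ℂ) * Complex.I)).re := by
  induction n with
  | zero => simp
  | succ n ih =>
    rw [iteratedDeriv_succ, ih]
    funext s
    have h1 : HasDerivAt (fun s : ℝ => z * Complex.I ^ n * Complex.exp ((s : ℂ) * Complex.I))
        (z * Complex.I ^ (n + 1) * Complex.exp ((s : ℂ) * Complex.I)) s := by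
      have h2 : HasDerivAt (fun s : ℝ => (s : ℂ) * Complex.I) (1 * Complex.I) s :=
        (Complex.ofRealCLM.hasDerivAt (x := s)).mul_const Complex.I
      convert! (h2.cexp.const_mul (z * Complex.I ^ n)) using 1
      ring
    exact ((Complex.reCLM.hasFDerivAt.comp_hasDerivAt s h1).const_mul 2).deriv

/-- The wave covector `x ↦ 2π⟨k,x⟩`. -/
noncomputable def waveCovector (k : ℤ × ℤ) : ℝ × ℝ →L[ℝ] ℝ :=
  (2 * Real.pi) • ((k.1 : ℝ) • ContinuousLinearMap.fst ℝ ℝ ℝ + (k.2 : ℝ) • ContinuousLinearMap.snd ℝ ℝ ℝ)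

lemma waveCovector_apply (k : ℤ × ℤ) (x : ℝ × ℝ) :
    waveCovector k x = 2 * Real.pi * (k.1 * x.1 + k.2 * x.2) := by
  simp [waveCovector]; ring

/-- The Fourier symbol of `D^δ` at the wave vector `2πk`. -/
noncomputable def symbol (δ : ℕ × ℕ) (k : ℤ × ℤ) : ℂ :=
  Complex.I ^ (δ.1 + δ.2) * (((2 * Real.pi * k.1) ^ δ.1 * (2 * Real.pi * k.2) ^ δ.2 : ℝ) : ℂ)

/-- The real trigonometric polynomial `2 Re (z e^{2πi⟨k,x⟩})`. -/
noncomputable def modeFun (k : ℤ × ℤ) (z : ℂ) (x : ℝ × ℝ) : ℝ := 2 * (z * character k x).re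

lemma modeFun_eq_comp (k : ℤ × ℤ) (z : ℂ) : modeFun k z =
    (fun s : ℝ => 2 * (z * Complex.exp ((s : ℂ) * Complex.I)).re) ∘ waveCovector k := by
  funext x
  simp only [modeFun, character, Function.comp_apply, waveCovector_apply]

lemma contDiff_re_exp (z : ℂ) (n : WithTop ℕ∞) :
    ContDiff ℝ n (fun s : ℝ => 2 * (z * Complex.exp ((s : ℂ) * Complex.I)).re) := by
  have h1 : ContDiff ℝ n (fun s : ℝ => (s : ℂ)) := Complex.ofRealCLM.contDiff
  have h2 : ContDiff ℝ n (fun s : ℝ => z * Complex.exp ((s : ℂ) * Complex.I)) :=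
    contDiff_const.mul (h1.mul contDiff_const).cexp
  exact contDiff_const.mul (Complex.reCLM.contDiff.comp h2)

lemma contDiff_modeFun (k : ℤ × ℤ) (z : ℂ) (n : WithTop ℕ∞) : ContDiff ℝ n (modeFun k z) := by
  rw [modeFun_eq_comp]
  exact (contDiff_re_exp z n).comp (waveCovector k).contDiff

/-- The mode is a function of one variable composed with the wave covector, so each differentiation
yields a factor 2πk₁ or 2πk₂ and a factor i. -/
lemma partialDeriv_modeFun (δ : ℕ × ℕ) (k : ℤ × ℤ) (z : ℂ) (x : ℝ × ℝ) :
    partialDeriv δ (modeFun k z) x = 2 * (z * symbol δ k * character k x).re := by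
  unfold partialDeriv
  rw [modeFun_eq_comp, ContinuousLinearMap.iteratedFDeriv_comp_right (waveCovector k)
    (contDiff_re_exp z ⊤) x (by exact_mod_cast le_top)]
  rw [ContinuousMultilinearMap.compContinuousLinearMap_apply,
    iteratedFDeriv_apply_eq_iteratedDeriv_mul_prod, iteratedDeriv_re_exp]
  have hprod : ∏ i : Fin (δ.1 + δ.2), waveCovector k
      (if (i : ℕ) < δ.1 then ((1 : ℝ), (0 : ℝ)) else ((0 : ℝ), (1 : ℝ))) =
      (2 * Real.pi * k.1) ^ δ.1 * (2 * Real.pi * k.2) ^ δ.2 := by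
    rw [Fin.prod_univ_add]
    simp [waveCovector_apply]
  rw [hprod, smul_eq_mul, waveCovector_apply]
  unfold symbol character
  rw [mul_left_comm, ← Complex.re_ofReal_mul]
  congr 2
  ring

lemma modeFun_periodic (k n : ℤ × ℤ) (z : ℂ) (x : ℝ × ℝ) :
    modeFun k z (x + ((n.1 : ℝ), (n.2 : ℝ))) = modeFun k z x := by
  unfold modeFun; rw [character_periodic]

/-- The trigonometric polynomials `2 Re (z e^{2πi⟨k,x⟩})` as elements of `C^m(𝕋²)`. -/
noncomputable def mode (m : ℕ) (k : ℤ × ℤ) : ℂ →ₗ[ℝ] CmTorus m where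
  toFun z := ⟨modeFun k z, contDiff_modeFun k z _, fun n x => modeFun_periodic k n z x⟩
  map_add' z w := Subtype.ext <| funext fun x => by
    change modeFun k (z + w) x = modeFun k z x + modeFun k w x
    simp only [modeFun, add_mul, Complex.add_re]; ring
  map_smul' c z := Subtype.ext <| funext fun x => by
    change modeFun k (c • z) x = c * modeFun k z x
    simp only [modeFun, Complex.real_smul, mul_assoc, Complex.re_ofReal_mul]; ring

lemma mode_apply (m : ℕ) (k : ℤ × ℤ) (z : ℂ) (x : ℝ × ℝ) :
    (mode m k z) x = 2 * (z * character k x).re := rfl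

lemma partialDeriv_mode (m : ℕ) (δ : ℕ × ℕ) (k : ℤ × ℤ) (z : ℂ) (x : ℝ × ℝ) :
    partialDeriv δ (mode m k z) x = 2 * (z * symbol δ k * character k x).re :=
  partialDeriv_modeFun δ k z x

lemma continuous_mode (m : ℕ) (k : ℤ × ℤ) : Continuous (mode m k) :=
  LinearMap.continuous_of_finiteDimensional _

/-! ### Fourier coefficients -/

lemma exp_neg_eq_character (k : ℤ × ℤ) (x : ℝ × ℝ) :
    Complex.exp (-(2 * Real.pi * Complex.I * (k.1 * x.1 + k.2 * x.2))) = character (-k) x := by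
  unfold character
  congr 1
  simp
  ring

lemma character_mul (k l : ℤ × ℤ) (x : ℝ × ℝ) :
    character k x * character l x = character (k + l) x := by
  unfold character
  rw [← Complex.exp_add]
  congr 1
  simp
  ring

lemma conj_character (k : ℤ × ℤ) (x : ℝ × ℝ) :
    (starRingEnd ℂ) (character k x) = character (-k) x := by
  unfold character
  rw [← Complex.exp_conj, map_mul, Complex.conj_ofReal, Complex.conj_I]
  congr 1
  simp
  ring

lemma fourierCoef_eq (k : ℤ × ℤ) (f : ℝ × ℝ → ℝ) :
    fourierCoef k f =
      ∫ x in Set.Icc (0 : ℝ) 1 ×ˢ Set.Icc (0 : ℝ) 1, (f x : ℂ) * character (-k) x := by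
  unfold fourierCoef
  simp only [exp_neg_eq_character]

lemma isCompact_square : IsCompact (Set.Icc (0 : ℝ) 1 ×ˢ Set.Icc (0 : ℝ) 1) :=
  isCompact_Icc.prod isCompact_Icc

lemma volume_square : volume (Set.Icc (0 : ℝ) 1 ×ˢ Set.Icc (0 : ℝ) 1) = 1 := by
  rw [Measure.volume_eq_prod, Measure.prod_prod]; simp

lemma integrableOn_square {f : ℝ × ℝ → ℂ} (hf : Continuous f) :
    IntegrableOn f (Set.Icc (0 : ℝ) 1 ×ˢ Set.Icc (0 : ℝ) 1) :=
  hf.continuousOn.integrableOn_compact isCompact_square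

lemma CmTorus.continuous_mul_character {m : ℕ} (f : CmTorus m) (k : ℤ × ℤ) :
    Continuous fun x => (f x : ℂ) * character k x :=
  (Complex.continuous_ofReal.comp f.contDiff.continuous).mul (continuous_character k)

/-- The Fourier coefficient as a continuous linear functional on `C^m(𝕋²)`. -/
noncomputable def fourierCLM (m : ℕ) (k : ℤ × ℤ) : CmTorus m →L[ℝ] ℂ :=
  LinearMap.mkContinuous
    { toFun := fun f => fourierCoef k f
      map_add' := fun f g => by
        rw [fourierCoef_eq, fourierCoef_eq, fourierCoef_eq, ← integral_add
          (integrableOn_square (f.continuous_mul_character _))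
          (integrableOn_square (g.continuous_mul_character _))]
        congr 1
        funext x
        rw [← add_mul, ← Complex.ofReal_add]
        rfl
      map_smul' := fun c f => by
        rw [fourierCoef_eq, fourierCoef_eq, RingHom.id_apply, ← integral_smul]
        congr 1
        funext x
        rw [Complex.real_smul, ← mul_assoc, ← Complex.ofReal_mul]
        rfl } 1 fun f => by
    change ‖fourierCoef k f‖ ≤ 1 * ‖f‖
    rw [fourierCoef_eq]
    have h := norm_setIntegral_le_of_norm_le_const (μ := volume)
      (s := Set.Icc (0 : ℝ) 1 ×ˢ Set.Icc (0 : ℝ) 1)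
      (f := fun x => (f x : ℂ) * character (-k) x) (C := ‖f‖) (by rw [volume_square]; simp)
      (fun x _ => by
        rw [norm_mul, norm_character, mul_one, Complex.norm_real]
        exact f.abs_apply_le x)
    rwa [measureReal_def, volume_square, ENNReal.toReal_one, mul_one, ← one_mul ‖f‖] at h

lemma fourierCLM_apply {m : ℕ} (k : ℤ × ℤ) (f : CmTorus m) :
    fourierCLM m k f = fourierCoef k f := rfl

lemma integral_exp_two_pi (n : ℤ) :
    ∫ x in Set.Icc (0 : ℝ) 1, Complex.exp (2 * Real.pi * Complex.I * n * x) =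
      if n = 0 then 1 else 0 := by
  rw [integral_Icc_eq_integral_Ioc, ← intervalIntegral.integral_of_le zero_le_one]
  split_ifs with h
  · simp [h]
  · have hc : (2 * Real.pi * Complex.I * n : ℂ) ≠ 0 := by
      simp [h, Real.pi_ne_zero]
    rw [integral_exp_mul_complex hc]
    have : Complex.exp (2 * Real.pi * Complex.I * n * (1 : ℝ)) = 1 := by
      rw [Complex.exp_eq_one_iff]
      exact ⟨n, by push_cast; ring⟩
    rw [this]
    simp

lemma integral_character (k : ℤ × ℤ) :
    ∫ x in Set.Icc (0 : ℝ) 1 ×ˢ Set.Icc (0 : ℝ) 1, character k x = if k = 0 then 1 else 0 := by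
  have h : ∀ x : ℝ × ℝ, character k x = Complex.exp (2 * Real.pi * Complex.I * k.1 * x.1) *
      Complex.exp (2 * Real.pi * Complex.I * k.2 * x.2) := by
    intro x
    rw [← Complex.exp_add]
    unfold character
    congr 1
    push_cast
    ring
  simp only [h]
  rw [Measure.volume_eq_prod, setIntegral_prod_mul (μ := volume) (ν := volume)
    (fun x : ℝ => Complex.exp (2 * Real.pi * Complex.I * k.1 * x))
    (fun y : ℝ => Complex.exp (2 * Real.pi * Complex.I * k.2 * y)),
    integral_exp_two_pi, integral_exp_two_pi]
  rcases k with ⟨a, b⟩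
  by_cases ha : a = 0 <;> by_cases hb : b = 0 <;> simp [ha, hb]

/-- The real function 2 Re(z e_l) equals z e_l + z̄ e_{-l}, so it carries the coefficients at l and
-l at once. -/
lemma fourierCoef_mode (m : ℕ) (k l : ℤ × ℤ) (z : ℂ) :
    fourierCoef k (mode m l z) =
      (if k = l then z else 0) + (if k = -l then (starRingEnd ℂ) z else 0) := by
  rw [fourierCoef_eq]
  have h : ∀ x : ℝ × ℝ, ((mode m l z) x : ℂ) * character (-k) x =
      z * character (l - k) x + (starRingEnd ℂ) z * character (-l - k) x := by
    intro x
    rw [mode_apply]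
    have : ((2 * (z * character l x).re : ℝ) : ℂ) =
        z * character l x + (starRingEnd ℂ) z * character (-l) x := by
      rw [← conj_character, ← map_mul, Complex.add_conj]
    rw [this, add_mul, mul_assoc, mul_assoc, character_mul, character_mul]
    rfl
  simp only [h]
  rw [integral_add
    ((integrableOn_square (continuous_character _)).const_mul _)
    ((integrableOn_square (continuous_character _)).const_mul _),
    integral_const_mul, integral_const_mul, integral_character, integral_character]
  congr 1
  · by_cases hk : k = l
    · simp [hk]
    · have : l - k ≠ 0 := fun h => hk (sub_eq_zero.1 h).symm
      simp [hk, this]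
  · by_cases hk : k = -l
    · simp [hk]
    · have : -l - k ≠ 0 := fun h => hk (sub_eq_zero.1 h).symm
      simp [hk, this]

/-! ### Uniqueness of Fourier coefficients -/

/-- A continuous periodic function with summable Fourier coefficients is the pointwise sum of its
Fourier series; here all coefficients vanish. -/
lemma eq_zero_of_integral_mul_exp {g : ℝ → ℂ} (hg : Continuous g) (hper : Function.Periodic g 1)
    (h : ∀ n : ℤ, ∫ x in Set.Icc (0 : ℝ) 1,
      g x * Complex.exp (2 * Real.pi * Complex.I * n * x) = 0) (x : ℝ) : g x = 0 := by
  have : Fact ((0 : ℝ) < 1) := ⟨zero_lt_one⟩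
  let G : C(AddCircle (1 : ℝ), ℂ) := ⟨hper.lift, continuous_coinduced_dom.2 hg⟩
  have hcoef : fourierCoeff G = 0 := by
    funext n
    rw [fourierCoeff_eq_intervalIntegral _ n 0, zero_add,
      intervalIntegral.integral_of_le zero_le_one, ← integral_Icc_eq_integral_Ioc]
    have h' := h (-n)
    simp only [Pi.zero_apply]
    rw [div_one, one_smul, ← h']
    congr 1
    funext y
    rw [fourier_coe_apply, smul_eq_mul, mul_comm]
    congr 1
    simp
  have hs : Summable (fourierCoeff G) := by rw [hcoef]; exact summable_zero
  have := has_pointwise_sum_fourier_series_of_summable hs (x : AddCircle (1 : ℝ))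
  rw [hcoef] at this
  simp only [Pi.zero_apply, zero_smul] at this
  exact (hasSum_zero.unique this).symm

/-- By Fubini the one-dimensional statement applies twice: first to the partial coefficient x ↦ ∫
f(x,y) e^{2πiny} dy, then to y ↦ f(x,y) for fixed x. -/
lemma CmTorus.eq_zero_of_fourierCoef {m : ℕ} (f : CmTorus m) (h : ∀ k, fourierCoef k f = 0) :
    f = 0 := by
  have hcont : Continuous f.toFun := f.contDiff.continuous
  have hper1 : ∀ x y : ℝ, f (x + 1, y) = f (x, y) := fun x y => by
    have := f.2.2 (1, 0) (x, y)
    simp only [Int.cast_one, Int.cast_zero, Prod.mk_add_mk, add_zero] at this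
    exact this
  have hper2 : ∀ x y : ℝ, f (x, y + 1) = f (x, y) := fun x y => by
    have := f.2.2 (0, 1) (x, y)
    simp only [Int.cast_one, Int.cast_zero, Prod.mk_add_mk, add_zero] at this
    exact this
  have h2 : ∀ (n : ℤ) (x : ℝ), ∫ y in Set.Icc (0 : ℝ) 1,
      (f (x, y) : ℂ) * Complex.exp (2 * Real.pi * Complex.I * n * y) = 0 := by
    intro n
    have hunc : Continuous (Function.uncurry fun x y : ℝ =>
        (f (x, y) : ℂ) * Complex.exp (2 * Real.pi * Complex.I * n * y)) := by
      have h0 : Continuous fun p : ℝ × ℝ => f.toFun (p.1, p.2) := hcont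
      exact (Complex.continuous_ofReal.comp h0).mul (by fun_prop)
    refine eq_zero_of_integral_mul_exp
      (continuous_parametric_integral_of_continuous hunc isCompact_Icc) ?_ ?_
    · intro x
      simp only [hper1]
    · intro l
      have hk := h (-l, -n)
      rw [fourierCoef_eq, Measure.volume_eq_prod, setIntegral_prod] at hk
      · rw [← hk]
        congr 1
        funext x
        rw [← integral_mul_const]
        congr 1
        funext y
        rw [mul_assoc, ← Complex.exp_add]
        unfold character
        congr 2
        simp
        ring
      · rw [← Measure.volume_eq_prod]
        exact integrableOn_square (f.continuous_mul_character _)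
  refine Subtype.ext (funext fun p => ?_)
  have h3 := eq_zero_of_integral_mul_exp (g := fun y => (f (p.1, y) : ℂ))
    (Complex.continuous_ofReal.comp (hcont.comp (by fun_prop)))
    (fun y => by simp only [hper2]) (fun n => h2 n p.1) p.2
  exact_mod_cast h3

lemma CmTorus.ext_fourierCoef {m : ℕ} {f g : CmTorus m}
    (h : ∀ k, fourierCoef k f = fourierCoef k g) : f = g := by
  rw [← sub_eq_zero]
  refine CmTorus.eq_zero_of_fourierCoef _ fun k => ?_
  rw [← fourierCLM_apply, map_sub, fourierCLM_apply, fourierCLM_apply, h, sub_self]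

/-! ### Measurability on the path space -/

section PathSpace

variable {m : ℕ}

/-- A compact image inside an open set keeps a positive distance from the complement. A lower bound
on this distance is a closed condition in time, so it suffices to test it on a countable dense
subset of K. -/
lemma measurableSet_mapsTo {S : Type*} [MeasurableSpace S] {X : S → PathSpace m}
    (hX : ∀ t, Measurable fun ω => X ω t) {K : Set ℝ} (hK : IsCompact K) {U : Set (CmTorus m)}
    (hU : IsOpen U) : MeasurableSet {ω | Set.MapsTo (X ω) K U} := by
  obtain ⟨D, hDc, hD⟩ := TopologicalSpace.exists_countable_dense K
  have h : {ω | Set.MapsTo (X ω) K U} =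
      ⋃ n : ℕ, ⋂ q ∈ D, {ω | ((n : ENNReal) + 1)⁻¹ ≤ Metric.infEDist (X ω q) Uᶜ} := by
    ext ω
    simp only [Set.mem_ofPred_eq, Set.mem_iUnion, Set.mem_iInter]
    constructor
    · intro hm
      obtain ⟨δ, hδ, hsub⟩ := (hK.image (X ω).continuous).exists_thickening_subset_open hU
        (Set.mapsTo_iff_image_subset.1 hm)
      obtain ⟨n, hn⟩ := ENNReal.exists_inv_nat_lt (a := ENNReal.ofReal δ) (by simpa using hδ)
      refine ⟨n, fun q _ => ?_⟩
      have h1 : ((n : ENNReal) + 1)⁻¹ ≤ ENNReal.ofReal δ :=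
        (ENNReal.inv_le_inv.2 le_self_add).trans hn.le
      refine h1.trans (Metric.le_infEDist.2 fun y hy => ?_)
      by_contra hlt
      rw [not_le] at hlt
      refine hy (hsub ?_)
      rw [Metric.mem_thickening_iff]
      refine ⟨_, Set.mem_image_of_mem _ q.2, ?_⟩
      rw [edist_comm, edist_dist] at hlt
      exact (ENNReal.ofReal_lt_ofReal_iff hδ).1 hlt
    · rintro ⟨n, hn⟩ x hx
      have hc : IsClosed {q : K | ((n : ENNReal) + 1)⁻¹ ≤ Metric.infEDist (X ω q) Uᶜ} :=
        isClosed_le continuous_const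
          (Metric.continuous_infEDist.comp ((X ω).continuous.comp continuous_subtype_val))
      have hx' : (⟨x, hx⟩ : K) ∈ {q : K | ((n : ENNReal) + 1)⁻¹ ≤ Metric.infEDist (X ω q) Uᶜ} :=
        hc.closure_subset_iff.2 (fun q hq => hn q hq) (hD ⟨x, hx⟩)
      by_contra hxU
      have h0 : Metric.infEDist (X ω x) Uᶜ = 0 := Metric.infEDist_zero_of_mem hxU
      simp only [Set.mem_ofPred_eq, h0] at hx'
      simp at hx'
  rw [h]
  refine MeasurableSet.iUnion fun n => MeasurableSet.biInter hDc fun q _ => ?_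
  exact measurableSet_le measurable_const (measurable_infEDist.comp (hX q))

/-- The compact-open topology is second countable, so its Borel σ-algebra is generated by the
subbasic sets of paths mapping a compact set into an open set. -/
lemma measurable_pathSpace {S : Type*} [MeasurableSpace S] {X : S → PathSpace m}
    (hX : ∀ t, Measurable fun ω => X ω t) : Measurable X := by
  have h : (inferInstance : MeasurableSpace (PathSpace m)) = _ :=
    borel_eq_generateFrom_of_subbasis (α := PathSpace m) ContinuousMap.compactOpen_eq
  rw [measurable_iff_comap_le]
  change MeasurableSpace.comap X (inferInstance : MeasurableSpace (PathSpace m)) ≤ _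
  rw [h, ← measurable_iff_comap_le]
  refine measurable_generateFrom ?_
  rintro _ ⟨K, hK, U, hU, rfl⟩
  exact measurableSet_mapsTo hX hK hU

lemma measurable_eval (t : ℝ) : Measurable fun ψ : PathSpace m => ψ t :=
  (ContinuousEvalConst.continuous_eval_const t).measurable

lemma supNorm_eq (T₁ T₂ : ℝ) (ψ : PathSpace m) :
    supNorm T₁ T₂ ψ = ‖ψ.restrict (Set.Icc T₁ T₂)‖ := by
  rw [ContinuousMap.norm_eq_iSup_norm]; rfl

lemma continuous_supNorm (T₁ T₂ : ℝ) : Continuous fun ψ : PathSpace m => supNorm T₁ T₂ ψ := by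
  simp only [supNorm_eq]
  exact (ContinuousMap.continuous_restrict _).norm

lemma norm_le_supNorm {T₁ T₂ t : ℝ} (ht : t ∈ Set.Icc T₁ T₂) (ψ : PathSpace m) :
    ‖ψ t‖ ≤ supNorm T₁ T₂ ψ := by
  rw [supNorm_eq]
  exact (ψ.restrict (Set.Icc T₁ T₂)).norm_coe_le_norm ⟨t, ht⟩

lemma supNorm_nonneg (T₁ T₂ : ℝ) (ψ : PathSpace m) : 0 ≤ supNorm T₁ T₂ ψ :=
  Real.iSup_nonneg fun _ => norm_nonneg _

lemma supNorm_le {T₁ T₂ c : ℝ} (hc : 0 ≤ c) {ψ : PathSpace m}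
    (h : ∀ t ∈ Set.Icc T₁ T₂, ‖ψ t‖ ≤ c) : supNorm T₁ T₂ ψ ≤ c :=
  Real.iSup_le (fun s => h s s.2) hc

/-- The paths of sublinear growth. -/
def sublinearPaths (m : ℕ) : Set (PathSpace m) :=
  {ψ | ∀ δ : ℝ, 0 < δ → ∃ C : ℝ, 0 < C ∧ ∀ t : ℝ, ‖ψ t‖ ≤ δ * |t| + C}

/-- Slopes 1/(n+1), integer constants and rational times suffice, by monotonicity and continuity of
the paths. -/
lemma measurableSet_sublinearPaths : MeasurableSet (sublinearPaths m) := by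
  have h : sublinearPaths m = ⋂ n : ℕ, ⋃ C : ℕ, ⋂ q : ℚ,
      {ψ : PathSpace m | ‖ψ (q : ℝ)‖ ≤ ((n : ℝ) + 1)⁻¹ * |(q : ℝ)| + C} := by
    ext ψ
    simp only [sublinearPaths, Set.mem_ofPred_eq, Set.mem_iInter, Set.mem_iUnion]
    constructor
    · intro h n
      obtain ⟨C, -, hC⟩ := h ((n : ℝ) + 1)⁻¹ (by positivity)
      obtain ⟨N, hN⟩ := exists_nat_ge C
      exact ⟨N, fun q => (hC q).trans (by linarith)⟩
    · intro h δ hδ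
      obtain ⟨n, hn⟩ := exists_nat_one_div_lt hδ
      obtain ⟨C, hC⟩ := h n
      refine ⟨C + 1, by positivity, fun t => ?_⟩
      have hcl : IsClosed {t : ℝ | ‖ψ t‖ ≤ ((n : ℝ) + 1)⁻¹ * |t| + C} :=
        isClosed_le ψ.continuous.norm (by fun_prop)
      have ht : t ∈ {t : ℝ | ‖ψ t‖ ≤ ((n : ℝ) + 1)⁻¹ * |t| + C} :=
        hcl.closure_subset_iff.2 (by rintro _ ⟨q, rfl⟩; exact hC q) (Rat.denseRange_cast t)
      have ht' : ‖ψ t‖ ≤ ((n : ℝ) + 1)⁻¹ * |t| + C := ht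
      rw [one_div] at hn
      nlinarith [abs_nonneg t]
  rw [h]
  refine MeasurableSet.iInter fun n => MeasurableSet.iUnion fun C => MeasurableSet.iInter fun q => ?_
  exact measurableSet_le (measurable_eval _).norm measurable_const

lemma shift_apply (t : ℝ) (ψ : PathSpace m) (s : ℝ) : shift t ψ s = ψ (t + s) := rfl

lemma shift_mem_sublinearPaths {ψ : PathSpace m} (h : ψ ∈ sublinearPaths m) (t : ℝ) :
    shift t ψ ∈ sublinearPaths m := by
  intro δ hδ
  obtain ⟨C, hC, hb⟩ := h δ hδ
  refine ⟨δ * |t| + C, by positivity, fun s => ?_⟩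
  rw [shift_apply]
  have := hb (t + s)
  have h2 := abs_add_le t s
  nlinarith

lemma shift_preimage_sublinearPaths (t : ℝ) :
    shift t ⁻¹' sublinearPaths m = sublinearPaths m := by
  ext ψ
  refine ⟨fun h => ?_, fun h => shift_mem_sublinearPaths h t⟩
  have h' := shift_mem_sublinearPaths h (-t)
  have : shift (-t) (shift t ψ) = ψ := by
    ext1 s
    simp [shift_apply]
  rwa [this] at h'

lemma integrableOn_exp_mul_sq {ψ : PathSpace m} (h : ψ ∈ sublinearPaths m) {τ : ℝ} (hτ : 0 < τ) :
    IntegrableOn (fun s : ℝ => Real.exp (s / τ) * ‖ψ s‖ ^ 2) (Set.Iic 0) := by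
  -- With y = -s/(2τ) this slope gives ‖ψ s‖ ≤ y/2 + C, while e^{s/τ} = e^{-y} e^{-y}. One factor
  -- absorbs ‖ψ s‖² ≤ 2C² + y²/2 ≤ 2C² + e^y, and the other is integrable.
  obtain ⟨C, hC, hb⟩ := h (1 / (4 * τ)) (by positivity)
  have hint : IntegrableOn (fun s : ℝ => (2 * C ^ 2 + 2) * Real.exp ((2 * τ)⁻¹ * s)) (Set.Iic 0) :=
    (integrableOn_exp_mul_Iic (by positivity) 0).const_mul _
  refine hint.mono' ?_ ?_
  · have hc : Continuous fun s : ℝ => Real.exp (s / τ) * ‖ψ s‖ ^ 2 := by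
      have := ψ.continuous
      fun_prop
    exact hc.aestronglyMeasurable
  · refine (ae_restrict_mem measurableSet_Iic).mono fun s hs => ?_
    have hs0 : s ≤ 0 := hs
    rw [Real.norm_of_nonneg (by positivity)]
    set y : ℝ := -s / (2 * τ) with hy
    have hy0 : 0 ≤ y := by rw [hy]; exact div_nonneg (by linarith) (by linarith)
    have h1 : ‖ψ s‖ ≤ y / 2 + C := by
      refine (hb s).trans (le_of_eq ?_)
      rw [abs_of_nonpos hs0, hy]
      field_simp
      ring
    have h2 : ‖ψ s‖ ^ 2 ≤ 2 * C ^ 2 + y ^ 2 / 2 := by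
      have := norm_nonneg (ψ s)
      nlinarith [sq_nonneg (y / 2 - C)]
    have h3 : y ^ 2 / 2 ≤ Real.exp y := by
      have := Real.quadratic_le_exp_of_nonneg hy0
      linarith
    have h4 : Real.exp (s / τ) = Real.exp (-y) * Real.exp (-y) := by
      rw [← Real.exp_add]; congr 1; rw [hy]; field_simp; ring
    have h5 : Real.exp ((2 * τ)⁻¹ * s) = Real.exp (-y) := by
      congr 1; rw [hy]; field_simp
    have h6 : Real.exp (-y) * Real.exp y = 1 := by rw [← Real.exp_add]; simp
    have h7 : Real.exp (-y) ≤ 1 := Real.exp_le_one_iff.2 (by linarith)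
    have h8 := Real.exp_pos (-y)
    rw [h4, h5]
    have h9 : Real.exp (-y) * ‖ψ s‖ ^ 2 ≤ 2 * C ^ 2 + 2 := by
      have := mul_le_mul_of_nonneg_left (h2.trans (add_le_add_right h3 _)) h8.le
      nlinarith [sq_nonneg C]
    calc Real.exp (-y) * Real.exp (-y) * ‖ψ s‖ ^ 2
        = Real.exp (-y) * (Real.exp (-y) * ‖ψ s‖ ^ 2) := by ring
      _ ≤ Real.exp (-y) * (2 * C ^ 2 + 2) := mul_le_mul_of_nonneg_left h9 h8.le
      _ = _ := by ring

lemma measurable_integral_exp_mul_sq (τ : ℝ) : Measurable fun ψ : PathSpace m =>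
    ∫ s in Set.Iic (0 : ℝ), Real.exp (s / τ) * ‖ψ s‖ ^ 2 := by
  have h : Measurable (Function.uncurry fun (s : ℝ) (ψ : PathSpace m) =>
      Real.exp (s / τ) * ‖ψ s‖ ^ 2) := by
    refine measurable_uncurry_of_continuous_of_measurable (fun ψ => ?_) fun s => ?_
    · have := ψ.continuous
      fun_prop
    · exact ((measurable_eval s).norm.pow_const 2).const_mul _
  exact (h.comp measurable_swap).stronglyMeasurable.integral_prod_right'.measurable

end PathSpace

/-! ### Dyadic chaining -/

section Chaining

variable {d : ℕ}

/-- The dyadic point `i / 2^n`. -/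
noncomputable def dyadicPt (n : ℕ) (i : Fin d → ℕ) : Fin d → ℝ := fun j => (i j : ℝ) / 2 ^ n

/-- The indices of the dyadic points of level `n` in `[0,1)^d`. -/
def dyadicGrid (d n : ℕ) : Finset (Fin d → ℕ) := Fintype.piFinset fun _ => Finset.range (2 ^ n)

/-- The dyadic index at level `n` of the cube containing `x`. -/
noncomputable def dyadicIndex (n : ℕ) (x : Fin d → ℝ) : Fin d → ℕ := fun j => ⌊x j * 2 ^ n⌋₊

/-- Passing to the parent cube halves the index, so the dyadic approximations of a point form a
chain of parents. -/
lemma dyadicIndex_succ (n : ℕ) (x : Fin d → ℝ) :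
    dyadicIndex n x = fun j => dyadicIndex (n + 1) x j / 2 := by
  funext j
  have h := Nat.floor_div_natCast (x j * 2 ^ (n + 1)) 2
  unfold dyadicIndex
  rw [← h]
  congr 1
  push_cast
  rw [pow_succ]
  field_simp

lemma dyadicIndex_mem {x : Fin d → ℝ} (hx : ∀ j, 0 ≤ x j ∧ x j < 1) (n : ℕ) :
    dyadicIndex n x ∈ dyadicGrid d n := by
  simp only [dyadicGrid, Fintype.mem_piFinset, Finset.mem_range, dyadicIndex]
  intro j
  rw [Nat.floor_lt (by have := (hx j).1; positivity)]
  push_cast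
  nlinarith [(hx j).2, pow_pos (two_pos : (0 : ℝ) < 2) n]

lemma tendsto_dyadicPt {x : Fin d → ℝ} (hx : ∀ j, 0 ≤ x j ∧ x j < 1) :
    Tendsto (fun n => dyadicPt n (dyadicIndex n x)) atTop (𝓝 x) := by
  rw [tendsto_pi_nhds]
  intro j
  have h := (tendsto_nat_floor_mul_div_atTop (R := ℝ) (hx j).1).comp
    (tendsto_pow_atTop_atTop_of_one_lt (one_lt_two : (1 : ℝ) < 2))
  exact h

lemma dyadicPt_mem_Icc {n : ℕ} {i : Fin d → ℕ} (hi : i ∈ dyadicGrid d n) :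
    dyadicPt n i ∈ Set.Icc (0 : Fin d → ℝ) 1 := by
  simp only [dyadicGrid, Fintype.mem_piFinset, Finset.mem_range] at hi
  refine ⟨fun j => by simp only [dyadicPt, Pi.zero_apply]; positivity, fun j => ?_⟩
  simp only [dyadicPt, Pi.one_apply]
  rw [div_le_one (by positivity)]
  exact_mod_cast (hi j).le

lemma half_mem_dyadicGrid {n : ℕ} {i : Fin d → ℕ} (hi : i ∈ dyadicGrid d (n + 1)) :
    (fun j => i j / 2) ∈ dyadicGrid d n := by
  simp only [dyadicGrid, Fintype.mem_piFinset, Finset.mem_range] at hi ⊢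
  intro j
  have := hi j
  rw [pow_succ] at this
  omega

lemma norm_dyadicPt_sub_le (n : ℕ) (i : Fin d → ℕ) :
    ‖dyadicPt (n + 1) i - dyadicPt n (fun j => i j / 2)‖ ≤ (1 / 2) ^ (n + 1) := by
  rw [pi_norm_le_iff_of_nonneg (by positivity)]
  intro j
  have h : (i j : ℝ) = 2 * ((i j / 2 : ℕ) : ℝ) + ((i j % 2 : ℕ) : ℝ) := by
    exact_mod_cast (Nat.div_add_mod (i j) 2).symm
  have h2 : ((i j % 2 : ℕ) : ℝ) ≤ 1 := by
    exact_mod_cast Nat.le_of_lt_succ (Nat.mod_lt _ two_pos)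
  have h3 : (dyadicPt (n + 1) i - dyadicPt n (fun j => i j / 2)) j =
      ((i j % 2 : ℕ) : ℝ) / 2 ^ (n + 1) := by
    simp only [Pi.sub_apply, dyadicPt]
    rw [h, pow_succ]
    field_simp
    ring
  rw [h3, Real.norm_of_nonneg (by positivity), one_div, inv_pow, div_eq_mul_inv]
  exact mul_le_of_le_one_left (by positivity) h2

lemma card_dyadicGrid (d n : ℕ) : (dyadicGrid d n).card = 2 ^ (n * d) := by
  rw [dyadicGrid, Fintype.card_piFinset]; simp [pow_mul]

/-- The value at a point of the half-open cube is a telescoping sum along its dyadic ancestors,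
dominated by a geometric series; continuity passes to the limit. Points with a coordinate equal to 1
are approached by contraction towards the origin. -/
lemma abs_le_of_dyadic_increments {f : (Fin d → ℝ) → ℝ} (hf : Continuous f) {r s : ℝ}
    (hr0 : 0 ≤ r) (hr1 : r < 1) (hs : 0 ≤ s) (h0 : |f 0| ≤ s)
    (hΔ : ∀ n, ∀ i ∈ dyadicGrid d (n + 1),
      |f (dyadicPt (n + 1) i) - f (dyadicPt n fun j => i j / 2)| ≤ r ^ n * s)
    {x : Fin d → ℝ} (hx : x ∈ Set.Icc (0 : Fin d → ℝ) 1) : |f x| ≤ s * (1 + (1 - r)⁻¹) := by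
  have key : ∀ x : Fin d → ℝ, (∀ j, 0 ≤ x j ∧ x j < 1) → |f x| ≤ s * (1 + (1 - r)⁻¹) := by
    intro x hx
    have hN : ∀ N, |f (dyadicPt N (dyadicIndex N x))| ≤ s * (1 + ∑ n ∈ Finset.range N, r ^ n) := by
      intro N
      induction N with
      | zero =>
        have : dyadicPt 0 (dyadicIndex 0 x) = 0 := by
          funext j
          have : ⌊x j⌋₊ = 0 := Nat.floor_eq_zero.2 (hx j).2
          simp [dyadicPt, dyadicIndex, this]
        rw [this]
        simpa using h0
      | succ N ih =>
        have h1 := hΔ N _ (dyadicIndex_mem hx (N + 1))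
        rw [← dyadicIndex_succ] at h1
        rw [Finset.sum_range_succ]
        have h2 := abs_add_le (f (dyadicPt (N + 1) (dyadicIndex (N + 1) x)) -
          f (dyadicPt N (dyadicIndex N x))) (f (dyadicPt N (dyadicIndex N x)))
        rw [sub_add_cancel] at h2
        nlinarith
    refine le_of_tendsto ((hf.tendsto x).comp (tendsto_dyadicPt hx)).abs (.of_forall fun N => ?_)
    refine (hN N).trans (mul_le_mul_of_nonneg_left (add_le_add_right ?_ _) hs)
    rw [← tsum_geometric_of_lt_one hr0 hr1]
    exact (summable_geometric_of_lt_one hr0 hr1).sum_le_tsum _ fun _ _ => by positivity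
  have hlim : Tendsto (fun n : ℕ => f (fun j => x j * (1 - 1 / ((n : ℝ) + 1)))) atTop (𝓝 (f x)) := by
    refine (hf.tendsto x).comp (tendsto_pi_nhds.2 fun j => ?_)
    have := (tendsto_one_div_add_atTop_nhds_zero_nat (𝕜 := ℝ)).const_sub 1 |>.const_mul (x j)
    simpa using this
  refine le_of_tendsto hlim.abs (.of_forall fun n => key _ fun j => ?_)
  have h1 : 0 < 1 / ((n : ℝ) + 1) := by positivity
  have h2 : 1 / ((n : ℝ) + 1) ≤ 1 := by
    rw [div_le_one (by positivity)]; linarith [n.cast_nonneg (α := ℝ)]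
  have h3 := hx.1 j
  have h4 := hx.2 j
  simp only [Pi.zero_apply, Pi.one_apply] at h3 h4
  constructor
  · exact mul_nonneg h3 (by linarith)
  · nlinarith

/-- The sum over all dyadic increments that controls the supremum over the unit cube. -/
noncomputable def chainingSum (q : ℕ) (f : (Fin d → ℝ) → ℝ) : ENNReal :=
  ENNReal.ofReal (|f 0| ^ q) + ∑' n : ℕ, 2 ^ n * ∑ i ∈ dyadicGrid d (n + 1),
    ENNReal.ofReal (|f (dyadicPt (n + 1) i) - f (dyadicPt n fun j => i j / 2)| ^ q)

/-- The constant in the chaining bound. -/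
noncomputable def chainingConst (q : ℕ) : ℝ := (1 + (1 - (1 / 2 : ℝ) ^ (1 / (q : ℝ)))⁻¹) ^ q

lemma chainingConst_pos {q : ℕ} (hq : q ≠ 0) : 0 < chainingConst q := by
  have : (1 / 2 : ℝ) ^ (1 / (q : ℝ)) < 1 :=
    Real.rpow_lt_one (by norm_num) (by norm_num) (by positivity)
  have h2 : 0 < (1 - (1 / 2 : ℝ) ^ (1 / (q : ℝ)))⁻¹ := inv_pos.2 (by linarith)
  unfold chainingConst
  positivity

/-- If V is the chaining sum, the weight 2^n forces every increment at level n to have q-th power at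
most 2^{-n} V. This is the geometric decay of the previous bound with s = V^{1/q} and r = 2^{-1/q}.
-/
lemma ofReal_abs_pow_le_chainingSum {q : ℕ} (hq : q ≠ 0) {f : (Fin d → ℝ) → ℝ} (hf : Continuous f)
    {x : Fin d → ℝ} (hx : x ∈ Set.Icc (0 : Fin d → ℝ) 1) :
    ENNReal.ofReal (|f x| ^ q) ≤ ENNReal.ofReal (chainingConst q) * chainingSum q f := by
  by_cases htop : chainingSum q f = ⊤
  · rw [htop, ENNReal.mul_top (by simpa using chainingConst_pos hq)]
    exact le_top
  have hq' : (q : ℝ) ≠ 0 := by exact_mod_cast hq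
  set V : ℝ := (chainingSum q f).toReal with hV
  have hVeq : chainingSum q f = ENNReal.ofReal V := (ENNReal.ofReal_toReal htop).symm
  have hV0 : 0 ≤ V := ENNReal.toReal_nonneg
  set s : ℝ := V ^ (1 / (q : ℝ)) with hs
  have hs0 : 0 ≤ s := Real.rpow_nonneg hV0 _
  have hsq : s ^ q = V := by
    rw [hs, ← Real.rpow_natCast, ← Real.rpow_mul hV0, one_div, inv_mul_cancel₀ hq', Real.rpow_one]
  set r : ℝ := (1 / 2 : ℝ) ^ (1 / (q : ℝ)) with hr
  have hr0 : 0 ≤ r := by positivity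
  have hrq : r ^ q = 1 / 2 := by
    rw [hr, ← Real.rpow_natCast, ← Real.rpow_mul (by norm_num), one_div_mul_cancel hq',
      Real.rpow_one]
  have hr1 : r < 1 := Real.rpow_lt_one (by norm_num) (by norm_num) (by positivity)
  have h0 : |f 0| ≤ s := by
    have h : ENNReal.ofReal (|f 0| ^ q) ≤ ENNReal.ofReal V := by
      rw [← hVeq]; exact le_self_add
    rw [ENNReal.ofReal_le_ofReal_iff hV0, ← hsq] at h
    exact le_of_pow_le_pow_left₀ hq hs0 h
  have hΔ : ∀ n, ∀ i ∈ dyadicGrid d (n + 1),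
      |f (dyadicPt (n + 1) i) - f (dyadicPt n fun j => i j / 2)| ≤ r ^ n * s := by
    intro n i hi
    set D := |f (dyadicPt (n + 1) i) - f (dyadicPt n fun j => i j / 2)| with hD
    have h : ENNReal.ofReal (2 ^ n * D ^ q) ≤ ENNReal.ofReal V := by
      rw [← hVeq, ENNReal.ofReal_mul (by positivity), ENNReal.ofReal_pow (by norm_num)]
      refine le_trans ?_ (le_add_left (ENNReal.le_tsum n))
      rw [ENNReal.ofReal_ofNat]
      exact mul_le_mul_right (Finset.single_le_sum (f := fun i => ENNReal.ofReal
        (|f (dyadicPt (n + 1) i) - f (dyadicPt n fun j => i j / 2)| ^ q))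
        (fun _ _ => zero_le) hi) _
    rw [ENNReal.ofReal_le_ofReal_iff hV0] at h
    refine le_of_pow_le_pow_left₀ hq (by positivity) ?_
    rw [mul_pow, ← pow_mul, mul_comm n q, pow_mul, hrq, hsq]
    have h2 : (0 : ℝ) < 2 ^ n := by positivity
    rw [one_div, inv_pow, ← div_eq_inv_mul, le_div_iff₀ h2, mul_comm]
    exact h
  have h := abs_le_of_dyadic_increments hf hr0 hr1 hs0 h0 hΔ hx
  rw [hVeq, ← ENNReal.ofReal_mul (chainingConst_pos hq).le]
  refine ENNReal.ofReal_le_ofReal ?_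
  calc |f x| ^ q ≤ (s * (1 + (1 - r)⁻¹)) ^ q := pow_le_pow_left₀ (abs_nonneg _) h q
    _ = chainingConst q * V := by rw [mul_pow, hsq, chainingConst, mul_comm]

variable {S : Type*} [MeasurableSpace S] {μ : Measure S}

lemma measurable_chainingSum {f : S → (Fin d → ℝ) → ℝ} (hf : ∀ x, Measurable fun ω => f ω x)
    (q : ℕ) : Measurable fun ω => chainingSum q (f ω) := by
  unfold chainingSum
  refine Measurable.add ?_ (Measurable.tsum fun n => Measurable.const_mul (M := ENNReal) ?_ _)
  · exact ((measurable_norm.comp (hf 0)).pow_const q).ennreal_ofReal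
  · refine Finset.measurable_sum _ fun i _ => ?_
    exact ((measurable_norm.comp ((hf _).sub (hf _))).pow_const q).ennreal_ofReal

/-- Level n has 2^{(n+1)d} increments of mean at most B 2^{-(n+1)(d+2)}, and carries the weight 2^n.
One power beyond d pays for the weight and the other for the summation over levels: the contribution
is B 2^{-n}/4. -/
lemma lintegral_chainingSum_le {f : S → (Fin d → ℝ) → ℝ} (hf : ∀ x, Measurable fun ω => f ω x)
    {q : ℕ} {B : ENNReal} (h0 : ∫⁻ ω, ENNReal.ofReal (|f ω 0| ^ q) ∂μ ≤ B)
    (hinc : ∀ x ∈ Set.Icc (0 : Fin d → ℝ) 1, ∀ y ∈ Set.Icc (0 : Fin d → ℝ) 1,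
      ∫⁻ ω, ENNReal.ofReal (|f ω x - f ω y| ^ q) ∂μ ≤
        B * ENNReal.ofReal (‖x - y‖ ^ (d + 2))) :
    ∫⁻ ω, chainingSum q (f ω) ∂μ ≤ 2 * B := by
  have hmeas : ∀ n i, Measurable fun ω => ENNReal.ofReal
      (|f ω (dyadicPt (n + 1) i) - f ω (dyadicPt n fun j => i j / 2)| ^ q) := fun n i =>
    ((measurable_norm.comp ((hf _).sub (hf _))).pow_const q).ennreal_ofReal
  have hmeas0 : Measurable fun ω => ENNReal.ofReal (|f ω 0| ^ q) :=
    ((measurable_norm.comp (hf 0)).pow_const q).ennreal_ofReal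
  unfold chainingSum
  rw [lintegral_add_left hmeas0,
    lintegral_tsum fun n => ((Finset.measurable_sum _ fun i _ => hmeas n i).const_mul _).aemeasurable,
    two_mul]
  refine add_le_add h0 ?_
  have hn : ∀ n : ℕ, ∫⁻ ω, 2 ^ n * ∑ i ∈ dyadicGrid d (n + 1), ENNReal.ofReal
      (|f ω (dyadicPt (n + 1) i) - f ω (dyadicPt n fun j => i j / 2)| ^ q) ∂μ ≤
      B * ENNReal.ofReal (1 / 2 / 2 * (1 / 2) ^ n) := by
    intro n
    rw [lintegral_const_mul _ (Finset.measurable_sum _ fun i _ => hmeas n i),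
      lintegral_finsetSum _ fun i _ => hmeas n i]
    have h1 : ∀ i ∈ dyadicGrid d (n + 1), ∫⁻ ω, ENNReal.ofReal
        (|f ω (dyadicPt (n + 1) i) - f ω (dyadicPt n fun j => i j / 2)| ^ q) ∂μ ≤
        B * ENNReal.ofReal (((1 / 2) ^ (n + 1)) ^ (d + 2)) := by
      intro i hi
      refine (hinc _ (dyadicPt_mem_Icc hi) _ (dyadicPt_mem_Icc (half_mem_dyadicGrid hi))).trans ?_
      gcongr
      exact norm_dyadicPt_sub_le n i
    refine (mul_le_mul_right (Finset.sum_le_card_nsmul _ _ _ h1) _).trans (le_of_eq ?_)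
    rw [card_dyadicGrid, nsmul_eq_mul, mul_left_comm _ B, mul_left_comm _ B]
    congr 1
    have e1 : (2 : ENNReal) ^ n = ENNReal.ofReal (2 ^ n) := by
      rw [ENNReal.ofReal_pow (by norm_num), ENNReal.ofReal_ofNat]
    have e2 : (((2 ^ ((n + 1) * d) : ℕ)) : ENNReal) = ENNReal.ofReal (2 ^ ((n + 1) * d)) := by
      rw [ENNReal.ofReal_pow (by norm_num), ENNReal.ofReal_ofNat]; norm_cast
    rw [e1, e2, ← ENNReal.ofReal_mul (by positivity), ← ENNReal.ofReal_mul (by positivity)]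
    congr 1
    rw [← pow_mul, mul_add, pow_add]
    simp only [one_div, inv_pow]
    have : (2 : ℝ) ^ ((n + 1) * d) ≠ 0 := by positivity
    field_simp
    ring
  refine (ENNReal.tsum_le_tsum hn).trans ?_
  rw [ENNReal.tsum_mul_left, ← ENNReal.ofReal_tsum_of_nonneg (fun n => by positivity)
    (summable_geometric_two.mul_left _), tsum_mul_left, tsum_geometric_two]
  norm_num
  exact mul_le_of_le_one_right zero_le (by
    rw [← ENNReal.ofReal_one]; exact ENNReal.ofReal_le_ofReal (by norm_num))

/-- A quantitative Kolmogorov criterion: control of the second moment of the supremum over the unit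
cube by increment moments of order `2p`. -/
lemma exists_sq_bound_of_increments {f : S → (Fin d → ℝ) → ℝ} (hf : ∀ x, Measurable fun ω => f ω x)
    (hcont : ∀ ω, Continuous (f ω)) [IsProbabilityMeasure μ] {p : ℕ} (hp : p ≠ 0) {A C : ℝ}
    (hA : 0 < A) (hC : 0 ≤ C)
    (h0 : ∫⁻ ω, ENNReal.ofReal (|f ω 0| ^ (2 * p)) ∂μ ≤ ENNReal.ofReal (C * A ^ p))
    (hinc : ∀ x ∈ Set.Icc (0 : Fin d → ℝ) 1, ∀ y ∈ Set.Icc (0 : Fin d → ℝ) 1,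
      ∫⁻ ω, ENNReal.ofReal (|f ω x - f ω y| ^ (2 * p)) ∂μ ≤
        ENNReal.ofReal (C * A ^ p) * ENNReal.ofReal (‖x - y‖ ^ (d + 2))) :
    ∃ G : S → ENNReal, Measurable G ∧
      (∀ ω, ∀ x ∈ Set.Icc (0 : Fin d → ℝ) 1, ENNReal.ofReal (|f ω x| ^ 2) ≤ G ω) ∧
      ∫⁻ ω, G ω ∂μ ≤ ENNReal.ofReal ((1 + 2 * chainingConst (2 * p) * C) * A) := by
  have hq : 2 * p ≠ 0 := by omega
  have hK := chainingConst_pos hq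
  have hms := measurable_chainingSum hf (2 * p)
  -- From y/A ≤ 1 + (y/A)^p follows y ≤ A + A^{1-p} y^p. With y = |f|² and moments of order A^p this
  -- gives a bound linear in A, as the variance scaling requires.
  refine ⟨fun ω => ENNReal.ofReal A + ENNReal.ofReal (A / A ^ p * chainingConst (2 * p)) *
    chainingSum (2 * p) (f ω), measurable_const.add (hms.const_mul _), ?_, ?_⟩
  · intro ω x hx
    have h1 := ofReal_abs_pow_le_chainingSum hq (hcont ω) hx
    have h2 : |f ω x| ^ 2 ≤ A + A / A ^ p * |f ω x| ^ (2 * p) := by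
      rw [pow_mul]
      set y := |f ω x| ^ 2 with hy
      have hy0 : 0 ≤ y := by positivity
      have h3 : y / A ≤ 1 + (y / A) ^ p := by
        rcases le_total (y / A) 1 with h | h
        · have : 0 ≤ (y / A) ^ p := by positivity
          linarith
        · have := le_self_pow₀ h hp
          linarith
      have h4 := mul_le_mul_of_nonneg_left h3 hA.le
      rw [mul_div_cancel₀ _ hA.ne', div_pow] at h4
      refine h4.trans (le_of_eq ?_)
      field_simp
    refine (ENNReal.ofReal_le_ofReal h2).trans ?_
    have hAp : 0 ≤ A / A ^ p := by positivity
    rw [ENNReal.ofReal_add hA.le (by positivity), ENNReal.ofReal_mul hAp]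
    simp only [ENNReal.ofReal_mul hAp, mul_assoc]
    gcongr
  · rw [lintegral_add_left measurable_const, lintegral_const, measure_univ, mul_one,
      lintegral_const_mul _ hms]
    have h1 := lintegral_chainingSum_le hf h0 hinc
    have h2 : (2 : ENNReal) * ENNReal.ofReal (C * A ^ p) = ENNReal.ofReal (2 * (C * A ^ p)) := by
      rw [ENNReal.ofReal_mul (p := 2) (by norm_num), ENNReal.ofReal_ofNat]
    rw [h2] at h1
    refine (add_le_add_right (mul_le_mul_right h1 _) _).trans (le_of_eq ?_)
    rw [← ENNReal.ofReal_mul (by positivity), ← ENNReal.ofReal_add hA.le (by positivity)]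
    congr 1
    field_simp

end Chaining

/-! ### Riemann-Stieltjes integrals against an exponential -/

section Stieltjes

/-- The value `g(t) - e^{-(t-s)a} g(s) - a ∫_s^t e^{-(t-u)a} g(u) du` of the Riemann-Stieltjes
integral `∫_s^t e^{-(t-u)a} dg(u)`. -/
noncomputable def expStieltjes (a : ℝ) (g : ℝ → ℂ) (s t : ℝ) : ℂ :=
  g t - (Real.exp (-((t - s) * a)) : ℂ) * g s -
    ∫ u in s..t, ((a * Real.exp (-((t - u) * a)) : ℝ) : ℂ) * g u

lemma partition_mem_Icc {s t : ℝ} {n : ℕ} {p : ℕ → ℝ} (h0 : p 0 = s) (hn : p n = t)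
    (hp : ∀ i < n, p i ≤ p (i + 1)) {i : ℕ} (hi : i ≤ n) : p i ∈ Set.Icc s t := by
  constructor
  · induction i with
    | zero => exact h0.ge
    | succ i ih => exact (ih (by omega)).trans (hp i (by omega))
  · obtain ⟨k, rfl⟩ := Nat.exists_eq_add_of_le hi
    clear hi
    induction k with
    | zero => exact hn.le
    | succ k ih =>
      have h : ∀ j, p (i + j) ≤ p (i + (k + 1)) ∨ k + 1 < j := by
        intro j
        by_cases hj : j ≤ k + 1
        · left
          obtain ⟨l, hl⟩ := Nat.exists_eq_add_of_le hj
          rw [hl]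
          clear ih hj
          have : ∀ l', j + l' ≤ k + 1 → p (i + j) ≤ p (i + (j + l')) := by
            intro l'
            induction l' with
            | zero => intro _; exact le_rfl
            | succ l' ihl =>
              intro hle
              exact (ihl (by omega)).trans (hp (i + (j + l')) (by omega))
          exact this l (by omega)
        · right; omega
      have := (h 0).resolve_right (by omega)
      rw [hn] at this
      exact this

lemma integral_mul_exp (a t p q : ℝ) :
    ∫ u in p..q, (a * Real.exp (-((t - u) * a)) : ℝ) =
      Real.exp (-((t - q) * a)) - Real.exp (-((t - p) * a)) := by
  have hd : ∀ u ∈ Set.uIcc p q, HasDerivAt (fun u => Real.exp (-((t - u) * a)))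
      (a * Real.exp (-((t - u) * a))) u := by
    intro u _
    have h1 : HasDerivAt (fun u : ℝ => -((t - u) * a)) a u := by
      have := (((hasDerivAt_id u).const_sub t).mul_const a).fun_neg
      simpa using this
    simpa [mul_comm] using h1.exp
  exact intervalIntegral.integral_eq_sub_of_hasDerivAt hd
    ((by fun_prop : Continuous fun u => a * Real.exp (-((t - u) * a))).intervalIntegrable _ _)

lemma norm_integral_exp_mul_sub_le {a t : ℝ} (ha : 0 ≤ a) {g : ℝ → ℂ} {p q ε : ℝ}
    (hpq : p ≤ q) (hqt : q ≤ t) {c : ℂ} (hc : ∀ u ∈ Set.Icc p q, ‖g u - c‖ ≤ ε) :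
    ‖∫ u in p..q, ((a * Real.exp (-((t - u) * a)) : ℝ) : ℂ) * (g u - c)‖ ≤ a * ε * (q - p) := by
  have h := intervalIntegral.norm_integral_le_of_norm_le_const (a := p) (b := q) (C := a * ε)
    (f := fun u => ((a * Real.exp (-((t - u) * a)) : ℝ) : ℂ) * (g u - c)) (fun u hu => by
      rw [Set.uIoc_of_le hpq] at hu
      have hu' : u ∈ Set.Icc p q := ⟨hu.1.le, hu.2⟩
      rw [norm_mul, Complex.norm_real, Real.norm_of_nonneg (by positivity)]
      have h1 : Real.exp (-((t - u) * a)) ≤ 1 := by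
        rw [Real.exp_le_one_iff]
        have := mul_nonneg (sub_nonneg.2 (hu'.2.trans hqt)) ha
        linarith
      exact mul_le_mul (mul_le_of_le_one_right ha h1) (hc u hu') (norm_nonneg _) ha)
  rwa [abs_of_nonneg (sub_nonneg.2 hpq)] at h

/-- Integration by parts on one cell: the error is exactly the integral of the derivative of the
exponential against g - g(p) on [p, ξ] and against g - g(q) on [ξ, q]. Only the oscillation of g
enters, so continuity of g is enough. -/
lemma stieltjes_cell_le {a t : ℝ} (ha : 0 ≤ a) {g : ℝ → ℂ} (hg : Continuous g) {p q ξ ε : ℝ}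
    (hξ : ξ ∈ Set.Icc p q) (hqt : q ≤ t)
    (hε : ∀ u ∈ Set.Icc p q, ∀ v ∈ Set.Icc p q, ‖g u - g v‖ ≤ ε) :
    ‖(Real.exp (-((t - ξ) * a)) : ℂ) * (g q - g p) -
      ((Real.exp (-((t - q) * a)) : ℂ) * g q - (Real.exp (-((t - p) * a)) : ℂ) * g p -
        ∫ u in p..q, ((a * Real.exp (-((t - u) * a)) : ℝ) : ℂ) * g u)‖ ≤ a * ε * (q - p) := by
  have hF : Continuous fun u => ((a * Real.exp (-((t - u) * a)) : ℝ) : ℂ) := by fun_prop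
  have hsub : ∀ (x y : ℝ) (c : ℂ),
      ∫ u in x..y, ((a * Real.exp (-((t - u) * a)) : ℝ) : ℂ) * (g u - c) =
      (∫ u in x..y, ((a * Real.exp (-((t - u) * a)) : ℝ) : ℂ) * g u) -
        ((Real.exp (-((t - y) * a)) : ℂ) - (Real.exp (-((t - x) * a)) : ℂ)) * c := by
    intro x y c
    simp only [mul_sub]
    have i1 : IntervalIntegrable (fun u => ((a * Real.exp (-((t - u) * a)) : ℝ) : ℂ) * g u)
        volume x y := (hF.mul hg).intervalIntegrable _ _
    have i2 : IntervalIntegrable (fun u => ((a * Real.exp (-((t - u) * a)) : ℝ) : ℂ) * c)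
        volume x y := (hF.mul continuous_const).intervalIntegrable _ _
    rw [intervalIntegral.integral_sub i1 i2, intervalIntegral.integral_mul_const,
      intervalIntegral.integral_ofReal, integral_mul_exp]
    push_cast
    ring
  have hsplit : (∫ u in p..q, ((a * Real.exp (-((t - u) * a)) : ℝ) : ℂ) * g u) =
      (∫ u in p..ξ, ((a * Real.exp (-((t - u) * a)) : ℝ) : ℂ) * g u) +
      ∫ u in ξ..q, ((a * Real.exp (-((t - u) * a)) : ℝ) : ℂ) * g u :=
    (intervalIntegral.integral_add_adjacent_intervals ((hF.mul hg).intervalIntegrable _ _)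
      ((hF.mul hg).intervalIntegrable _ _)).symm
  have h1 := norm_integral_exp_mul_sub_le (t := t) ha (g := g) (c := g p) (ε := ε) hξ.1
    (hξ.2.trans hqt) fun u hu => hε u ⟨hu.1, hu.2.trans hξ.2⟩ p ⟨le_rfl, hξ.1.trans hξ.2⟩
  have h2 := norm_integral_exp_mul_sub_le (t := t) ha (g := g) (c := g q) (ε := ε) hξ.2 hqt
    fun u hu => hε u ⟨hξ.1.trans hu.1, hu.2⟩ q ⟨hξ.1.trans hξ.2, le_rfl⟩
  have h3 := (norm_add_le _ _).trans (add_le_add h1 h2)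
  rw [hsub, hsub] at h3
  rw [hsplit]
  refine le_trans (le_of_eq ?_) (h3.trans (le_of_eq ?_))
  · congr 1; ring
  · ring

lemma hasStieltjesIntegral_exp {a : ℝ} (ha : 0 ≤ a) {g : ℝ → ℂ} (hg : Continuous g) {s t : ℝ}
    (hst : s ≤ t) :
    HasStieltjesIntegral (fun u => Real.exp (-((t - u) * a))) g s t (expStieltjes a g s t) := by
  intro ε hε
  -- The cell errors add up to aη(t - s); the summand 1 makes the denominator positive and the final
  -- inequality strict.
  set η : ℝ := ε / (a * (t - s) + 1) with hη
  have hD : 0 < a * (t - s) + 1 := by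
    have := mul_nonneg ha (sub_nonneg.2 hst)
    linarith
  have hη0 : 0 < η := div_pos hε hD
  obtain ⟨δ, hδ, hunif⟩ := Metric.uniformContinuousOn_iff.1
    (isCompact_Icc.uniformContinuousOn_of_continuous hg.continuousOn :
      UniformContinuousOn g (Set.Icc s t)) η hη0
  refine ⟨δ, hδ, fun n p ξ h0 hn hp => ?_⟩
  have hmem : ∀ i ≤ n, p i ∈ Set.Icc s t := fun i hi =>
    partition_mem_Icc h0 hn (fun j hj => (hp j hj).1) hi
  have hF : Continuous fun u => ((a * Real.exp (-((t - u) * a)) : ℝ) : ℂ) * g u :=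
    (by fun_prop : Continuous fun u => ((a * Real.exp (-((t - u) * a)) : ℝ) : ℂ)).mul hg
  have htel : expStieltjes a g s t = ∑ i ∈ Finset.range n,
      ((Real.exp (-((t - p (i + 1)) * a)) : ℂ) * g (p (i + 1)) -
        (Real.exp (-((t - p i) * a)) : ℂ) * g (p i) -
        ∫ u in p i..p (i + 1), ((a * Real.exp (-((t - u) * a)) : ℝ) : ℂ) * g u) := by
    rw [Finset.sum_sub_distrib, intervalIntegral.sum_integral_adjacent_intervals
      fun k _ => hF.intervalIntegrable _ _,
      Finset.sum_range_sub fun i => (Real.exp (-((t - p i) * a)) : ℂ) * g (p i), h0, hn]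
    simp [expStieltjes]
  rw [htel, ← Finset.sum_sub_distrib]
  have hcell : ∀ i ∈ Finset.range n, ‖(Real.exp (-((t - ξ i) * a)) : ℂ) * (g (p (i + 1)) - g (p i)) -
      ((Real.exp (-((t - p (i + 1)) * a)) : ℂ) * g (p (i + 1)) -
        (Real.exp (-((t - p i) * a)) : ℂ) * g (p i) -
        ∫ u in p i..p (i + 1), ((a * Real.exp (-((t - u) * a)) : ℝ) : ℂ) * g u)‖ ≤
      a * η * (p (i + 1) - p i) := by
    intro i hi
    have hi' := Finset.mem_range.1 hi
    have hl := hmem i hi'.le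
    have hr := hmem (i + 1) hi'
    refine stieltjes_cell_le ha hg (hp i hi').2.2 hr.2 fun u hu v hv => ?_
    rw [← dist_eq_norm]
    refine (hunif u ⟨hl.1.trans hu.1, hu.2.trans hr.2⟩ v ⟨hl.1.trans hv.1, hv.2.trans hr.2⟩ ?_).le
    rw [Real.dist_eq, abs_lt]
    have := (hp i hi').2.1
    constructor <;> linarith [hu.1, hu.2, hv.1, hv.2]
  refine (norm_sum_le_of_le _ hcell).trans_lt ?_
  rw [← Finset.mul_sum, Finset.sum_range_sub, h0, hn]
  have : ε = η * (a * (t - s) + 1) := by rw [hη]; field_simp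
  rw [this]
  nlinarith

/-- The points of the uniform partition of `[s, t]` into `n` intervals. -/
noncomputable def uniformPt (s t : ℝ) (n i : ℕ) : ℝ := s + (t - s) * (i / n)

/-- Fixing a sequence of partitions yields uniqueness of the integral, and later writes it as a
limit of explicit linear combinations of increments of g. -/
lemma HasStieltjesIntegral.tendsto {f : ℝ → ℝ} {g : ℝ → ℂ} {s t : ℝ} (hst : s ≤ t) {I : ℂ}
    (h : HasStieltjesIntegral f g s t I) :
    Tendsto (fun n : ℕ => ∑ i ∈ Finset.range (n + 1), (f (uniformPt s t (n + 1) i) : ℂ) *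
      (g (uniformPt s t (n + 1) (i + 1)) - g (uniformPt s t (n + 1) i))) atTop (𝓝 I) := by
  rw [Metric.tendsto_atTop]
  intro ε hε
  obtain ⟨δ, hδ, hδ'⟩ := h ε hε
  obtain ⟨N, hN⟩ := exists_nat_gt ((t - s) / δ)
  refine ⟨N, fun n hn => ?_⟩
  rw [dist_eq_norm]
  have hn0 : (0 : ℝ) < (n + 1 : ℕ) := by positivity
  have hstep : ∀ i, uniformPt s t (n + 1) (i + 1) - uniformPt s t (n + 1) i =
      (t - s) / (n + 1 : ℕ) := by
    intro i
    unfold uniformPt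
    push_cast
    field_simp
    ring
  have hle : ∀ i, uniformPt s t (n + 1) i ≤ uniformPt s t (n + 1) (i + 1) := by
    intro i
    have h1 := hstep i
    have h2 : 0 ≤ (t - s) / (n + 1 : ℕ) := div_nonneg (sub_nonneg.2 hst) hn0.le
    linarith
  refine hδ' (n + 1) (uniformPt s t (n + 1)) (uniformPt s t (n + 1)) ?_ ?_ fun i _ =>
    ⟨hle i, ?_, le_rfl, hle i⟩
  · simp [uniformPt]
  · unfold uniformPt
    rw [div_self hn0.ne']
    ring
  · rw [hstep, div_lt_iff₀ hn0]
    rw [div_lt_iff₀ hδ] at hN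
    have : (N : ℝ) ≤ (n + 1 : ℕ) := by exact_mod_cast hn.trans n.le_succ
    nlinarith

lemma HasStieltjesIntegral.unique {f : ℝ → ℝ} {g : ℝ → ℂ} {s t : ℝ} (hst : s ≤ t) {I J : ℂ}
    (h : HasStieltjesIntegral f g s t I) (h' : HasStieltjesIntegral f g s t J) : I = J :=
  tendsto_nhds_unique (h.tendsto hst) (h'.tendsto hst)

end Stieltjes

/-! ### The stationary Ornstein-Uhlenbeck functional -/

section OrnsteinUhlenbeck

/-- The paths for which `∫_{-∞}^t e^{-(t-u)a} dg(u)` is defined. -/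
structure OUPath (a : ℝ) (g : ℝ → ℂ) : Prop where
  continuous : Continuous g
  integrableOn : IntegrableOn (fun u => Real.exp (a * u) * ‖g u‖) (Set.Iic 0)

/-- `∫_{-∞}^t e^{-(t-u)a} dg(u) = g(t) - a ∫_{-∞}^t e^{-(t-u)a} g(u) du`. -/
noncomputable def ou (a : ℝ) (g : ℝ → ℂ) (t : ℝ) : ℂ :=
  g t - (a * Real.exp (-(t * a)) : ℝ) * ∫ u in Set.Iic t, (Real.exp (a * u) : ℂ) * g u

variable {a : ℝ} {g : ℝ → ℂ}

lemma OUPath.integrableOn_Iic (h : OUPath a g) (t : ℝ) :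
    IntegrableOn (fun u => (Real.exp (a * u) : ℂ) * g u) (Set.Iic t) := by
  have hc : Continuous fun u => (Real.exp (a * u) : ℂ) * g u :=
    (by fun_prop : Continuous fun u => (Real.exp (a * u) : ℂ)).mul h.continuous
  have h0 : IntegrableOn (fun u => (Real.exp (a * u) : ℂ) * g u) (Set.Iic 0) := by
    refine h.integrableOn.mono' hc.aestronglyMeasurable (.of_forall fun u => le_of_eq ?_)
    rw [norm_mul, Complex.norm_real, Real.norm_of_nonneg (Real.exp_pos _).le]
  refine (h0.union (hc.integrableOn_Icc (a := 0) (b := t))).mono_set fun u hu => ?_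
  rcases le_total u 0 with h | h
  · exact Or.inl h
  · exact Or.inr ⟨h, hu⟩

/-- This is the mild equation for a single mode, obtained by splitting the integral over (-∞, t] at
s. -/
lemma OUPath.ou_eq (h : OUPath a g) (s t : ℝ) :
    ou a g t = (Real.exp (-((t - s) * a)) : ℂ) * ou a g s + expStieltjes a g s t := by
  have h1 := intervalIntegral.integral_Iic_sub_Iic (h.integrableOn_Iic s) (h.integrableOn_Iic t)
  have h2 : ∫ u in s..t, ((a * Real.exp (-((t - u) * a)) : ℝ) : ℂ) * g u =
      (a * Real.exp (-(t * a)) : ℝ) * ∫ u in s..t, (Real.exp (a * u) : ℂ) * g u := by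
    rw [← intervalIntegral.integral_const_mul]
    congr 1
    funext u
    rw [← mul_assoc, ← Complex.ofReal_mul, mul_assoc, ← Real.exp_add]
    congr 5
    ring
  have h3 : (a * Real.exp (-(t * a)) : ℝ) =
      Real.exp (-((t - s) * a)) * (a * Real.exp (-(s * a))) := by
    rw [mul_left_comm, ← Real.exp_add]
    congr 2
    ring
  unfold ou expStieltjes
  rw [h2, ← h1, h3]
  push_cast
  ring

lemma OUPath.continuous_ou (h : OUPath a g) : Continuous (ou a g) := by
  have h1 : ∀ t, (∫ u in Set.Iic t, (Real.exp (a * u) : ℂ) * g u) =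
      (∫ u in Set.Iic 0, (Real.exp (a * u) : ℂ) * g u) +
        ∫ u in (0 : ℝ)..t, (Real.exp (a * u) : ℂ) * g u := fun t => by
    rw [← intervalIntegral.integral_Iic_sub_Iic (h.integrableOn_Iic 0) (h.integrableOn_Iic t)]
    ring
  have hc : Continuous fun u => (Real.exp (a * u) : ℂ) * g u :=
    (by fun_prop : Continuous fun u => (Real.exp (a * u) : ℂ)).mul h.continuous
  have h2 : Continuous fun t => ∫ u in (0 : ℝ)..t, (Real.exp (a * u) : ℂ) * g u :=
    intervalIntegral.continuous_primitive (fun _ _ => hc.intervalIntegrable _ _) 0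
  have h3 : ou a g = fun t => g t - ((a * Real.exp (-(t * a)) : ℝ) : ℂ) *
      ((∫ u in Set.Iic 0, (Real.exp (a * u) : ℂ) * g u) +
        ∫ u in (0 : ℝ)..t, (Real.exp (a * u) : ℂ) * g u) := funext fun t => by rw [ou, h1]
  rw [h3]
  exact h.continuous.sub ((by fun_prop : Continuous fun t => ((a * Real.exp (-(t * a)) : ℝ) : ℂ)).mul
    (continuous_const.add h2))

lemma ou_conj (a : ℝ) (g : ℝ → ℂ) (t : ℝ) :
    ou a (fun u => (starRingEnd ℂ) (g u)) t = (starRingEnd ℂ) (ou a g t) := by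
  unfold ou
  rw [map_sub, map_mul, Complex.conj_ofReal, ← integral_conj]
  simp only [map_mul, Complex.conj_ofReal]

/-- The exponential distribution with parameter `1`. -/
noncomputable def expLaw : Measure ℝ :=
  (volume.restrict (Set.Ioi 0)).withDensity fun r => ENNReal.ofReal (Real.exp (-r))

instance : IsProbabilityMeasure expLaw := ⟨by
  rw [expLaw, withDensity_apply _ MeasurableSet.univ, Measure.restrict_univ,
    ← ofReal_integral_eq_lintegral_ofReal, integral_exp_neg_Ioi_zero, ENNReal.ofReal_one]
  · have := integrableOn_exp_mul_Ioi (a := -1) (by norm_num) 0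
    simp only [neg_one_mul] at this
    exact this
  · exact .of_forall fun r => (Real.exp_pos _).le⟩

lemma integrable_expLaw_iff {E : Type*} [NormedAddCommGroup E] [NormedSpace ℝ E] {f : ℝ → E} :
    Integrable f expLaw ↔ IntegrableOn (fun r => Real.exp (-r) • f r) (Set.Ioi 0) := by
  have hm : Measurable fun r : ℝ => ENNReal.ofReal (Real.exp (-r)) := by fun_prop
  rw [expLaw, integrable_withDensity_iff_integrable_smul' hm (.of_forall fun r => by simp)]
  simp only [ENNReal.toReal_ofReal (Real.exp_pos _).le]
  rfl

lemma integral_expLaw {E : Type*} [NormedAddCommGroup E] [NormedSpace ℝ E] (f : ℝ → E) :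
    ∫ r, f r ∂expLaw = ∫ r in Set.Ioi 0, Real.exp (-r) • f r := by
  have hm : Measurable fun r : ℝ => ENNReal.ofReal (Real.exp (-r)) := by fun_prop
  rw [expLaw, integral_withDensity_eq_integral_toReal_smul hm (.of_forall fun r => by simp)]
  simp only [ENNReal.toReal_ofReal (Real.exp_pos _).le]

/-- The substitution u = t - r/a turns the density a e^{-(t-u)a} on (-∞, t] into the standard
exponential density. -/
lemma OUPath.integrable_comp (ha : 0 < a) (h : OUPath a g) (t : ℝ) :
    Integrable (fun r => g (t - r / a)) expLaw ∧
      ∫ r, g (t - r / a) ∂expLaw =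
        (a * Real.exp (-(t * a)) : ℝ) * ∫ u in Set.Iic t, (Real.exp (a * u) : ℂ) * g u := by
  set F : ℝ → ℂ := fun r => (Real.exp (-r) : ℂ) * g (t - r / a) with hF
  set K : ℝ → ℂ := fun u => (Real.exp (-(t * a)) : ℂ) * ((Real.exp (a * u) : ℂ) * g u) with hK
  have hKi : IntegrableOn K (Set.Iic t) := (h.integrableOn_Iic t).const_mul _
  have hFK : ∀ v, F (a * v) = K (t - v) := by
    intro v
    simp only [hF, hK]
    rw [mul_div_cancel_left₀ _ ha.ne', ← mul_assoc, ← Complex.ofReal_mul, ← Real.exp_add]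
    congr 4
    ring
  have hmp : MeasurePreserving (fun v : ℝ => t - v) volume volume :=
    Measure.measurePreserving_sub_left volume t
  have hpre : (fun v : ℝ => t - v) ⁻¹' Set.Iic t = Set.Ici 0 := by
    ext v; simp
  have hemb : MeasurableEmbedding fun v : ℝ => t - v :=
    (Homeomorph.subLeft t).measurableEmbedding
  have hKi' : IntegrableOn (fun v => K (t - v)) (Set.Ioi 0) := by
    have := (hmp.integrableOn_comp_preimage hemb (f := K) (s := Set.Iic t)).2 hKi
    rw [hpre] at this
    exact this.mono_set Set.Ioi_subset_Ici_self
  have hKint : ∫ v in Set.Ioi 0, K (t - v) = ∫ u in Set.Iic t, K u := by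
    have := hmp.setIntegral_preimage_emb hemb K (Set.Iic t)
    rw [hpre, integral_Ici_eq_integral_Ioi] at this
    exact this
  constructor
  · rw [integrable_expLaw_iff]
    have := (integrableOn_Ioi_comp_mul_left_iff F 0 ha).1 (by simpa only [hFK] using hKi')
    rw [mul_zero] at this
    simpa only [hF, Complex.real_smul] using this
  · rw [integral_expLaw]
    have h1 := integral_comp_mul_left_Ioi' F 0 ha
    rw [mul_zero] at h1
    simp only [Complex.real_smul]
    change ∫ r in Set.Ioi 0, F r = _
    rw [← h1]
    simp only [hFK]
    rw [hKint, integral_const_mul, Complex.real_smul]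
    push_cast
    ring

/-- An average of increments over a probability measure: through Jensen's inequality, moment bounds
for increments of g become moment bounds for the functional. -/
lemma OUPath.ou_eq_integral (ha : 0 < a) (h : OUPath a g) (t : ℝ) :
    ou a g t = ∫ r, (g t - g (t - r / a)) ∂expLaw := by
  obtain ⟨h1, h2⟩ := h.integrable_comp ha t
  rw [integral_sub (integrable_const _) h1, h2, integral_const]
  simp [ou]

lemma OUPath.integrable_sub (ha : 0 < a) (h : OUPath a g) (t : ℝ) :
    Integrable (fun r => g t - g (t - r / a)) expLaw :=
  (integrable_const _).sub (h.integrable_comp ha t).1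

end OrnsteinUhlenbeck

/-! ### Linear combinations of fractional Brownian motions -/

section Gaussian

variable {S : Type*} [MeasurableSpace S] {μ : Measure S} {H : ℝ}
  {J : Type*} [Fintype J]

/-- The covariance function of fractional Brownian motion. -/
noncomputable def fbmCov (H s t : ℝ) : ℝ :=
  (1 / 2 : ℝ) * (|t| ^ (2 * H) + |s| ^ (2 * H) - |t - s| ^ (2 * H))

/-- The variance of `∑ j, w j * B (τ j)` for a fractional Brownian motion `B`. -/
noncomputable def fbmVar (H : ℝ) (w τ : J → ℝ) : ℝ := ∑ i, ∑ j, w i * w j * fbmCov H (τ i) (τ j)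

lemma fbmVar_mul (c : ℝ) (w τ : J → ℝ) : fbmVar H (fun j => c * w j) τ = c ^ 2 * fbmVar H w τ := by
  simp only [fbmVar, Finset.mul_sum]
  refine Finset.sum_congr rfl fun i _ => Finset.sum_congr rfl fun j _ => ?_
  ring

/-- The terms |τ i|^{2H} and |τ j|^{2H} of the covariance are each multiplied by the total weight
and drop out. What is left depends on time differences only, which is the source of all stationarity
below. -/
lemma fbmVar_of_sum_eq_zero {w : J → ℝ} (hw : ∑ j, w j = 0) (τ : J → ℝ) :
    fbmVar H w τ = -(1 / 2) * ∑ i, ∑ j, w i * w j * |τ j - τ i| ^ (2 * H) := by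
  have h : ∀ i j, w i * w j * fbmCov H (τ i) (τ j) =
      (1 / 2) * (w i * (w j * |τ j| ^ (2 * H))) + (1 / 2) * (w i * |τ i| ^ (2 * H)) * w j +
        -(1 / 2) * (w i * w j * |τ j - τ i| ^ (2 * H)) := fun i j => by
    unfold fbmCov; ring
  simp only [fbmVar, h, Finset.sum_add_distrib, ← Finset.mul_sum, ← Finset.sum_mul, hw]
  simp

lemma fbmVar_add_const {w : J → ℝ} (hw : ∑ j, w j = 0) (τ : J → ℝ) (r : ℝ) :
    fbmVar H w (fun j => τ j + r) = fbmVar H w τ := by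
  rw [fbmVar_of_sum_eq_zero hw, fbmVar_of_sum_eq_zero hw]
  simp

lemma fbmVar_sub (hH : H ≠ 0) (s t : ℝ) : fbmVar H ![1, -1] ![t, s] = |t - s| ^ (2 * H) := by
  rw [fbmVar_of_sum_eq_zero (by simp)]
  have h0 : (0 : ℝ) ^ (2 * H) = 0 := Real.zero_rpow (by simpa using hH)
  simp [Fin.sum_univ_two, h0, abs_sub_comm s t]
  ring

lemma IsRealFBM.hasGaussianLaw_sum {B : ℝ → S → ℝ} (hB : IsRealFBM H B μ) (w τ : J → ℝ) :
    HasGaussianLaw (fun ω => ∑ j, w j * B (τ j) ω) μ := by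
  have h := ((hB.gaussian.comp_right τ).smul w).hasGaussianLaw_fun_sum (I := Finset.univ)
  simpa using h

lemma IsRealFBM.memLp {B : ℝ → S → ℝ} (hB : IsRealFBM H B μ) (t : ℝ) : MemLp (B t) 2 μ :=
  (hB.gaussian.hasGaussianLaw_eval t).memLp_two

lemma IsRealFBM.integral_sum {B : ℝ → S → ℝ} (hB : IsRealFBM H B μ) (w τ : J → ℝ) :
    ∫ ω, ∑ j, w j * B (τ j) ω ∂μ = 0 := by
  have := hB.gaussian.isProbabilityMeasure
  rw [integral_finsetSum _ fun j _ => ((hB.memLp (τ j)).integrable (by norm_num)).const_mul _]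
  simp [integral_const_mul, hB.mean]

lemma IsRealFBM.integral_sum_sq {B : ℝ → S → ℝ} (hB : IsRealFBM H B μ) (w τ : J → ℝ) :
    ∫ ω, (∑ j, w j * B (τ j) ω) ^ 2 ∂μ = fbmVar H w τ := by
  have := hB.gaussian.isProbabilityMeasure
  have hint : ∀ i j, Integrable (fun ω => w i * w j * (B (τ j) ω * B (τ i) ω)) μ := fun i j =>
    ((hB.memLp (τ j)).integrable_mul (hB.memLp (τ i))).const_mul _
  have hexp : ∀ ω, (∑ j, w j * B (τ j) ω) ^ 2 =
      ∑ i, ∑ j, w i * w j * (B (τ j) ω * B (τ i) ω) := fun ω => by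
    rw [sq, Finset.sum_mul_sum]
    exact Finset.sum_congr rfl fun i _ => Finset.sum_congr rfl fun j _ => by ring
  simp only [hexp]
  rw [integral_finsetSum _ fun i _ => integrable_finsetSum _ fun j _ => hint i j]
  refine Finset.sum_congr rfl fun i _ => ?_
  rw [integral_finsetSum _ fun j _ => hint i j]
  refine Finset.sum_congr rfl fun j _ => ?_
  rw [integral_const_mul, hB.cov, fbmCov]

lemma IsRealFBM.variance_sum {B : ℝ → S → ℝ} (hB : IsRealFBM H B μ) (w τ : J → ℝ) :
    Var[fun ω => ∑ j, w j * B (τ j) ω; μ] = fbmVar H w τ := by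
  rw [variance_of_integral_eq_zero (hB.hasGaussianLaw_sum w τ).aemeasurable (hB.integral_sum w τ),
    hB.integral_sum_sq]

lemma sum_mul_eq_sqrt_two (w : J → ℝ) (z : J → ℝ) :
    ∑ j, w j * z j = ∑ j, ((Real.sqrt 2)⁻¹ * w j) * (Real.sqrt 2 * z j) := by
  refine Finset.sum_congr rfl fun j _ => ?_
  have : Real.sqrt 2 ≠ 0 := by positivity
  field_simp

variable {β : Mode → ℝ → S → ℂ}

lemma IsInfDimFBM.measurable_re (hβ : IsInfDimFBM H β μ) (k : Mode) (t : ℝ) :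
    Measurable fun ω => (β k t ω).re := by
  have := ((hβ.re_fbm k).measurable t).const_mul (Real.sqrt 2)⁻¹
  simpa using this

lemma IsInfDimFBM.measurable_im (hβ : IsInfDimFBM H β μ) (k : Mode) (t : ℝ) :
    Measurable fun ω => (β k t ω).im := by
  have := ((hβ.im_fbm k).measurable t).const_mul (Real.sqrt 2)⁻¹
  simpa using this

lemma IsInfDimFBM.measurable (hβ : IsInfDimFBM H β μ) (k : Mode) (t : ℝ) :
    Measurable (β k t) :=
  measurable_of_re_im (hβ.measurable_re k t) (hβ.measurable_im k t)

/-- The linear functional `∑ j, (x j Re z(τ j) + y j Im z(τ j))` of a path. -/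
noncomputable def pathFunctional (x y τ : J → ℝ) (z : ℝ → ℂ) : ℝ :=
  (∑ j, x j * (z (τ j)).re) + ∑ j, y j * (z (τ j)).im

lemma measurable_pathFunctional (x y τ : J → ℝ) : Measurable (pathFunctional x y τ) := by
  unfold pathFunctional
  fun_prop

/-- Real and imaginary parts are independent, and each is 1/√2 times a normalized fractional
Brownian motion, whence the division by 2. -/
lemma IsInfDimFBM.pathFunctional_law (hβ : IsInfDimFBM H β μ) (k : Mode) (x y τ : J → ℝ) :
    HasGaussianLaw (fun ω => pathFunctional x y τ fun t => β k t ω) μ ∧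
      (∫ ω, pathFunctional x y τ (fun t => β k t ω) ∂μ = 0) ∧
      Var[fun ω => pathFunctional x y τ fun t => β k t ω; μ] =
        (fbmVar H x τ + fbmVar H y τ) / 2 := by
  set X : S → ℝ := fun ω => ∑ j, x j * (β k (τ j) ω).re with hX
  set Y : S → ℝ := fun ω => ∑ j, y j * (β k (τ j) ω).im with hY
  have eX : X = fun ω => ∑ j, ((Real.sqrt 2)⁻¹ * x j) * (Real.sqrt 2 * (β k (τ j) ω).re) :=
    funext fun ω => sum_mul_eq_sqrt_two x _
  have eY : Y = fun ω => ∑ j, ((Real.sqrt 2)⁻¹ * y j) * (Real.sqrt 2 * (β k (τ j) ω).im) :=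
    funext fun ω => sum_mul_eq_sqrt_two y _
  have gX : HasGaussianLaw X μ := by rw [eX]; exact (hβ.re_fbm k).hasGaussianLaw_sum _ τ
  have gY : HasGaussianLaw Y μ := by rw [eY]; exact (hβ.im_fbm k).hasGaussianLaw_sum _ τ
  have mX : ∫ ω, X ω ∂μ = 0 := by rw [eX]; exact (hβ.re_fbm k).integral_sum _ τ
  have mY : ∫ ω, Y ω ∂μ = 0 := by rw [eY]; exact (hβ.im_fbm k).integral_sum _ τ
  have h2 : (Real.sqrt 2)⁻¹ ^ 2 = (1 / 2 : ℝ) := by rw [inv_pow, Real.sq_sqrt (by norm_num)]; norm_num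
  have vX : Var[X; μ] = fbmVar H x τ / 2 := by
    rw [eX, (hβ.re_fbm k).variance_sum, fbmVar_mul, h2]; ring
  have vY : Var[Y; μ] = fbmVar H y τ / 2 := by
    rw [eY, (hβ.im_fbm k).variance_sum, fbmVar_mul, h2]; ring
  have hind : IndepFun X Y μ := by
    have hm1 : Measurable fun z : ℝ → ℝ => ∑ j, x j * z (τ j) := by fun_prop
    have hm2 : Measurable fun z : ℝ → ℝ => ∑ j, y j * z (τ j) := by fun_prop
    exact (hβ.indep_re_im k).comp hm1 hm2
  refine ⟨iIndepFun.hasGaussianLaw_fun_add gX gY hind, ?_, ?_⟩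
  · change ∫ ω, (X ω + Y ω) ∂μ = 0
    rw [integral_add gX.integrable gY.integrable, mX, mY, add_zero]
  · have := hind.variance_add gX.memLp_two gY.memLp_two
    rw [vX, vY] at this
    rw [add_div]
    exact this

/-- The law of a finite linear combination of the real and imaginary parts of independent `β_k`. -/
lemma IsInfDimFBM.map_sum_pathFunctional (hβ : IsInfDimFBM H β μ) {F : Finset Mode}
    (hF : ∀ k ∈ F, k.neg ∉ F) (x y τ : Mode → J → ℝ) :
    μ.map (fun ω => ∑ k ∈ F, pathFunctional (x k) (y k) (τ k) fun t => β k t ω) =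
      gaussianReal 0 (∑ k ∈ F, (fbmVar H (x k) (τ k) + fbmVar H (y k) (τ k)) / 2).toNNReal := by
  set Y : Mode → S → ℝ := fun k ω => pathFunctional (x k) (y k) (τ k) fun t => β k t ω with hY
  have hind : iIndepFun (fun (k : F) ω => Y k ω) μ :=
    (hβ.indep (F : Set Mode) hF).comp (fun k => pathFunctional (x k) (y k) (τ k))
      fun k => measurable_pathFunctional _ _ _
  have hg : ∀ k, HasGaussianLaw (Y k) μ := fun k => (hβ.pathFunctional_law k _ _ _).1
  have e : (fun ω => ∑ k ∈ F, Y k ω) = fun ω => ∑ k : F, Y k ω :=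
    funext fun ω => (Finset.sum_coe_sort F fun k => Y k ω).symm
  have hG : HasGaussianLaw (fun ω => ∑ k ∈ F, Y k ω) μ := by
    rw [e]
    exact hind.hasGaussianLaw_fun_sum fun k => hg k
  have hmean : ∫ ω, ∑ k ∈ F, Y k ω ∂μ = 0 := by
    rw [integral_finsetSum _ fun k _ => (hg k).integrable]
    exact Finset.sum_eq_zero fun k _ => (hβ.pathFunctional_law k _ _ _).2.1
  have hvar : Var[fun ω => ∑ k ∈ F, Y k ω; μ] =
      ∑ k ∈ F, (fbmVar H (x k) (τ k) + fbmVar H (y k) (τ k)) / 2 := by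
    have h1 := IndepFun.variance_sum (X := Y) (s := F) (μ := μ) (fun k _ => (hg k).memLp_two)
      fun i hi j hj hij => hind.indepFun (i := ⟨i, hi⟩) (j := ⟨j, hj⟩) (by simpa using hij)
    have h2 : (∑ k ∈ F, Y k) = fun ω => ∑ k ∈ F, Y k ω := by
      funext ω; simp
    rw [h2] at h1
    rw [h1]
    exact Finset.sum_congr rfl fun k _ => (hβ.pathFunctional_law k _ _ _).2.2
  rw [hG.map_eq_gaussianReal, hmean, hvar]

/-! ### Moments -/

/-- The `2p`-th moment of the standard normal distribution. -/
noncomputable def gaussMoment (p : ℕ) : ℝ := ∫ x, |x| ^ (2 * p) ∂(gaussianReal 0 1)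

lemma gaussMoment_nonneg (p : ℕ) : 0 ≤ gaussMoment p := integral_nonneg fun _ => by positivity

lemma lintegral_gaussianReal_pow (p : ℕ) (v : NNReal) :
    ∫⁻ x, ENNReal.ofReal (|x| ^ (2 * p)) ∂(gaussianReal 0 v) =
      ENNReal.ofReal (gaussMoment p * (v : ℝ) ^ p) := by
  have hv : gaussianReal 0 v = (gaussianReal 0 1).map (Real.sqrt v * ·) := by
    rw [gaussianReal_map_const_mul]
    congr 1
    · simp
    · ext; simp
  have hint : Integrable (fun x : ℝ => |x| ^ (2 * p)) (gaussianReal 0 1) := by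
    have := (memLp_id_gaussianReal (μ := 0) (v := 1) ((2 * p : ℕ) : NNReal)).integrable_norm_pow'
    simpa using this
  rw [hv, lintegral_map (by fun_prop) (by fun_prop)]
  have h : ∀ x : ℝ, |Real.sqrt v * x| ^ (2 * p) = (v : ℝ) ^ p * |x| ^ (2 * p) := fun x => by
    rw [abs_mul, mul_pow, abs_of_nonneg (Real.sqrt_nonneg _), pow_mul (Real.sqrt v),
      Real.sq_sqrt (NNReal.coe_nonneg v)]
  simp only [h]
  rw [← ofReal_integral_eq_lintegral_ofReal (hint.const_mul _) (.of_forall fun x => by positivity),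
    integral_const_mul, mul_comm, gaussMoment]

lemma lintegral_pow_of_map_eq {Y : S → ℝ} (hY : Measurable Y) (p : ℕ) {v V : ℝ}
    (h : μ.map Y = gaussianReal 0 v.toNNReal) (hvV : v ≤ V) (hV : 0 ≤ V) :
    ∫⁻ ω, ENNReal.ofReal (|Y ω| ^ (2 * p)) ∂μ ≤ ENNReal.ofReal (gaussMoment p * V ^ p) := by
  have h1 := lintegral_map (μ := μ) (f := fun x : ℝ => ENNReal.ofReal (|x| ^ (2 * p)))
    (by fun_prop) hY
  rw [← h1, h, lintegral_gaussianReal_pow]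
  refine ENNReal.ofReal_le_ofReal (mul_le_mul_of_nonneg_left ?_ (gaussMoment_nonneg p))
  refine pow_le_pow_left₀ NNReal.zero_le_coe ?_ p
  rw [Real.coe_toNNReal']
  exact max_le hvV hV

/-- Jensen's inequality for an even power; if the power is not integrable, the right-hand side is
infinite. -/
lemma ofReal_abs_integral_pow_le {ν : Measure ℝ} [IsProbabilityMeasure ν] {f : ℝ → ℝ}
    (hf : Integrable f ν) (p : ℕ) :
    ENNReal.ofReal (|∫ r, f r ∂ν| ^ (2 * p)) ≤ ∫⁻ r, ENNReal.ofReal (|f r| ^ (2 * p)) ∂ν := by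
  have he : Even (2 * p) := even_two_mul p
  simp only [he.pow_abs]
  by_cases hi : Integrable (fun r => f r ^ (2 * p)) ν
  · rw [← ofReal_integral_eq_lintegral_ofReal hi (.of_forall fun r => he.pow_nonneg _)]
    refine ENNReal.ofReal_le_ofReal ?_
    exact he.convexOn_pow.map_integral_le (continuousOn_pow _) isClosed_univ (by simp) hf hi
  · have htop : ∫⁻ r, ENNReal.ofReal (f r ^ (2 * p)) ∂ν = ⊤ := by
      by_contra hne
      refine hi ⟨hf.aestronglyMeasurable.pow _, ?_⟩
      rw [hasFiniteIntegral_iff_ofReal (.of_forall fun r => he.pow_nonneg _)]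
      exact lt_top_iff_ne_top.2 hne
    rw [htop]
    exact le_top

/-- The moment `∫_0^∞ (1 + r)^{2p} e^{-r} dr`. -/
noncomputable def expMoment (p : ℕ) : ℝ := ∫ r, (1 + r) ^ (2 * p) ∂expLaw

lemma ae_expLaw_pos : ∀ᵐ r ∂expLaw, 0 < r := by
  have : expLaw ≪ volume.restrict (Set.Ioi 0) := withDensity_absolutelyContinuous _ _
  exact this.ae_le (ae_restrict_mem measurableSet_Ioi)

lemma integrable_one_add_pow_expLaw (p : ℕ) : Integrable (fun r => (1 + r) ^ (2 * p)) expLaw := by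
  rw [integrable_expLaw_iff]
  set C : ℝ := 2 ^ (2 * p) * (2 * p).factorial * Real.exp (1 / 2) with hC
  have h0 : IntegrableOn (fun r : ℝ => C * Real.exp (-(1 / 2) * r)) (Set.Ioi 0) :=
    (integrableOn_exp_mul_Ioi (by norm_num) 0).const_mul C
  refine h0.mono' (by fun_prop) ((ae_restrict_mem measurableSet_Ioi).mono fun r hr => ?_)
  have hr0 : (0 : ℝ) < r := hr
  have h1 := Real.pow_div_factorial_le_exp ((1 + r) / 2) (by linarith) (2 * p)
  rw [div_le_iff₀ (by positivity), div_pow, div_le_iff₀ (by positivity)] at h1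
  rw [smul_eq_mul, Real.norm_of_nonneg (by positivity)]
  have h2 : Real.exp (-r) * (Real.exp ((1 + r) / 2)) = Real.exp (1 / 2) * Real.exp (-(1 / 2) * r) := by
    rw [← Real.exp_add, ← Real.exp_add]; congr 1; ring
  calc Real.exp (-r) * (1 + r) ^ (2 * p)
      ≤ Real.exp (-r) * (Real.exp ((1 + r) / 2) * (2 * p).factorial * 2 ^ (2 * p)) :=
        mul_le_mul_of_nonneg_left h1 (Real.exp_pos _).le
    _ = (Real.exp (-r) * Real.exp ((1 + r) / 2)) * ((2 * p).factorial * 2 ^ (2 * p)) := by ring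
    _ = _ := by rw [h2, hC]; ring

lemma expMoment_nonneg (p : ℕ) : 0 ≤ expMoment p :=
  integral_nonneg_of_ae (ae_expLaw_pos.mono fun r hr => by
    have : 0 < 1 + r := by linarith
    simp only [Pi.zero_apply]
    positivity)

lemma pathFunctional_mul (c : ℂ) (w τ : J → ℝ) (z : ℝ → ℂ) :
    pathFunctional (fun j => c.re * w j) (fun j => -c.im * w j) τ z =
      (c * ∑ j, (w j : ℂ) * z (τ j)).re := by
  unfold pathFunctional
  rw [Finset.mul_sum, Complex.re_sum, ← Finset.sum_add_distrib]
  refine Finset.sum_congr rfl fun j _ => ?_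
  simp
  ring

/-- Moment bound for exponential averages of linear combinations of independent fractional Brownian
motions. -/
lemma IsInfDimFBM.lintegral_average_pow_le (hβ : IsInfDimFBM H β μ)
    (hcont : ∀ k ω, Continuous fun t => β k t ω)
    {F : Finset Mode} (hF : ∀ k ∈ F, k.neg ∉ F) (c : Mode → ℂ) (w : J → ℝ)
    {τ : Mode → ℝ → J → ℝ} (hτ : ∀ k, Continuous (τ k)) {V : Mode → ℝ}
    (hV : ∀ k ∈ F, ∀ r, 0 < r → fbmVar H w (τ k r) ≤ V k * (1 + r) ^ 2)
    (hint : ∀ k ∈ F, ∀ ω, Integrable (fun r => ∑ j, (w j : ℂ) * β k (τ k r j) ω) expLaw) (p : ℕ)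
    {A : ℝ} (hA : 0 ≤ A) (hAV : ∑ k ∈ F, ‖c k‖ ^ 2 * V k ≤ A) :
    ∫⁻ ω, ENNReal.ofReal (|∑ k ∈ F,
        (c k * ∫ r, ∑ j, (w j : ℂ) * β k (τ k r j) ω ∂expLaw).re| ^ (2 * p)) ∂μ ≤
      ENNReal.ofReal (gaussMoment p * expMoment p * A ^ p) := by
  have hprob : IsProbabilityMeasure μ := by
    by_contra hne
    exact hne (hβ.re_fbm ⟨(1, 0), by simp⟩).gaussian.isProbabilityMeasure
  set Y : ℝ → S → ℝ := fun r ω => ∑ k ∈ F, pathFunctional (fun j => (c k).re * w j)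
    (fun j => -(c k).im * w j) (τ k r) fun t => β k t ω with hY
  have hYeq : ∀ r ω, Y r ω = ∑ k ∈ F, (c k * ∑ j, (w j : ℂ) * β k (τ k r j) ω).re := fun r ω => by
    simp only [hY, pathFunctional_mul]
  have hYm : ∀ r, Measurable (Y r) := fun r => by
    rw [funext (hYeq r)]
    refine Finset.measurable_sum _ fun k _ => Complex.measurable_re.comp (Measurable.const_mul ?_ _)
    exact Finset.measurable_sum _ fun j _ => (hβ.measurable k _).const_mul _
  have hYc : ∀ ω, Continuous fun r => Y r ω := fun ω => by
    simp only [hYeq]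
    refine continuous_finsetSum _ fun k _ => Complex.continuous_re.comp (continuous_const.mul ?_)
    refine continuous_finsetSum _ fun j _ => continuous_const.mul ?_
    exact (hcont k ω).comp ((continuous_apply j).comp (hτ k))
  have hYu : Measurable (Function.uncurry Y) := measurable_uncurry_of_continuous_of_measurable hYc hYm
  have hYi : ∀ ω, Integrable (fun r => Y r ω) expLaw := fun ω => by
    simp only [hYeq]
    exact integrable_finsetSum _ fun k hk => ((hint k hk ω).const_mul _).re
  have hYint : ∀ ω, ∑ k ∈ F, (c k * ∫ r, ∑ j, (w j : ℂ) * β k (τ k r j) ω ∂expLaw).re =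
      ∫ r, Y r ω ∂expLaw := fun ω => by
    simp only [hYeq]
    have hre : ∀ k ∈ F, Integrable (fun r => (c k * ∑ j, (w j : ℂ) * β k (τ k r j) ω).re) expLaw :=
      fun k hk => ((hint k hk ω).const_mul _).re
    rw [integral_finsetSum _ hre]
    refine Finset.sum_congr rfl fun k hk => ?_
    rw [← integral_const_mul]
    exact (integral_re ((hint k hk ω).const_mul _)).symm
  -- For fixed r the sum is a centred Gaussian. Mode k contributes ‖c k‖² times half of `fbmVar`, so
  -- the variance is at most A(1 + r)²; the factor 1/2 is given away.
  have hbound : ∀ r, 0 < r → ∫⁻ ω, ENNReal.ofReal (|Y r ω| ^ (2 * p)) ∂μ ≤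
      ENNReal.ofReal (gaussMoment p * A ^ p * (1 + r) ^ (2 * p)) := by
    intro r hr
    refine (lintegral_pow_of_map_eq (hYm r) p (hβ.map_sum_pathFunctional hF _ _ fun k => τ k r)
      (V := A * (1 + r) ^ 2) ?_ (by positivity)).trans (le_of_eq ?_)
    · refine le_trans (Finset.sum_le_sum fun k hk => ?_)
        ((Finset.sum_mul F (fun k => ‖c k‖ ^ 2 * V k) ((1 + r) ^ 2)).symm.trans_le
          (mul_le_mul_of_nonneg_right hAV (by positivity)))
      rw [fbmVar_mul, fbmVar_mul, neg_sq, ← add_mul]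
      have h1 : (c k).re ^ 2 + (c k).im ^ 2 = ‖c k‖ ^ 2 := by
        rw [Complex.sq_norm, Complex.normSq_apply]; ring
      have h2 := hV k hk r hr
      have h3 : 0 ≤ fbmVar H w (τ k r) := by
        rw [← (hβ.re_fbm k).variance_sum]; exact variance_nonneg _ _
      rw [h1, mul_assoc]
      have h4 := mul_le_mul_of_nonneg_left h2 (sq_nonneg ‖c k‖)
      have h5 := mul_nonneg (sq_nonneg ‖c k‖) h3
      linarith
    · congr 1
      rw [mul_pow, ← pow_mul]
      ring
  simp only [hYint]
  -- Jensen in r for each ω, then Tonelli, so that the Gaussian bound is used for each fixed r.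
  calc ∫⁻ ω, ENNReal.ofReal (|∫ r, Y r ω ∂expLaw| ^ (2 * p)) ∂μ
      ≤ ∫⁻ ω, ∫⁻ r, ENNReal.ofReal (|Y r ω| ^ (2 * p)) ∂expLaw ∂μ :=
        lintegral_mono fun ω => ofReal_abs_integral_pow_le (hYi ω) p
    _ = ∫⁻ r, ∫⁻ ω, ENNReal.ofReal (|Y r ω| ^ (2 * p)) ∂μ ∂expLaw := by
        refine lintegral_lintegral_swap ?_
        have : Measurable fun q : S × ℝ => ENNReal.ofReal (|Y q.2 q.1| ^ (2 * p)) :=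
          ((measurable_norm.comp (hYu.comp measurable_swap)).pow_const _).ennreal_ofReal
        exact this.aemeasurable
    _ ≤ ∫⁻ r, ENNReal.ofReal (gaussMoment p * A ^ p * (1 + r) ^ (2 * p)) ∂expLaw :=
        lintegral_mono_ae (ae_expLaw_pos.mono hbound)
    _ = _ := by
        have hg := gaussMoment_nonneg p
        rw [← ofReal_integral_eq_lintegral_ofReal ((integrable_one_add_pow_expLaw p).const_mul _)
          (ae_expLaw_pos.mono fun r hr => by
            have : 0 < 1 + r := by linarith
            simp only [Pi.zero_apply]
            positivity), integral_const_mul, ← expMoment]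
        congr 1
        ring

end Gaussian

/-! ### The Gaussian field of a finite set of modes -/

/-- Fractional Brownian coefficients all of whose paths are regular. -/
structure IsRegularFBM {S : Type*} [MeasurableSpace S] (H : ℝ) (a : Mode → ℝ)
    (β : Mode → ℝ → S → ℂ) (μ : Measure S) : Prop extends IsInfDimFBM H β μ where
  ouPath : ∀ k ω, OUPath (a k) fun t => β k t ω
  conj_eq : ∀ k t ω, β k.neg t ω = (starRingEnd ℂ) (β k t ω)

/-! ### Variances of rectangular increments. -/

section Variance

/-- The two middle times carry equal weights. Hence the rectangular increment can be read as a
difference of increments in either of two ways. -/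
lemma fbmVar_rect_comm (H t t' s s' : ℝ) :
    fbmVar H ![1, -1, -1, 1] ![t, t', s, s'] = fbmVar H ![1, -1, -1, 1] ![t, s, t', s'] := by
  simp [fbmVar, Fin.sum_univ_four]
  ring

variable {S : Type*} [MeasurableSpace S] {μ : Measure S} {H : ℝ}

lemma IsRealFBM.fbmVar_rect_le {B : ℝ → S → ℝ} (hB : IsRealFBM H B μ) (hH : H ≠ 0)
    (t t' s s' : ℝ) : fbmVar H ![1, -1, -1, 1] ![t, t', s, s'] ≤
      2 * |t - t'| ^ (2 * H) + 2 * |s - s'| ^ (2 * H) := by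
  have e1 := hB.integral_sum_sq ![1, -1, -1, 1] ![t, t', s, s']
  have e2 := hB.integral_sum_sq ![1, -1] ![t, t']
  have e3 := hB.integral_sum_sq ![1, -1] ![s, s']
  have hprob := hB.gaussian.isProbabilityMeasure
  have i2 : Integrable (fun ω => (∑ j, ![(1 : ℝ), -1] j * B (![t, t'] j) ω) ^ 2) μ :=
    (hB.hasGaussianLaw_sum ![1, -1] ![t, t']).memLp_two.integrable_sq
  have i3 : Integrable (fun ω => (∑ j, ![(1 : ℝ), -1] j * B (![s, s'] j) ω) ^ 2) μ :=
    (hB.hasGaussianLaw_sum ![1, -1] ![s, s']).memLp_two.integrable_sq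
  rw [← e1, ← fbmVar_sub hH, ← fbmVar_sub hH, ← e2, ← e3, ← integral_const_mul,
    ← integral_const_mul, ← integral_add (i2.const_mul 2) (i3.const_mul 2)]
  refine integral_mono (hB.hasGaussianLaw_sum _ _).memLp_two.integrable_sq
    ((i2.const_mul 2).add (i3.const_mul 2)) fun ω => ?_
  simp only [Fin.sum_univ_four, Fin.sum_univ_two]
  simp
  nlinarith [sq_nonneg (B t ω - B t' ω + (B s ω - B s' ω))]

end Variance

/-- Interpolation: the smaller of D^{2H} and X^{2H} is at most D^{2γ} X^{2H-2γ}. The condition γ ≤ H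
keeps both exponents nonnegative. -/
lemma min_le_rpow_mul_rpow {H γ D X y : ℝ} (hγ : 0 < γ) (hγH : γ ≤ H) (hD : 0 ≤ D) (hX : 0 < X)
    (h1 : y ≤ 4 * D ^ (2 * H)) (h2 : y ≤ 4 * X ^ (2 * H)) :
    y ≤ 4 * D ^ (2 * γ) * X ^ (2 * H - 2 * γ) := by
  rcases le_total D X with h | h
  · refine h1.trans ?_
    rw [mul_assoc]
    refine mul_le_mul_of_nonneg_left ?_ (by norm_num)
    have : D ^ (2 * H) = D ^ (2 * γ) * D ^ (2 * H - 2 * γ) := by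
      rcases hD.eq_or_lt with rfl | hD'
      · rw [Real.zero_rpow (by linarith), Real.zero_rpow (by linarith), zero_mul]
      · rw [← Real.rpow_add hD']; congr 1; ring
    rw [this]
    exact mul_le_mul_of_nonneg_left (Real.rpow_le_rpow hD h (by linarith)) (Real.rpow_nonneg hD _)
  · refine h2.trans ?_
    rw [mul_assoc]
    refine mul_le_mul_of_nonneg_left ?_ (by norm_num)
    have : X ^ (2 * H) = X ^ (2 * γ) * X ^ (2 * H - 2 * γ) := by
      rw [← Real.rpow_add hX]; congr 1; ring
    rw [this]
    exact mul_le_mul_of_nonneg_right (Real.rpow_le_rpow hX.le h (by linarith))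
      (Real.rpow_nonneg hX.le _)

lemma div_rpow_le {r a e : ℝ} (hr : 0 < r) (ha : 0 < a) (he0 : 0 ≤ e) (he2 : e ≤ 2) :
    (r / a) ^ e ≤ a ^ (-e) * (1 + r) ^ 2 := by
  rw [Real.div_rpow hr.le ha.le, Real.rpow_neg ha.le, div_eq_inv_mul]
  refine mul_le_mul_of_nonneg_left ?_ (by positivity)
  calc r ^ e ≤ (1 + r) ^ e := Real.rpow_le_rpow hr.le (by linarith) he0
    _ ≤ (1 + r) ^ (2 : ℝ) := Real.rpow_le_rpow_of_exponent_le (by linarith) he2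
    _ = (1 + r) ^ 2 := by norm_cast

/-! ### Moments of the Ornstein-Uhlenbeck functionals and of their increments in time. -/

section Moments

variable {S : Type*} [MeasurableSpace S] {μ : Measure S} {H : ℝ} {a : Mode → ℝ}
  {β : Mode → ℝ → S → ℂ}

/-- The constant in the moment bounds for the Ornstein-Uhlenbeck functionals. -/
noncomputable def ouMoment (p : ℕ) : ℝ := gaussMoment p * expMoment p

lemma ouMoment_nonneg (p : ℕ) : 0 ≤ ouMoment p := mul_nonneg (gaussMoment_nonneg p) (expMoment_nonneg p)

lemma IsRegularFBM.lintegral_ou_pow_le (hβ : IsRegularFBM H a β μ) (hH : H ∈ Set.Ioo (0 : ℝ) 1)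
    (ha : ∀ k, 0 < a k) {F : Finset Mode} (hF : ∀ k ∈ F, k.neg ∉ F) (c : Mode → ℂ) (t : ℝ) (p : ℕ)
    {A : ℝ} (hA : 0 ≤ A) (hAV : ∑ k ∈ F, ‖c k‖ ^ 2 * a k ^ (-(2 * H)) ≤ A) :
    ∫⁻ ω, ENNReal.ofReal (|∑ k ∈ F, (c k * ou (a k) (fun u => β k u ω) t).re| ^ (2 * p)) ∂μ ≤
      ENNReal.ofReal (ouMoment p * A ^ p) := by
  have hsum : ∀ (k : Mode) (r : ℝ) (ω : S),
      ∑ j, ((![1, -1] j : ℝ) : ℂ) * β k (![t, t - r / a k] j) ω = β k t ω - β k (t - r / a k) ω := by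
    intro k r ω
    simp [Fin.sum_univ_two]
    ring
  have h := hβ.toIsInfDimFBM.lintegral_average_pow_le (fun k ω => (hβ.ouPath k ω).continuous) hF c
    ![1, -1] (τ := fun k r => ![t, t - r / a k])
    (fun k => by
      refine continuous_pi fun j => ?_
      fin_cases j
      · exact continuous_const
      · simp; fun_prop)
    (V := fun k => a k ^ (-(2 * H)))
    (fun k _ r hr => by
      rw [fbmVar_sub hH.1.ne', sub_sub_cancel, abs_of_pos (div_pos hr (ha k))]
      exact div_rpow_le hr (ha k) (by linarith [hH.1]) (by linarith [hH.2]))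
    (fun k _ ω => by
      simp only [hsum]
      exact (hβ.ouPath k ω).integrable_sub (ha k) t) p hA hAV
  simp only [hsum] at h
  simpa only [ouMoment, (hβ.ouPath _ _).ou_eq_integral (ha _)] using h

lemma IsRegularFBM.lintegral_ou_sub_pow_le (hβ : IsRegularFBM H a β μ)
    (hH : H ∈ Set.Ioo (0 : ℝ) 1) {γ : ℝ} (hγ : 0 < γ) (hγH : γ ≤ H)
    (ha : ∀ k, 0 < a k) {F : Finset Mode} (hF : ∀ k ∈ F, k.neg ∉ F) (c : Mode → ℂ) (s t : ℝ) (p : ℕ)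
    {A : ℝ} (hA : 0 ≤ A)
    (hAV : ∑ k ∈ F, ‖c k‖ ^ 2 * (4 * |t - s| ^ (2 * γ) * a k ^ (2 * γ - 2 * H)) ≤ A) :
    ∫⁻ ω, ENNReal.ofReal (|∑ k ∈ F, (c k * (ou (a k) (fun u => β k u ω) t -
      ou (a k) (fun u => β k u ω) s)).re| ^ (2 * p)) ∂μ ≤ ENNReal.ofReal (ouMoment p * A ^ p) := by
  have hsum : ∀ (k : Mode) (r : ℝ) (ω : S), ∑ j, ((![1, -1, -1, 1] j : ℝ) : ℂ) *
      β k (![t, t - r / a k, s, s - r / a k] j) ω =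
      (β k t ω - β k (t - r / a k) ω) - (β k s ω - β k (s - r / a k) ω) := by
    intro k r ω
    simp [Fin.sum_univ_four]
    ring
  have hi := fun k ω t => (hβ.ouPath k ω).integrable_sub (ha k) t
  have h := hβ.toIsInfDimFBM.lintegral_average_pow_le (fun k ω => (hβ.ouPath k ω).continuous) hF c
    ![1, -1, -1, 1] (τ := fun k r => ![t, t - r / a k, s, s - r / a k])
    (fun k => by
      refine continuous_pi fun j => ?_
      fin_cases j
      · exact continuous_const
      · simp; fun_prop
      · exact continuous_const
      · simp; fun_prop)
    (V := fun k => 4 * |t - s| ^ (2 * γ) * a k ^ (2 * γ - 2 * H))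
    (fun k _ r hr => by
      have hX := div_pos hr (ha k)
      -- Pairing each time with its own shift gives the bound by (r/a)^{2H}; pairing t with s gives
      -- the bound by |t - s|^{2H}. Interpolation trades Hölder regularity in time for powers of a.
      have h1 := (hβ.re_fbm k).fbmVar_rect_le hH.1.ne' t (t - r / a k) s (s - r / a k)
      have h2 := (hβ.re_fbm k).fbmVar_rect_le hH.1.ne' t s (t - r / a k) (s - r / a k)
      rw [← fbmVar_rect_comm, sub_sub_sub_cancel_right] at h2
      rw [sub_sub_cancel, sub_sub_cancel, abs_of_pos hX] at h1
      have h3 := min_le_rpow_mul_rpow hγ hγH (abs_nonneg (t - s)) hX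
        (h2.trans (by linarith)) (h1.trans (by linarith))
      refine h3.trans ?_
      have h4 := div_rpow_le (e := 2 * H - 2 * γ) hr (ha k) (by linarith) (by linarith [hH.2])
      rw [neg_sub] at h4
      have h5 := mul_le_mul_of_nonneg_left h4
        (by positivity : 0 ≤ 4 * |t - s| ^ (2 * γ))
      linarith)
    (fun k _ ω => by
      simp only [hsum]
      exact (hi k ω t).sub (hi k ω s)) p hA hAV
  simp only [hsum] at h
  have he : ∀ k ω, ∫ r, ((β k t ω - β k (t - r / a k) ω) - (β k s ω - β k (s - r / a k) ω)) ∂expLaw =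
      ou (a k) (fun u => β k u ω) t - ou (a k) (fun u => β k u ω) s := fun k ω => by
    rw [integral_sub (hi k ω t) (hi k ω s), (hβ.ouPath _ _).ou_eq_integral (ha _),
      (hβ.ouPath _ _).ou_eq_integral (ha _)]
  simpa only [ouMoment, he] using h

end Moments

/-! ### Bounds for the wave vectors -/

lemma Mode.one_le_length (k : Mode) : 1 ≤ k.length := by
  have h1 : (1 : ℝ) ≤ (k.1.1 : ℝ) ^ 2 + (k.1.2 : ℝ) ^ 2 := by
    have : (1 : ℤ) ≤ k.1.1 ^ 2 + k.1.2 ^ 2 := by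
      by_contra hlt
      have h0 : k.1.1 ^ 2 + k.1.2 ^ 2 = 0 := by nlinarith [sq_nonneg k.1.1, sq_nonneg k.1.2]
      have h1 : k.1.1 = 0 := by nlinarith [sq_nonneg k.1.1, sq_nonneg k.1.2]
      have h2 : k.1.2 = 0 := by nlinarith [sq_nonneg k.1.1, sq_nonneg k.1.2]
      exact k.2 (Prod.ext h1 h2)
    exact_mod_cast this
  have h2 : 1 ≤ Real.sqrt ((k.1.1 : ℝ) ^ 2 + (k.1.2 : ℝ) ^ 2) := Real.one_le_sqrt.2 h1
  unfold Mode.length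
  nlinarith [Real.pi_gt_three]

lemma Mode.abs_fst_le (k : Mode) : |2 * Real.pi * (k.1.1 : ℝ)| ≤ k.length := by
  rw [abs_mul, abs_of_pos Real.two_pi_pos]
  exact mul_le_mul_of_nonneg_left (Real.abs_le_sqrt (by nlinarith [sq_nonneg (k.1.2 : ℝ)]))
    Real.two_pi_pos.le

lemma Mode.abs_snd_le (k : Mode) : |2 * Real.pi * (k.1.2 : ℝ)| ≤ k.length := by
  rw [abs_mul, abs_of_pos Real.two_pi_pos]
  exact mul_le_mul_of_nonneg_left (Real.abs_le_sqrt (by nlinarith [sq_nonneg (k.1.1 : ℝ)]))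
    Real.two_pi_pos.le

lemma norm_symbol_le {m : ℕ} {δ : ℕ × ℕ} (hδ : δ ∈ multiIndices m) (k : Mode) :
    ‖symbol δ k.1‖ ≤ k.length ^ m := by
  have h1 := k.one_le_length
  unfold symbol
  rw [norm_mul, norm_pow, Complex.norm_I, one_pow, one_mul, Complex.norm_real, norm_mul, norm_pow,
    norm_pow, Real.norm_eq_abs, Real.norm_eq_abs]
  calc |2 * Real.pi * (k.1.1 : ℝ)| ^ δ.1 * |2 * Real.pi * (k.1.2 : ℝ)| ^ δ.2
      ≤ k.length ^ δ.1 * k.length ^ δ.2 :=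
        mul_le_mul (pow_le_pow_left₀ (abs_nonneg _) k.abs_fst_le _)
          (pow_le_pow_left₀ (abs_nonneg _) k.abs_snd_le _) (by positivity) (by positivity)
    _ = k.length ^ (δ.1 + δ.2) := (pow_add _ _ _).symm
    _ ≤ k.length ^ m := pow_le_pow_right₀ h1 (Finset.mem_filter.1 hδ).2

/-- The difference is at most 2 and at most 2L with L = |k|‖x - y‖, and min(1, L) ≤ L^γ. The 2 in
the Lipschitz bound comes from the maximum norm on ℝ × ℝ. -/
lemma norm_character_sub_le (k : Mode) {γ : ℝ} (hγ : γ ∈ Set.Ioc (0 : ℝ) 1) (x y : ℝ × ℝ) :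
    ‖character k.1 x - character k.1 y‖ ≤ 2 * (k.length * ‖x - y‖) ^ γ := by
  have hk := k.one_le_length
  set L := k.length * ‖x - y‖ with hL
  have hL0 : 0 ≤ L := by positivity
  have h2 : ‖character k.1 x - character k.1 y‖ ≤ 2 := by
    refine (norm_sub_le _ _).trans ?_
    rw [norm_character, norm_character]; norm_num
  have h1 : ‖character k.1 x - character k.1 y‖ ≤ 2 * L := by
    have e : character k.1 x = character k.1 y *
        Complex.exp (Complex.I * ((2 * Real.pi * (k.1.1 * (x - y).1 + k.1.2 * (x - y).2) : ℝ) : ℂ)) := by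
      unfold character
      rw [← Complex.exp_add]
      congr 1
      simp
      ring
    rw [e, ← mul_sub_one, norm_mul, norm_character, one_mul]
    refine Real.norm_exp_I_mul_ofReal_sub_one_le.trans ?_
    rw [Real.norm_eq_abs]
    have e2 : 2 * Real.pi * (k.1.1 * (x - y).1 + k.1.2 * (x - y).2) =
        2 * Real.pi * k.1.1 * (x - y).1 + 2 * Real.pi * k.1.2 * (x - y).2 := by ring
    rw [e2]
    refine (abs_add_le _ _).trans ?_
    rw [abs_mul (2 * Real.pi * (k.1.1 : ℝ)), abs_mul (2 * Real.pi * (k.1.2 : ℝ))]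
    have a1 := mul_le_mul k.abs_fst_le (norm_fst_le (x - y)) (norm_nonneg _) (by positivity)
    have a2 := mul_le_mul k.abs_snd_le (norm_snd_le (x - y)) (norm_nonneg _) (by positivity)
    rw [Real.norm_eq_abs] at a1 a2
    linarith
  rcases le_total L 1 with h | h
  · refine h1.trans (mul_le_mul_of_nonneg_left ?_ (by norm_num))
    rcases hL0.eq_or_lt with h0 | h0
    · rw [← h0, Real.zero_rpow hγ.1.ne']
    · have := Real.rpow_le_rpow_of_exponent_ge h0 h hγ.2
      rwa [Real.rpow_one] at this
  · have := Real.one_le_rpow h hγ.1.le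
    linarith

/-! ### The random field of a finite set of modes -/

lemma CmTorus.partialDeriv_finsetSum {m : ℕ} {ι : Type*} (u : ι → CmTorus m) (F : Finset ι)
    {δ : ℕ × ℕ} (hδ : δ ∈ multiIndices m) (x : ℝ × ℝ) :
    partialDeriv δ (∑ i ∈ F, u i : CmTorus m) x = ∑ i ∈ F, partialDeriv δ (u i) x := by
  classical
  induction F using Finset.induction_on with
  | empty =>
    have := partialDeriv_smul (m := m) 0 0 hδ x
    simpa using this
  | insert i F hi ih => rw [Finset.sum_insert hi, Finset.sum_insert hi, partialDeriv_add _ _ hδ, ih]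

/-- The path `t ↦ ∑_{k ∈ F} 2 Re (σ_k Z_k(t) e_k)` for the Ornstein-Uhlenbeck paths `Z_k`. -/
noncomputable def field (m : ℕ) (σ : Mode → ℝ) {a : Mode → ℝ} {b : Mode → ℝ → ℂ}
    (h : ∀ k, OUPath (a k) (b k)) (F : Finset Mode) : PathSpace m where
  toFun t := ∑ k ∈ F, mode m k.1 (σ k * ou (a k) (b k) t)
  continuous_toFun := continuous_finsetSum _ fun k _ =>
    (continuous_mode m k.1).comp (continuous_const.mul (h k).continuous_ou)

lemma field_apply (m : ℕ) (σ : Mode → ℝ) {a : Mode → ℝ} {b : Mode → ℝ → ℂ}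
    (h : ∀ k, OUPath (a k) (b k)) (F : Finset Mode) (t : ℝ) :
    field m σ h F t = ∑ k ∈ F, mode m k.1 (σ k * ou (a k) (b k) t) := rfl

/-- The coefficients of `D^δ` of the field at the point `x`. -/
noncomputable def fieldCoef (σ : Mode → ℝ) (δ : ℕ × ℕ) (x : ℝ × ℝ) (k : Mode) : ℂ :=
  2 * (σ k * symbol δ k.1 * character k.1 x)

lemma partialDeriv_field {m : ℕ} (σ : Mode → ℝ) {a : Mode → ℝ} {b : Mode → ℝ → ℂ}
    (h : ∀ k, OUPath (a k) (b k)) (F : Finset Mode) (t : ℝ) {δ : ℕ × ℕ} (hδ : δ ∈ multiIndices m)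
    (x : ℝ × ℝ) : partialDeriv δ (field m σ h F t) x =
      ∑ k ∈ F, (fieldCoef σ δ x k * ou (a k) (b k) t).re := by
  rw [field_apply, CmTorus.partialDeriv_finsetSum _ _ hδ]
  refine Finset.sum_congr rfl fun k _ => ?_
  have h2 : ∀ z : ℂ, (2 * z).re = 2 * z.re := fun z => by simp
  rw [partialDeriv_mode, fieldCoef, mul_assoc 2, h2]
  congr 2
  ring

/-- The weights that control the field in `C^m`. -/
noncomputable def weight (H γ : ℝ) (m : ℕ) (a σ : Mode → ℝ) (k : Mode) : ℝ :=
  σ k ^ 2 * (k.length ^ m) ^ 2 * (a k ^ (-(2 * H)) * (k.length ^ γ) ^ 2 + a k ^ (2 * γ - 2 * H))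

lemma weight_nonneg {H γ : ℝ} {m : ℕ} {a σ : Mode → ℝ} (ha : ∀ k, 0 < a k) (k : Mode) :
    0 ≤ weight H γ m a σ k := by
  have h1 := Real.rpow_pos_of_pos (ha k) (-(2 * H))
  have h2 := Real.rpow_pos_of_pos (ha k) (2 * γ - 2 * H)
  unfold weight
  positivity

lemma norm_fieldCoef_sq_le {m : ℕ} (σ : Mode → ℝ) {δ : ℕ × ℕ} (hδ : δ ∈ multiIndices m)
    (x : ℝ × ℝ) (k : Mode) : ‖fieldCoef σ δ x k‖ ^ 2 ≤ 4 * (σ k ^ 2 * (k.length ^ m) ^ 2) := by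
  have h1 := norm_symbol_le hδ k
  have h2 := pow_le_pow_left₀ (norm_nonneg _) h1 2
  have h3 : ‖fieldCoef σ δ x k‖ ^ 2 = 4 * (σ k ^ 2 * ‖symbol δ k.1‖ ^ 2) := by
    rw [fieldCoef, norm_mul, norm_mul, norm_mul, norm_character, Complex.norm_real,
      Real.norm_eq_abs, mul_one, mul_pow, mul_pow, sq_abs]
    norm_num
  rw [h3]
  have := mul_le_mul_of_nonneg_left h2 (sq_nonneg (σ k))
  linarith

lemma norm_fieldCoef_sub_sq_le {m : ℕ} (σ : Mode → ℝ) {δ : ℕ × ℕ} (hδ : δ ∈ multiIndices m)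
    {γ : ℝ} (hγ : γ ∈ Set.Ioc (0 : ℝ) 1) (x y : ℝ × ℝ) (k : Mode) :
    ‖fieldCoef σ δ x k - fieldCoef σ δ y k‖ ^ 2 ≤
      16 * (σ k ^ 2 * (k.length ^ m) ^ 2) * ((k.length ^ γ) ^ 2 * ‖x - y‖ ^ (2 * γ)) := by
  have h1 := norm_symbol_le hδ k
  have h2 := pow_le_pow_left₀ (norm_nonneg _) h1 2
  have h3 : ‖fieldCoef σ δ x k - fieldCoef σ δ y k‖ ^ 2 =
      4 * (σ k ^ 2 * ‖symbol δ k.1‖ ^ 2) * ‖character k.1 x - character k.1 y‖ ^ 2 := by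
    rw [fieldCoef, fieldCoef, ← mul_sub, ← mul_sub, norm_mul, norm_mul, norm_mul,
      Complex.norm_real, Real.norm_eq_abs, mul_pow, mul_pow, mul_pow, sq_abs]
    norm_num
    ring
  have h4 := pow_le_pow_left₀ (norm_nonneg _) (norm_character_sub_le k hγ x y) 2
  have hk := k.one_le_length
  have h5 : (2 * (k.length * ‖x - y‖) ^ γ) ^ 2 = 4 * ((k.length ^ γ) ^ 2 * ‖x - y‖ ^ (2 * γ)) := by
    rw [Real.mul_rpow (by linarith) (norm_nonneg _), mul_comm 2 γ,
      Real.rpow_mul (norm_nonneg (x - y)), Real.rpow_two]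
    ring
  rw [h5] at h4
  rw [h3]
  refine (mul_le_mul (mul_le_mul_of_nonneg_left (mul_le_mul_of_nonneg_left h2 (sq_nonneg _))
    (by norm_num)) h4 (by positivity) (by positivity)).trans (le_of_eq (by ring))

lemma ofReal_abs_add_pow_le (u v : ℝ) (p : ℕ) : ENNReal.ofReal (|u + v| ^ (2 * p)) ≤
    ENNReal.ofReal (2 ^ (2 * p - 1)) *
      (ENNReal.ofReal (|u| ^ (2 * p)) + ENNReal.ofReal (|v| ^ (2 * p))) := by
  rw [← ENNReal.ofReal_add (by positivity) (by positivity), ← ENNReal.ofReal_mul (by positivity)]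
  refine ENNReal.ofReal_le_ofReal ?_
  exact (pow_le_pow_left₀ (abs_nonneg _) (abs_add_le u v) _).trans
    (add_pow_le (abs_nonneg _) (abs_nonneg _) _)

/-! ### Second moment of the supremum of the field. -/

section FieldEstimate

variable {S : Type*} [MeasurableSpace S] {μ : Measure S} {H γ : ℝ} {a σ : Mode → ℝ}
  {β : Mode → ℝ → S → ℂ} {m : ℕ}

lemma measurable_ou_of_measurable {b : S → ℝ → ℂ} (hb : ∀ t, Measurable fun ω => b ω t) {a : ℝ}
    (h : ∀ ω, OUPath a (b ω)) (t : ℝ) : Measurable fun ω => ou a (b ω) t := by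
  have hu : Measurable (Function.uncurry fun (u : ℝ) (ω : S) => b ω u) :=
    measurable_uncurry_of_continuous_of_measurable (fun ω => (h ω).continuous) hb
  have hm : Measurable fun q : S × ℝ => (Real.exp (a * q.2) : ℂ) * b q.1 q.2 :=
    (by fun_prop : Measurable fun q : S × ℝ => (Real.exp (a * q.2) : ℂ)).mul
      (hu.comp measurable_swap)
  have hi : StronglyMeasurable fun ω => ∫ u in Set.Iic t, (Real.exp (a * u) : ℂ) * b ω u :=
    hm.stronglyMeasurable.integral_prod_right
  exact (hb t).sub (measurable_const.mul hi.measurable)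

lemma IsRegularFBM.measurable_ou (hβ : IsRegularFBM H a β μ) (k : Mode) (t : ℝ) :
    Measurable fun ω => ou (a k) (fun u => β k u ω) t :=
  measurable_ou_of_measurable (b := fun ω u => β k u ω) (fun t => hβ.measurable k t)
    (fun ω => hβ.ouPath k ω) t

/-- The increment is a time increment at the fixed point x plus a space increment at the fixed time
s. The two summands of `weight` dominate the two variances; the common constant 16 is 4·4 in the
first and the 16 of `norm_fieldCoef_sub_sq_le` in the second. -/
lemma IsRegularFBM.lintegral_increment_le (hβ : IsRegularFBM H a β μ)
    (hH : H ∈ Set.Ioo (0 : ℝ) 1) (hγ : 0 < γ) (hγH : γ ≤ H) (ha : ∀ k, 0 < a k)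
    {F : Finset Mode} (hF : ∀ k ∈ F, k.neg ∉ F) {δ : ℕ × ℕ} (hδ : δ ∈ multiIndices m)
    {p : ℕ} (hp : p ≠ 0) {A B : ℝ} (hA : 0 < A) (hFA : ∑ k ∈ F, weight H γ m a σ k ≤ A)
    (s t : ℝ) (x y : ℝ × ℝ) (hst : |t - s| ^ (2 * γ) ≤ B) (hxy : ‖x - y‖ ^ (2 * γ) ≤ B) :
    ∫⁻ ω, ENNReal.ofReal (|partialDeriv δ (field m σ (fun k => hβ.ouPath k ω) F t) x -
        partialDeriv δ (field m σ (fun k => hβ.ouPath k ω) F s) y| ^ (2 * p)) ∂μ ≤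
      ENNReal.ofReal (2 ^ (2 * p) * ouMoment p * (16 * B * A) ^ p) := by
  have hB : 0 ≤ B := (Real.rpow_nonneg (abs_nonneg _) _).trans hst
  have hA' : 0 ≤ 16 * B * A := by positivity
  have b1 := hβ.lintegral_ou_sub_pow_le hH hγ hγH ha hF (fieldCoef σ δ x) s t p hA' <| by
    refine le_trans ?_ (mul_le_mul_of_nonneg_left hFA (by positivity))
    rw [Finset.mul_sum]
    refine Finset.sum_le_sum fun k _ => ?_
    have h1 := norm_fieldCoef_sq_le σ hδ x k
    have p1 := Real.rpow_pos_of_pos (ha k) (-(2 * H))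
    have p2 := Real.rpow_pos_of_pos (ha k) (2 * γ - 2 * H)
    calc ‖fieldCoef σ δ x k‖ ^ 2 * (4 * |t - s| ^ (2 * γ) * a k ^ (2 * γ - 2 * H))
        ≤ 4 * (σ k ^ 2 * (k.length ^ m) ^ 2) * (4 * B * a k ^ (2 * γ - 2 * H)) := by gcongr
      _ = 16 * B * (σ k ^ 2 * (k.length ^ m) ^ 2 * (0 + a k ^ (2 * γ - 2 * H))) := by ring
      _ ≤ 16 * B * weight H γ m a σ k := by unfold weight; gcongr; positivity
  have b2 := hβ.lintegral_ou_pow_le hH ha hF (fun k => fieldCoef σ δ x k - fieldCoef σ δ y k) s p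
      hA' <| by
    refine le_trans ?_ (mul_le_mul_of_nonneg_left hFA (by positivity))
    rw [Finset.mul_sum]
    refine Finset.sum_le_sum fun k _ => ?_
    have h1 := norm_fieldCoef_sub_sq_le σ hδ ⟨hγ, hγH.trans hH.2.le⟩ x y k
    have p1 := Real.rpow_pos_of_pos (ha k) (-(2 * H))
    have p2 := Real.rpow_pos_of_pos (ha k) (2 * γ - 2 * H)
    calc ‖fieldCoef σ δ x k - fieldCoef σ δ y k‖ ^ 2 * a k ^ (-(2 * H))
        ≤ 16 * (σ k ^ 2 * (k.length ^ m) ^ 2) * ((k.length ^ γ) ^ 2 * B) * a k ^ (-(2 * H)) := by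
          refine mul_le_mul_of_nonneg_right (h1.trans ?_) p1.le
          gcongr
      _ = 16 * B * (σ k ^ 2 * (k.length ^ m) ^ 2 * (a k ^ (-(2 * H)) * (k.length ^ γ) ^ 2 + 0)) := by
          ring
      _ ≤ 16 * B * weight H γ m a σ k := by unfold weight; gcongr
  have hm1 : Measurable fun ω => ENNReal.ofReal (|∑ k ∈ F, (fieldCoef σ δ x k *
      (ou (a k) (fun u => β k u ω) t - ou (a k) (fun u => β k u ω) s)).re| ^ (2 * p)) := by
    refine ((Finset.measurable_fun_sum _ fun k _ => ?_).abs.pow_const _).ennreal_ofReal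
    exact Complex.measurable_re.comp
      (((hβ.measurable_ou k t).sub (hβ.measurable_ou k s)).const_mul _)
  calc _ ≤ ∫⁻ ω, ENNReal.ofReal (2 ^ (2 * p - 1)) *
        (ENNReal.ofReal (|∑ k ∈ F, (fieldCoef σ δ x k *
          (ou (a k) (fun u => β k u ω) t - ou (a k) (fun u => β k u ω) s)).re| ^ (2 * p)) +
        ENNReal.ofReal (|∑ k ∈ F, ((fieldCoef σ δ x k - fieldCoef σ δ y k) *
          ou (a k) (fun u => β k u ω) s).re| ^ (2 * p))) ∂μ := by
        refine lintegral_mono fun ω => ?_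
        refine le_trans (le_of_eq ?_) (ofReal_abs_add_pow_le _ _ p)
        rw [partialDeriv_field _ _ _ _ hδ, partialDeriv_field _ _ _ _ hδ, ← Finset.sum_sub_distrib,
          ← Finset.sum_add_distrib]
        congr 3
        refine Finset.sum_congr rfl fun k _ => ?_
        rw [← Complex.sub_re, ← Complex.add_re]
        congr 1
        ring
    _ ≤ ENNReal.ofReal (2 ^ (2 * p - 1)) * (ENNReal.ofReal (ouMoment p * (16 * B * A) ^ p) +
          ENNReal.ofReal (ouMoment p * (16 * B * A) ^ p)) := by
        rw [lintegral_const_mul' _ _ ENNReal.ofReal_ne_top, lintegral_add_left hm1]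
        gcongr
    _ = _ := by
        have h0 := ouMoment_nonneg p
        have h1 : 0 ≤ ouMoment p * (16 * B * A) ^ p := by positivity
        rw [← ENNReal.ofReal_add h1 h1, ← ENNReal.ofReal_mul (by positivity)]
        congr 1
        obtain ⟨q, hq⟩ : ∃ q, 2 * p = q + 1 := ⟨2 * p - 1, by omega⟩
        rw [hq, Nat.add_sub_cancel, pow_succ]
        ring

lemma IsRegularFBM.measurable_partialDeriv_field (hβ : IsRegularFBM H a β μ) (F : Finset Mode)
    {δ : ℕ × ℕ} (hδ : δ ∈ multiIndices m) (t : ℝ) (x : ℝ × ℝ) :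
    Measurable fun ω => partialDeriv δ (field m σ (fun k => hβ.ouPath k ω) F t) x := by
  simp only [partialDeriv_field _ _ _ _ hδ]
  exact Finset.measurable_fun_sum _ fun k _ =>
    Complex.measurable_re.comp ((hβ.measurable_ou k t).const_mul _)

lemma IsRegularFBM.measurable_field (hβ : IsRegularFBM H a β μ) (F : Finset Mode) :
    Measurable fun ω => field m σ (fun k => hβ.ouPath k ω) F := by
  refine measurable_pathSpace fun t => ?_
  simp only [field_apply]
  refine Finset.measurable_fun_sum _ fun k _ => ?_
  exact (continuous_mode m k.1).measurable.comp ((hβ.measurable_ou k t).const_mul _)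

/-- The second moment of the supremum norm of the field over a time interval of length `l` is
bounded by the sum of the weights, uniformly in the position of the interval. -/
theorem exists_lintegral_supNorm_field_le (hH : H ∈ Set.Ioo (0 : ℝ) 1) (hγ : 0 < γ) (hγH : γ ≤ H)
    (m : ℕ) {l : ℝ} (hl : 0 < l) :
    ∃ K : ℝ, 0 < K ∧ ∀ {S : Type u} [MeasurableSpace S] {μ : Measure S} [IsProbabilityMeasure μ]
      {β : Mode → ℝ → S → ℂ} {a σ : Mode → ℝ} (hβ : IsRegularFBM H a β μ) (_ : ∀ k, 0 < a k)
      {F : Finset Mode} (_ : ∀ k ∈ F, k.neg ∉ F) (T : ℝ) {A : ℝ} (_ : 0 < A)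
      (_ : ∑ k ∈ F, weight H γ m a σ k ≤ A),
      ∫⁻ ω, ENNReal.ofReal (supNorm T (T + l) (field m σ (fun k => hβ.ouPath k ω) F) ^ 2) ∂μ ≤
        ENNReal.ofReal (K * A) := by
  -- Chaining in dimension d = 3, one time and two space variables, asks for increment moments of
  -- order D^{d+2} = D^5, whereas the 2p-th moment supplies D^{2γp}.
  obtain ⟨p, hp⟩ := exists_nat_gt (5 / (2 * γ))
  have hp5 : 5 ≤ 2 * γ * p := by
    rw [div_lt_iff₀ (by positivity)] at hp
    linarith
  have hp0 : p ≠ 0 := by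
    rintro rfl
    norm_num at hp5
  -- The time interval is rescaled to [0, 1]; L bounds the effect of the factor l on Hölder
  -- increments, and L ≥ 1 lets the same constant serve the space variables.
  set L : ℝ := (1 + l) ^ (2 * γ) with hL
  have hL1 : 1 ≤ L := Real.one_le_rpow (by linarith) (by linarith)
  set C : ℝ := 2 ^ (2 * p) * ouMoment p * (16 * L) ^ p with hC
  have hM := ouMoment_nonneg p
  have hC0 : 0 ≤ C := by positivity
  set K₀ : ℝ := 1 + 2 * chainingConst (2 * p) * C with hK₀
  have hK0 : 0 < K₀ := by
    have := chainingConst_pos (q := 2 * p) (by omega)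
    positivity
  set N : ℝ := ((multiIndices m).card : ℝ) with hN
  have hN0 : 0 < N := by
    rw [hN]; exact_mod_cast Finset.card_pos.2 ⟨_, CmTorus.zero_mem_multiIndices⟩
  -- The C^m norm is at most N times the largest derivative, whose square is at most the sum of the
  -- N bounds G; squaring gives N², and the sum of means gives the third N.
  refine ⟨N ^ 3 * K₀, by positivity, ?_⟩
  intro S _ μ _ β a σ hβ ha F hF T A hA hFA
  have key : ∀ δ ∈ multiIndices m, ∃ G : S → ENNReal, Measurable G ∧
      (∀ ω, ∀ t ∈ Set.Icc T (T + l), ∀ x ∈ CmTorus.unitSquare, ENNReal.ofReal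
        (|partialDeriv δ (field m σ (fun k => hβ.ouPath k ω) F t) x| ^ 2) ≤ G ω) ∧
      ∫⁻ ω, G ω ∂μ ≤ ENNReal.ofReal (K₀ * A) := by
    intro δ hδ
    obtain ⟨G, hG, hGb, hGi⟩ := exists_sq_bound_of_increments (μ := μ) (d := 3)
      (f := fun ω P => partialDeriv δ (field m σ (fun k => hβ.ouPath k ω) F (T + l * P 0)) (P 1, P 2))
      (fun P => hβ.measurable_partialDeriv_field F hδ _ _)
      (fun ω => by
        simp only [partialDeriv_field _ _ _ _ hδ]
        refine continuous_finsetSum _ fun k _ => Complex.continuous_re.comp (.mul ?_ ?_)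
        · have h2 := continuous_character k.1
          unfold fieldCoef
          fun_prop
        · exact (hβ.ouPath k ω).continuous_ou.comp (by fun_prop))
      hp0 hA hC0
      (by
        have := hβ.lintegral_ou_pow_le (μ := μ) hH ha hF (fieldCoef σ δ (0, 0)) T p
          (A := 4 * A) (by positivity) (by
            refine le_trans ?_ (mul_le_mul_of_nonneg_left hFA (by positivity))
            rw [Finset.mul_sum]
            refine Finset.sum_le_sum fun k _ => ?_
            have h1 := norm_fieldCoef_sq_le σ hδ (0, 0) k
            have p1 := Real.rpow_pos_of_pos (ha k) (-(2 * H))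
            have p2 := Real.rpow_pos_of_pos (ha k) (2 * γ - 2 * H)
            have p3 : 1 ≤ (k.length ^ γ) ^ 2 :=
              one_le_pow₀ (Real.one_le_rpow k.one_le_length hγ.le)
            calc ‖fieldCoef σ δ (0, 0) k‖ ^ 2 * a k ^ (-(2 * H))
                ≤ 4 * (σ k ^ 2 * (k.length ^ m) ^ 2) * a k ^ (-(2 * H)) := by gcongr
              _ = 4 * (σ k ^ 2 * (k.length ^ m) ^ 2 * (a k ^ (-(2 * H)) * 1 + 0)) := by ring
              _ ≤ 4 * weight H γ m a σ k := by unfold weight; gcongr)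
        simp only [partialDeriv_field _ _ _ _ hδ, Pi.zero_apply, mul_zero, add_zero]
        refine this.trans (ENNReal.ofReal_le_ofReal ?_)
        have h1 : (4 : ℝ) ^ p ≤ 2 ^ (2 * p) * (16 * L) ^ p := by
          have h2 : (1 : ℝ) ≤ 2 ^ (2 * p) := one_le_pow₀ (by norm_num)
          have h3 : (4 : ℝ) ^ p ≤ (16 * L) ^ p := pow_le_pow_left₀ (by norm_num) (by linarith) p
          nlinarith [pow_nonneg (by positivity : 0 ≤ 16 * L) p]
        calc ouMoment p * (4 * A) ^ p = ouMoment p * A ^ p * 4 ^ p := by rw [mul_pow]; ring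
          _ ≤ ouMoment p * A ^ p * (2 ^ (2 * p) * (16 * L) ^ p) := by gcongr
          _ = C * A ^ p := by rw [hC]; ring)
      (by
        intro P hP Q hQ
        set D : ℝ := ‖P - Q‖ with hD
        have hD0 : 0 ≤ D := norm_nonneg _
        have hD1 : D ≤ 1 := by
          refine (pi_norm_le_iff_of_nonneg zero_le_one).2 fun i => ?_
          have h1 := hP.1 i; have h2 := hP.2 i; have h3 := hQ.1 i; have h4 := hQ.2 i
          simp only [Pi.zero_apply, Pi.one_apply] at h1 h2 h3 h4
          rw [Real.norm_eq_abs, Pi.sub_apply, abs_le]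
          constructor <;> linarith
        have hc : ∀ i, |P i - Q i| ≤ D := fun i => norm_le_pi_norm (P - Q) i
        have hB : 0 ≤ L * D ^ (2 * γ) := by positivity
        have := hβ.lintegral_increment_le (μ := μ) (σ := σ) hH hγ hγH ha hF hδ hp0
          (B := L * D ^ (2 * γ)) hA hFA (T + l * Q 0) (T + l * P 0) (P 1, P 2) (Q 1, Q 2)
          (by
            rw [hL, ← Real.mul_rpow (by positivity) hD0]
            refine Real.rpow_le_rpow (abs_nonneg _) ?_ (by positivity)
            rw [add_sub_add_left_eq_sub, ← mul_sub, abs_mul, abs_of_pos hl]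
            exact mul_le_mul (by linarith) (hc 0) (abs_nonneg _) (by positivity))
          (by
            refine le_trans (Real.rpow_le_rpow (norm_nonneg _) ?_ (by positivity))
              (le_mul_of_one_le_left (by positivity) hL1)
            exact max_le (hc 1) (hc 2))
        refine this.trans ?_
        rw [← ENNReal.ofReal_mul (by positivity)]
        refine ENNReal.ofReal_le_ofReal ?_
        have h6 : (D ^ (2 * γ)) ^ p ≤ D ^ (3 + 2) := by
          rw [← Real.rpow_mul_natCast hD0, ← Real.rpow_natCast D (3 + 2)]
          rcases hD0.eq_or_lt with h0 | h0
          · rw [← h0, Real.zero_rpow (by positivity), Real.zero_rpow (by positivity)]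
          · exact Real.rpow_le_rpow_of_exponent_ge h0 hD1 (by push_cast; linarith)
        calc 2 ^ (2 * p) * ouMoment p * (16 * (L * D ^ (2 * γ)) * A) ^ p
            = C * A ^ p * (D ^ (2 * γ)) ^ p := by rw [hC]; simp only [mul_pow]; ring
          _ ≤ _ := by gcongr)
    refine ⟨G, hG, fun ω t ht x hx => ?_, hGi⟩
    have := hGb ω ![(t - T) / l, x.1, x.2] ⟨fun i => ?_, fun i => ?_⟩
    · have e : T + l * ((t - T) / l) = t := by field_simp; ring
      simpa [e] using this
    · have h1 := hx.1.1; have h2 := hx.1.2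
      fin_cases i
      · exact div_nonneg (by linarith [ht.1]) hl.le
      · exact h1
      · exact h2
    · have h1 := hx.2.1; have h2 := hx.2.2
      fin_cases i
      · exact (div_le_one hl).2 (by linarith [ht.2])
      · exact h1
      · exact h2
  choose! G hGm hGb hGi using key
  set Gs : S → ENNReal := fun ω => ∑ δ ∈ multiIndices m, G δ ω with hGs
  have hle : ∀ ω, ENNReal.ofReal (supNorm T (T + l) (field m σ (fun k => hβ.ouPath k ω) F) ^ 2) ≤
      ENNReal.ofReal (N ^ 2) * Gs ω := by
    intro ω
    by_cases htop : Gs ω = ⊤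
    · rw [htop, ENNReal.mul_top (by simpa using hN0.ne')]
      exact le_top
    have hs : supNorm T (T + l) (field m σ (fun k => hβ.ouPath k ω) F) ≤
        N * Real.sqrt (Gs ω).toReal := by
      refine supNorm_le (by positivity) fun t ht => ?_
      refine CmTorus.norm_le_of_forall_unitSquare _ fun δ hδ x hx => ?_
      refine Real.abs_le_sqrt ?_
      rw [← sq_abs, ← ENNReal.ofReal_le_iff_le_toReal htop]
      exact (hGb δ hδ ω t ht x hx).trans
        (Finset.single_le_sum (f := fun δ => G δ ω) (fun _ _ => zero_le) hδ)
    have h2 := pow_le_pow_left₀ (supNorm_nonneg _ _ _) hs 2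
    rw [mul_pow, Real.sq_sqrt ENNReal.toReal_nonneg] at h2
    refine (ENNReal.ofReal_le_ofReal h2).trans ?_
    rw [ENNReal.ofReal_mul (by positivity), ENNReal.ofReal_toReal htop]
  refine (lintegral_mono hle).trans ?_
  rw [lintegral_const_mul' _ _ ENNReal.ofReal_ne_top,
    lintegral_finsetSum _ fun δ hδ => hGm δ hδ]
  calc ENNReal.ofReal (N ^ 2) * ∑ δ ∈ multiIndices m, ∫⁻ ω, G δ ω ∂μ
      ≤ ENNReal.ofReal (N ^ 2) * ∑ δ ∈ multiIndices m, ENNReal.ofReal (K₀ * A) := by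
        gcongr with δ hδ
        exact hGi δ hδ
    _ = ENNReal.ofReal (N ^ 3 * K₀ * A) := by
        rw [Finset.sum_const, nsmul_eq_mul, ← ENNReal.ofReal_natCast, ← hN,
          ← ENNReal.ofReal_mul hN0.le, ← ENNReal.ofReal_mul (by positivity)]
        congr 1
        ring

end FieldEstimate

/-! ### Regular versions of fractional Brownian motion -/

section Regularization

variable {S : Type*} [MeasurableSpace S] {μ : Measure S} {H : ℝ}

lemma IsRealFBM.congr {B B' : ℝ → S → ℝ} (hB : IsRealFBM H B μ) (hm : ∀ t, Measurable (B' t))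
    (h : ∀ᵐ ω ∂μ, ∀ t, B' t ω = B t ω) : IsRealFBM H B' μ where
  measurable := hm
  gaussian := hB.gaussian.congr fun t => h.mono fun ω hω => (hω t).symm
  start := by
    filter_upwards [h, hB.start] with ω h1 h2
    rw [h1, h2]
  mean t := by
    rw [← hB.mean t]
    exact integral_congr_ae (h.mono fun ω hω => hω t)
  cov s t := by
    rw [← hB.cov s t]
    refine integral_congr_ae (h.mono fun ω hω => ?_)
    simp only [hω]
  continuous_paths := by
    filter_upwards [h, hB.continuous_paths] with ω h1 h2
    simpa only [h1] using h2

lemma IsInfDimFBM.congr {β b : Mode → ℝ → S → ℂ} (hβ : IsInfDimFBM H β μ)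
    (hm : ∀ k t, Measurable (b k t)) (h : ∀ᵐ ω ∂μ, ∀ k t, b k t ω = β k t ω) :
    IsInfDimFBM H b μ where
  re_fbm k := (hβ.re_fbm k).congr
    (fun t => (Complex.measurable_re.comp (hm k t)).const_mul _)
    (h.mono fun ω hω t => by rw [hω])
  im_fbm k := (hβ.im_fbm k).congr
    (fun t => (Complex.measurable_im.comp (hm k t)).const_mul _)
    (h.mono fun ω hω t => by rw [hω])
  indep_re_im k := (hβ.indep_re_im k).congr
    (h.mono fun ω hω => funext fun t => by simp only [hω])
    (h.mono fun ω hω => funext fun t => by simp only [hω])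
  conj k t := by
    filter_upwards [h, hβ.conj k t] with ω h1 h2
    rw [h1, h1, h2]
  indep T hT := (hβ.indep T hT).congr fun k =>
    h.mono fun ω hω => funext fun t => (hω k t).symm

lemma IsRealFBM.lintegral_sq {B : ℝ → S → ℝ} (hB : IsRealFBM H B μ) (hH : H ∈ Set.Ioo (0 : ℝ) 1)
    (t : ℝ) : ∫⁻ ω, ENNReal.ofReal (B t ω ^ 2) ∂μ ≤ ENNReal.ofReal (1 + t ^ 2) := by
  have h1 := hB.cov t t
  rw [sub_self, abs_zero, Real.zero_rpow (by linarith [hH.1])] at h1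
  rw [← ofReal_integral_eq_lintegral_ofReal (hB.memLp t).integrable_sq
    (.of_forall fun ω => sq_nonneg _)]
  refine ENNReal.ofReal_le_ofReal ?_
  simp only [sq (B t _), h1]
  have h2 : |t| ^ (2 * H) ≤ 1 + t ^ 2 := by
    rcases le_total |t| 1 with h | h
    · have := Real.rpow_le_one (abs_nonneg t) h (by linarith [hH.1] : 0 ≤ 2 * H)
      nlinarith [sq_nonneg t]
    · have := Real.rpow_le_rpow_of_exponent_le h (by linarith [hH.2] : 2 * H ≤ 2)
      rw [Real.rpow_two, sq_abs] at this
      linarith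
  linarith

lemma IsInfDimFBM.lintegral_norm_le {β : Mode → ℝ → S → ℂ} (hβ : IsInfDimFBM H β μ)
    (hH : H ∈ Set.Ioo (0 : ℝ) 1) (k : Mode) (t : ℝ) :
    ∫⁻ ω, ENNReal.ofReal ‖β k t ω‖ ∂μ ≤ ENNReal.ofReal (3 + 2 * t ^ 2) := by
  have hprob := (hβ.re_fbm k).gaussian.isProbabilityMeasure
  have hpt : ∀ ω, ENNReal.ofReal ‖β k t ω‖ ≤ ENNReal.ofReal 1 +
      (ENNReal.ofReal ((Real.sqrt 2 * (β k t ω).re) ^ 2) +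
        ENNReal.ofReal ((Real.sqrt 2 * (β k t ω).im) ^ 2)) := fun ω => by
    rw [← ENNReal.ofReal_add (by positivity) (by positivity),
      ← ENNReal.ofReal_add (by positivity) (by positivity)]
    refine ENNReal.ofReal_le_ofReal ?_
    have h1 : ‖β k t ω‖ ^ 2 = (β k t ω).re ^ 2 + (β k t ω).im ^ 2 := by
      rw [Complex.sq_norm, Complex.normSq_apply]; ring
    have h2 : Real.sqrt 2 ^ 2 = 2 := Real.sq_sqrt (by norm_num)
    rw [mul_pow, mul_pow, h2]
    nlinarith [sq_nonneg (‖β k t ω‖ - 1)]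
  refine (lintegral_mono hpt).trans ?_
  rw [lintegral_add_left measurable_const, lintegral_add_left
    (((hβ.re_fbm k).measurable t).pow_const 2).ennreal_ofReal]
  refine (add_le_add (le_of_eq ?_) (add_le_add ((hβ.re_fbm k).lintegral_sq hH t)
    ((hβ.im_fbm k).lintegral_sq hH t))).trans (le_of_eq ?_) (b := ENNReal.ofReal 1 +
      (ENNReal.ofReal (1 + t ^ 2) + ENNReal.ofReal (1 + t ^ 2)))
  · simp
  · rw [← ENNReal.ofReal_add (by positivity) (by positivity),
      ← ENNReal.ofReal_add (by positivity) (by positivity)]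
    congr 1
    ring

lemma integrableOn_exp_mul_quadratic {a : ℝ} (ha : 0 < a) :
    IntegrableOn (fun u : ℝ => Real.exp (a * u) * (3 + 2 * u ^ 2)) (Set.Iic 0) := by
  have h0 : IntegrableOn (fun u : ℝ => (3 + 16 / a ^ 2) * Real.exp (a / 2 * u)) (Set.Iic 0) :=
    (integrableOn_exp_mul_Iic (by positivity) 0).const_mul _
  refine h0.mono' (by fun_prop) ((ae_restrict_mem measurableSet_Iic).mono fun u hu => ?_)
  have hu0 : u ≤ 0 := hu
  have hx : 0 ≤ -(a / 2 * u) := by nlinarith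
  have h1 := Real.pow_div_factorial_le_exp _ hx 2
  have h2 := Real.one_le_exp hx
  have h3 : u ^ 2 ≤ 8 / a ^ 2 * Real.exp (-(a / 2 * u)) := by
    have : u ^ 2 = 8 / a ^ 2 * ((-(a / 2 * u)) ^ 2 / (Nat.factorial 2 : ℕ)) := by
      simp [Nat.factorial]; field_simp; ring
    rw [this]
    gcongr
  have h4 : Real.exp (a * u) * Real.exp (-(a / 2 * u)) = Real.exp (a / 2 * u) := by
    rw [← Real.exp_add]; congr 1; ring
  rw [Real.norm_of_nonneg (by positivity)]
  calc Real.exp (a * u) * (3 + 2 * u ^ 2)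
      ≤ Real.exp (a * u) * (3 * Real.exp (-(a / 2 * u)) +
          2 * (8 / a ^ 2 * Real.exp (-(a / 2 * u)))) := by gcongr; linarith
    _ = (3 + 16 / a ^ 2) * (Real.exp (a * u) * Real.exp (-(a / 2 * u))) := by ring
    _ = _ := by rw [h4]

/-- By Tonelli the mean of the integral is finite, as the first moments grow at most quadratically.
Continuity of every path supplies the joint measurability. -/
lemma ae_integrableOn_of_lintegral_le [SFinite μ] {b : S → ℝ → ℂ} (hb : ∀ t, Measurable fun ω => b ω t)
    (hc : ∀ ω, Continuous (b ω)) {a : ℝ} (ha : 0 < a)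
    (hi : ∀ t, ∫⁻ ω, ENNReal.ofReal ‖b ω t‖ ∂μ ≤ ENNReal.ofReal (3 + 2 * t ^ 2)) :
    ∀ᵐ ω ∂μ, IntegrableOn (fun u => Real.exp (a * u) * ‖b ω u‖) (Set.Iic 0) := by
  have hj : Measurable (Function.uncurry fun (u : ℝ) (ω : S) => b ω u) :=
    measurable_uncurry_of_continuous_of_measurable hc hb
  have hm : Measurable fun q : S × ℝ => ENNReal.ofReal (Real.exp (a * q.2) * ‖b q.1 q.2‖) :=
    ((by fun_prop : Measurable fun q : S × ℝ => Real.exp (a * q.2)).mul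
      (hj.comp measurable_swap).norm).ennreal_ofReal
  have hfin : ∫⁻ ω, (∫⁻ u in Set.Iic (0 : ℝ), ENNReal.ofReal (Real.exp (a * u) * ‖b ω u‖)) ∂μ ≠ ⊤ := by
    rw [lintegral_lintegral_swap hm.aemeasurable]
    refine ne_top_of_le_ne_top (b := ∫⁻ u in Set.Iic 0,
      ENNReal.ofReal (Real.exp (a * u) * (3 + 2 * u ^ 2))) ?_ (lintegral_mono fun u => ?_)
    · exact (integrableOn_exp_mul_quadratic ha).lintegral_lt_top.ne
    · simp only [ENNReal.ofReal_mul (Real.exp_pos _).le]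
      rw [lintegral_const_mul' _ _ ENNReal.ofReal_ne_top]
      gcongr
      exact hi u
  filter_upwards [ae_lt_top hm.lintegral_prod_right hfin] with ω hω
  have hcω : Continuous fun u => Real.exp (a * u) * ‖b ω u‖ := by
    have := hc ω
    fun_prop
  refine ⟨hcω.aestronglyMeasurable, ?_⟩
  rw [hasFiniteIntegral_iff_ofReal (.of_forall fun u => by positivity)]
  exact hω

lemma ouPath_zero (a : ℝ) : OUPath a fun _ => 0 := ⟨continuous_const, by simp⟩

lemma exists_measurable_cut {p : S → Prop} (hp : ∀ᵐ ω ∂μ, p ω) :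
    ∃ G : Set S, MeasurableSet G ∧ (∀ᵐ ω ∂μ, ω ∈ G) ∧ ∀ ω ∈ G, p ω := by
  refine ⟨(toMeasurable μ {ω | ¬ p ω})ᶜ, (measurableSet_toMeasurable _ _).compl, ?_, fun ω hω => ?_⟩
  · rw [ae_iff] at hp ⊢
    simpa using hp
  · by_contra h
    exact hω (subset_toMeasurable _ _ h)

open Classical in
/-- Fractional Brownian coefficients have a version all of whose paths are regular. -/
lemma IsInfDimFBM.exists_regular {β : Mode → ℝ → S → ℂ} (hβ : IsInfDimFBM H β μ)
    (hH : H ∈ Set.Ioo (0 : ℝ) 1) {a : Mode → ℝ} (ha : ∀ k, 0 < a k) :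
    ∃ b : Mode → ℝ → S → ℂ, IsRegularFBM H a b μ ∧ ∀ᵐ ω ∂μ, ∀ k t, b k t ω = β k t ω := by
  have hprob := (hβ.re_fbm ⟨(1, 0), by simp⟩).gaussian.isProbabilityMeasure
  have hcont : ∀ᵐ ω ∂μ, ∀ k, Continuous fun t => β k t ω := by
    rw [ae_all_iff]
    intro k
    filter_upwards [(hβ.re_fbm k).continuous_paths, (hβ.im_fbm k).continuous_paths] with ω h1 h2
    have e : (fun t => β k t ω) = fun t =>
        (((Real.sqrt 2)⁻¹ * (Real.sqrt 2 * (β k t ω).re) : ℝ) : ℂ) +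
          (((Real.sqrt 2)⁻¹ * (Real.sqrt 2 * (β k t ω).im) : ℝ) : ℂ) * Complex.I := by
      funext t
      have : Real.sqrt 2 ≠ 0 := by positivity
      rw [inv_mul_cancel_left₀ this, inv_mul_cancel_left₀ this, Complex.re_add_im]
    rw [e]
    fun_prop
  -- The modification is made in two stages: the paths are first set to zero off a measurable set
  -- where they are all continuous, because the Tonelli argument for integrability needs every path
  -- continuous.
  obtain ⟨G, hG, hGae, hGc⟩ := exists_measurable_cut hcont
  set b₀ : Mode → ℝ → S → ℂ := fun k t ω => if ω ∈ G then β k t ω else 0 with hb₀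
  have hb₀m : ∀ k t, Measurable (b₀ k t) := fun k t =>
    Measurable.ite hG (hβ.measurable k t) measurable_const
  have hb₀β : ∀ᵐ ω ∂μ, ∀ k t, b₀ k t ω = β k t ω :=
    hGae.mono fun ω hω k t => if_pos hω
  have hF₀ := hβ.congr hb₀m hb₀β
  have hb₀c : ∀ k ω, Continuous fun t => b₀ k t ω := fun k ω => by
    by_cases hω : ω ∈ G
    · simpa only [hb₀, if_pos hω] using hGc ω hω k
    · simp only [hb₀, if_neg hω]; exact continuous_const
  have hreg : ∀ᵐ ω ∂μ, (∀ k, IntegrableOn (fun u => Real.exp (a k * u) * ‖b₀ k u ω‖) (Set.Iic 0)) ∧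
      ∀ k t, b₀ k.neg t ω = (starRingEnd ℂ) (b₀ k t ω) := by
    have h1 : ∀ᵐ ω ∂μ, ∀ k,
        IntegrableOn (fun u => Real.exp (a k * u) * ‖b₀ k u ω‖) (Set.Iic 0) :=
      ae_all_iff.2 fun k => ae_integrableOn_of_lintegral_le (b := fun ω u => b₀ k u ω)
        (fun t => hb₀m k t) (fun ω => hb₀c k ω) (ha k) fun t => hF₀.lintegral_norm_le hH k t
    -- The conjugation relation holds off a null set depending on the time; rational times and
    -- continuity give one null set for all times.
    have h2 : ∀ᵐ ω ∂μ, ∀ k, ∀ q : ℚ, b₀ k.neg q ω = (starRingEnd ℂ) (b₀ k q ω) :=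
      ae_all_iff.2 fun k => ae_all_iff.2 fun q => hF₀.conj k q
    filter_upwards [h1, h2] with ω h1 h2
    refine ⟨h1, fun k t => ?_⟩
    have := Rat.denseRange_cast (𝕜 := ℝ)
    exact congrFun (this.equalizer (hb₀c k.neg ω) (Complex.continuous_conj.comp (hb₀c k ω))
      (funext fun q => h2 k q)) t
  obtain ⟨G', hG', hGae', hGp⟩ := exists_measurable_cut hreg
  refine ⟨fun k t ω => if ω ∈ G' then b₀ k t ω else 0, ⟨hF₀.congr (fun k t =>
    Measurable.ite hG' (hb₀m k t) measurable_const) (hGae'.mono fun ω hω k t => if_pos hω), ?_, ?_⟩, ?_⟩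
  · intro k ω
    by_cases hω : ω ∈ G'
    · simp only [if_pos hω]
      exact ⟨hb₀c k ω, (hGp ω hω).1 k⟩
    · simp only [if_neg hω]
      exact ouPath_zero _
  · intro k t ω
    by_cases hω : ω ∈ G'
    · simp only [if_pos hω]
      exact (hGp ω hω).2 k t
    · simp [if_neg hω]
  · filter_upwards [hGae', hb₀β] with ω h1 h2 k t
    rw [if_pos h1, h2]

end Regularization

/-! ### The series over all modes -/

/-- A set of modes that contains exactly one of `k` and `-k` for every `k`. -/
def halfModes : Set Mode := {k | 0 < k.1.1 ∨ (k.1.1 = 0 ∧ 0 < k.1.2)}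

lemma Mode.neg_notMem_halfModes {k : Mode} (hk : k ∈ halfModes) : k.neg ∉ halfModes := by
  simp only [halfModes, Mode.neg, Set.mem_ofPred_eq, Prod.fst_neg, Prod.snd_neg] at hk ⊢
  omega

lemma Mode.mem_or_neg_mem_halfModes (k : Mode) : k ∈ halfModes ∨ k.neg ∈ halfModes := by
  have : ¬ (k.1.1 = 0 ∧ k.1.2 = 0) := fun h => k.2 (Prod.ext h.1 h.2)
  simp only [halfModes, Mode.neg, Set.mem_ofPred_eq, Prod.fst_neg, Prod.snd_neg]
  omega

lemma Mode.neg_neg (k : Mode) : k.neg.neg = k := Subtype.ext (_root_.neg_neg k.1)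

open Classical in
-- The n-th set contains the first modes of an enumeration, for exhaustion, and finite sets off
-- which all finite sums of W are below 4^{-i}, i ≤ n. The new modes at step n + 1 avoid the n-th of
-- these, hence have small total weight.
lemma exists_exhaustion {W : Mode → ℝ} (hW : Summable W) :
    ∃ F : ℕ → Finset Mode, Monotone F ∧ (∀ n, ∀ k ∈ F n, k ∈ halfModes) ∧
      (∀ k ∈ halfModes, ∀ᶠ n in atTop, k ∈ F n) ∧
      ∀ n, ∑ k ∈ F (n + 1) \ F n, W k ≤ (1 / 4) ^ n := by
  have : Nonempty Mode := ⟨⟨(1, 0), by simp⟩⟩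
  obtain ⟨e, he⟩ := exists_surjective_nat Mode
  have hs : ∀ n : ℕ, ∃ s : Finset Mode, ∀ t, Disjoint t s → ‖∑ k ∈ t, W k‖ < (1 / 4) ^ n :=
    fun n => summable_iff_vanishing_norm.1 hW _ (by positivity)
  choose s hs using hs
  refine ⟨fun n => ((Finset.range (n + 1)).biUnion fun i => insert (e i) (s i)).filter
    (· ∈ halfModes), ?_, ?_, ?_, ?_⟩
  · intro n n' h
    exact Finset.filter_subset_filter _ (Finset.biUnion_subset_biUnion_of_subset_left _
      (Finset.range_mono (by omega)))
  · intro n k hk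
    exact (Finset.mem_filter.1 hk).2
  · intro k hk
    obtain ⟨i, rfl⟩ := he k
    refine eventually_atTop.2 ⟨i, fun n hn => Finset.mem_filter.2 ⟨Finset.mem_biUnion.2
      ⟨i, Finset.mem_range.2 (by omega), Finset.mem_insert_self _ _⟩, hk⟩⟩
  · intro n
    refine ((le_abs_self _).trans_lt (hs n _ ?_)).le
    rw [Finset.disjoint_left]
    intro k hk hks
    rw [Finset.mem_sdiff, Finset.mem_filter, Finset.mem_filter] at hk
    exact hk.2 ⟨Finset.mem_biUnion.2 ⟨n, Finset.mem_range.2 (by omega),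
      Finset.mem_insert_of_mem hks⟩, hk.1.2⟩

/-- `X` is the series `∑_{k} 2 Re (σ_k Z_k(t) e_k)` over the half of the modes. -/
structure IsModeSeries {S : Type*} [MeasurableSpace S] {μ : Measure S} {H : ℝ} {a : Mode → ℝ}
    {β : Mode → ℝ → S → ℂ} {m : ℕ} (σ : Mode → ℝ) (hβ : IsRegularFBM H a β μ)
    (F : ℕ → Finset Mode) (X : S → PathSpace m) : Prop where
  measurable : Measurable X
  half : ∀ n, ∀ k ∈ F n, k ∈ halfModes
  exhaust : ∀ k ∈ halfModes, ∀ᶠ n in atTop, k ∈ F n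
  tendsto : ∀ᵐ ω ∂μ, Tendsto (fun n => field m σ (fun k => hβ.ouPath k ω) (F n)) atTop (𝓝 (X ω))

/-! ### Almost sure convergence of the series in C(ℝ, C^m(𝕋²)). -/

section Construction

variable {S : Type u} [MeasurableSpace S] {μ : Measure S} {H γ : ℝ} {a σ : Mode → ℝ}
  {β : Mode → ℝ → S → ℂ} {m : ℕ}

lemma ae_summable_supNorm [IsProbabilityMeasure μ] (hβ : IsRegularFBM H a β μ)
    (hH : H ∈ Set.Ioo (0 : ℝ) 1) (hγ : 0 < γ) (hγH : γ ≤ H) (ha : ∀ k, 0 < a k)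
    {E : ℕ → Finset Mode} (hE : ∀ n, ∀ k ∈ E n, k ∈ halfModes)
    (hW : ∀ n, ∑ k ∈ E n, weight H γ m a σ k ≤ (1 / 4) ^ n) (T : ℝ) {l : ℝ} (hl : 0 < l) :
    ∀ᵐ ω ∂μ, Summable fun n => supNorm T (T + l) (field m σ (fun k => hβ.ouPath k ω) (E n)) := by
  obtain ⟨K, hK, hbound⟩ := exists_lintegral_supNorm_field_le.{u} hH hγ hγH m hl
  set f : ℕ → S → ℝ := fun n ω => supNorm T (T + l) (field m σ (fun k => hβ.ouPath k ω) (E n))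
    with hf
  have hfm : ∀ n, Measurable (f n) := fun n =>
    (continuous_supNorm T (T + l)).measurable.comp (hβ.measurable_field (E n))
  have hf0 : ∀ n ω, 0 ≤ f n ω := fun n ω => supNorm_nonneg _ _ _
  have hfi : ∀ n, ∫⁻ ω, ENNReal.ofReal (f n ω) ∂μ ≤ ENNReal.ofReal ((1 + K) * (1 / 2) ^ n) := by
    intro n
    have h1 := hbound hβ ha (fun k hk h => Mode.neg_notMem_halfModes (hE n k hk) (hE n _ h)) T
      (by positivity : (0 : ℝ) < (1 / 4) ^ n) (hW n)
    -- The arithmetic-geometric inequality with scale 2^{-n} turns the second moment K 4^{-n} into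
    -- the summable first moment (1 + K) 2^{-n}.
    have h2 : ∀ ω, ENNReal.ofReal (f n ω) ≤
        ENNReal.ofReal ((1 / 2) ^ n) + ENNReal.ofReal (2 ^ n) * ENNReal.ofReal (f n ω ^ 2) := by
      intro ω
      rw [← ENNReal.ofReal_mul (by positivity), ← ENNReal.ofReal_add (by positivity) (by positivity)]
      refine ENNReal.ofReal_le_ofReal ?_
      have h3 : (1 / 2 : ℝ) ^ n * 2 ^ n = 1 := by rw [← mul_pow]; norm_num
      have h4 : (0 : ℝ) < 2 ^ n := by positivity
      nlinarith [sq_nonneg (2 ^ n * f n ω - 1), hf0 n ω]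
    refine (lintegral_mono h2).trans ?_
    rw [lintegral_add_left measurable_const, lintegral_const_mul' _ _ ENNReal.ofReal_ne_top,
      lintegral_const, measure_univ, mul_one]
    refine (add_le_add_right (mul_le_mul_right h1 _) _).trans (le_of_eq ?_)
    rw [← ENNReal.ofReal_mul (by positivity), ← ENNReal.ofReal_add (by positivity) (by positivity)]
    congr 1
    have h3 : (1 / 4 : ℝ) ^ n * 2 ^ n = (1 / 2) ^ n := by rw [← mul_pow]; norm_num
    rw [← h3]
    have h5 : (1 / 4 : ℝ) ^ n * 2 ^ n = (1 / 2) ^ n := h3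
    linear_combination (0 : ℝ) * h5
  have hsum : ∫⁻ ω, ∑' n, ENNReal.ofReal (f n ω) ∂μ ≠ ⊤ := by
    rw [lintegral_tsum fun n => (hfm n).ennreal_ofReal.aemeasurable]
    refine ne_top_of_le_ne_top ?_ (ENNReal.tsum_le_tsum hfi)
    exact ((summable_geometric_of_lt_one (by norm_num) (by norm_num : (1 / 2 : ℝ) < 1)).mul_left
      (1 + K)).tsum_ofReal_ne_top
  filter_upwards [ae_lt_top (Measurable.tsum fun n => (hfm n).ennreal_ofReal) hsum] with ω hω
  have := ENNReal.summable_toReal hω.ne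
  simpa only [ENNReal.toReal_ofReal (hf0 _ ω)] using this

open Classical in
theorem exists_isModeSeries [IsProbabilityMeasure μ] (hβ : IsRegularFBM H a β μ)
    (hH : H ∈ Set.Ioo (0 : ℝ) 1) (hγ : 0 < γ) (hγH : γ ≤ H) (ha : ∀ k, 0 < a k)
    (hW : Summable (weight H γ m a σ)) :
    ∃ (F : ℕ → Finset Mode) (X : S → PathSpace m), IsModeSeries σ hβ F X := by
  obtain ⟨F, hmono, hhalf, hex, hFW⟩ := exists_exhaustion hW
  set f : ℕ → S → PathSpace m := fun n ω => field m σ (fun k => hβ.ouPath k ω) (F n) with hf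
  set g : ℕ → S → PathSpace m :=
    fun n ω => field m σ (fun k => hβ.ouPath k ω) (F (n + 1) \ F n) with hg
  have hfg : ∀ n ω, f n ω = f 0 ω + ∑ i ∈ Finset.range n, g i ω := by
    intro n ω
    induction n with
    | zero => simp
    | succ n ih =>
      rw [Finset.sum_range_succ, ← add_assoc, ← ih]
      ext1 t
      change field _ _ _ _ t = field _ _ _ _ t + field _ _ _ _ t
      rw [field_apply, field_apply, field_apply, ← Finset.sum_sdiff (hmono (Nat.le_succ n))]
      exact add_comm _ _
  have hae : ∀ᵐ ω ∂μ, Summable fun n => g n ω := by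
    -- The interval is [-(N + 1), N + 1]; countably many of them cover all compact sets, and C^m is
    -- complete, so the series converges in the compact-open topology.
    have h1 : ∀ᵐ ω ∂μ, ∀ N : ℕ, Summable fun n =>
        supNorm (-((N : ℝ) + 1)) (-((N : ℝ) + 1) + 2 * ((N : ℝ) + 1)) (g n ω) :=
      ae_all_iff.2 fun N => ae_summable_supNorm hβ hH hγ hγH ha
        (fun n k hk => hhalf _ _ (Finset.mem_sdiff.1 hk).1) hFW _ (by positivity)
    filter_upwards [h1] with ω hω
    refine ContinuousMap.summable_of_locally_summable_norm fun K => ?_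
    obtain ⟨r, hr⟩ := K.isCompact.isBounded.subset_closedBall 0
    obtain ⟨N, hN⟩ := exists_nat_gt r
    refine Summable.of_nonneg_of_le (fun n => norm_nonneg _) (fun n => ?_) (hω N)
    rw [ContinuousMap.norm_le _ (supNorm_nonneg _ _ _)]
    intro t
    refine norm_le_supNorm ?_ (g n ω)
    have := hr t.2
    rw [Metric.mem_closedBall, dist_zero_right, Real.norm_eq_abs] at this
    obtain ⟨h1, h2⟩ := abs_le.1 this
    constructor <;> linarith
  have hlim : ∀ᵐ ω ∂μ, ∃ x, Tendsto (fun n => f n ω) atTop (𝓝 x) := by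
    filter_upwards [hae] with ω hω
    refine ⟨f 0 ω + ∑' n, g n ω, ?_⟩
    exact (tendsto_const_nhds.add hω.hasSum.tendsto_sum_nat).congr fun n => (hfg n ω).symm
  obtain ⟨G, hG, hGae, hGl⟩ := exists_measurable_cut hlim
  choose! x hx using hGl
  refine ⟨F, fun ω => if ω ∈ G then x ω else 0, ⟨?_, hhalf, hex, ?_⟩⟩
  · refine measurable_pathSpace fun t => ?_
    refine measurable_of_tendsto_metrizable (f := fun n ω => if ω ∈ G then f n ω t else 0)
      (fun n => Measurable.ite hG ((measurable_eval t).comp (hβ.measurable_field (F n)))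
        measurable_const) ?_
    rw [tendsto_pi_nhds]
    intro ω
    by_cases hω : ω ∈ G
    · simp only [if_pos hω]
      exact ((ContinuousEvalConst.continuous_eval_const t).tendsto _).comp (hx ω hω)
    · simp only [if_neg hω]
      exact tendsto_const_nhds
  · filter_upwards [hGae] with ω hω
    rw [if_pos hω]
    exact hx ω hω

/-- Fatou's lemma along the almost surely convergent partial sums. -/
lemma IsModeSeries.lintegral_supNorm_le {hβ : IsRegularFBM H a β μ} {F : ℕ → Finset Mode}
    {X : S → PathSpace m} (hX : IsModeSeries σ hβ F X) {T₁ T₂ : ℝ} {C : ENNReal}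
    (h : ∀ n, ∫⁻ ω, ENNReal.ofReal
      (supNorm T₁ T₂ (field m σ (fun k => hβ.ouPath k ω) (F n)) ^ 2) ∂μ ≤ C) :
    ∫⁻ ω, ENNReal.ofReal (supNorm T₁ T₂ (X ω) ^ 2) ∂μ ≤ C := by
  have hc : Continuous fun ψ : PathSpace m => ENNReal.ofReal (supNorm T₁ T₂ ψ ^ 2) :=
    ENNReal.continuous_ofReal.comp ((continuous_supNorm T₁ T₂).pow 2)
  calc ∫⁻ ω, ENNReal.ofReal (supNorm T₁ T₂ (X ω) ^ 2) ∂μ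
      = ∫⁻ ω, liminf (fun n => ENNReal.ofReal
          (supNorm T₁ T₂ (field m σ (fun k => hβ.ouPath k ω) (F n)) ^ 2)) atTop ∂μ := by
        refine lintegral_congr_ae (hX.tendsto.mono fun ω hω => ?_)
        exact (((hc.tendsto _).comp hω).liminf_eq).symm
    _ ≤ liminf (fun n => ∫⁻ ω, ENNReal.ofReal
          (supNorm T₁ T₂ (field m σ (fun k => hβ.ouPath k ω) (F n)) ^ 2) ∂μ) atTop :=
        lintegral_liminf_le fun n => hc.measurable.comp (hβ.measurable_field (F n))
    _ ≤ C := by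
        refine (liminf_le_liminf (.of_forall h)).trans (le_of_eq ?_)
        exact liminf_const _

/-- Fourier coefficients are continuous, and those of the partial sums are eventually constant. For
k outside the chosen half, the value comes from the conjugate term of -k and from β_{-k} being the
conjugate of β_k. -/
lemma IsModeSeries.ae_fourierCoef_eq {hβ : IsRegularFBM H a β μ} {F : ℕ → Finset Mode}
    {X : S → PathSpace m} (hX : IsModeSeries σ hβ F X) (ha : ∀ k : Mode, a k.neg = a k)
    (hσ : ∀ k : Mode, σ k.neg = σ k) :
    ∀ᵐ ω ∂μ, ∀ t, fourierCoef 0 (X ω t) = 0 ∧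
      ∀ k : Mode, fourierCoef k.1 (X ω t) = σ k * ou (a k) (fun u => β k u ω) t := by
  filter_upwards [hX.tendsto] with ω hω
  intro t
  have hlim : ∀ k : ℤ × ℤ, Tendsto (fun n => ∑ l ∈ F n,
      ((if k = l.1 then σ l * ou (a l) (fun u => β l u ω) t else 0) +
        (if k = -l.1 then (starRingEnd ℂ) (σ l * ou (a l) (fun u => β l u ω) t) else 0)))
      atTop (𝓝 (fourierCoef k (X ω t))) := fun k => by
    have h1 := ((fourierCLM m k).continuous.tendsto _).comp
      (((ContinuousEvalConst.continuous_eval_const t).tendsto _).comp hω)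
    refine h1.congr fun n => ?_
    simp only [Function.comp_apply, field_apply, map_sum, fourierCLM_apply, fourierCoef_mode]
  refine ⟨tendsto_nhds_unique (hlim 0) (tendsto_const_nhds.congr fun n => ?_), fun k => ?_⟩
  · refine (Finset.sum_eq_zero fun l _ => ?_).symm
    rw [if_neg l.2.symm, if_neg (fun h => l.2 (neg_eq_zero.1 h.symm)), add_zero]
  rcases k.mem_or_neg_mem_halfModes with hk | hk
  · refine tendsto_nhds_unique (hlim k.1) (tendsto_const_nhds.congr' ?_)
    filter_upwards [hX.exhaust k hk] with n hn
    rw [Finset.sum_eq_single_of_mem k hn, if_pos rfl, if_neg, add_zero]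
    · intro h
      have h' : k = k.neg := Subtype.ext h
      refine Mode.neg_notMem_halfModes hk ?_
      rw [← h']
      exact hk
    · intro l hl hlk
      rw [if_neg (fun h => hlk (Subtype.ext h.symm)), if_neg, add_zero]
      intro h
      exact Mode.neg_notMem_halfModes (hX.half n l hl) ((Subtype.ext h : k = l.neg) ▸ hk)
  · have hval : (starRingEnd ℂ) (σ k.neg * ou (a k.neg) (fun u => β k.neg u ω) t) =
        σ k * ou (a k) (fun u => β k u ω) t := by
      simp only [hβ.conj_eq, ou_conj, map_mul, Complex.conj_ofReal, Complex.conj_conj, ha, hσ]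
    rw [← hval]
    refine tendsto_nhds_unique (hlim k.1) (tendsto_const_nhds.congr' ?_)
    filter_upwards [hX.exhaust k.neg hk] with n hn
    rw [Finset.sum_eq_single_of_mem k.neg hn, if_neg, if_pos, zero_add]
    · exact (_root_.neg_neg k.1).symm
    · intro h
      have h' : k = k.neg := Subtype.ext h
      refine Mode.neg_notMem_halfModes hk ?_
      rw [k.neg_neg, h']
      exact hk
    · intro l hl hlk
      rw [if_neg, if_neg, add_zero]
      · intro h
        exact hlk (Subtype.ext (by change l.1 = -k.1; rw [h, _root_.neg_neg]))
      · intro h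
        have : k = l := Subtype.ext h
        subst this
        exact Mode.neg_notMem_halfModes (hX.half n k hl) hk

end Construction

/-! ### Mild solutions -/

section Mild

variable {S : Type*} [MeasurableSpace S] {μ : Measure S} {H ν : ℝ} {α lam : Mode → ℝ}
  {β : Mode → ℝ → S → ℂ} {m : ℕ}

lemma IsMildSolution.congr {b : Mode → ℝ → S → ℂ} {X : S → PathSpace m}
    (hX : IsMildSolution H ν α lam b μ X) (h : ∀ᵐ ω ∂μ, ∀ k t, b k t ω = β k t ω) :
    IsMildSolution H ν α lam β μ X where
  mean_zero := hX.mean_zero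
  mild s t hst := by
    filter_upwards [hX.mild s t hst, h] with ω h1 h2
    simpa only [h2] using h1

lemma IsModeSeries.isMildSolution
    {hβ : IsRegularFBM H (fun k => ν * α k) β μ} {F : ℕ → Finset Mode} {X : S → PathSpace m}
    (hX : IsModeSeries (fun k => Real.sqrt (lam k) * ν ^ H) hβ F X) (ha : ∀ k, 0 < ν * α k)
    (hα : ∀ k : Mode, α k.neg = α k) (hlam : ∀ k : Mode, lam k.neg = lam k) :
    IsMildSolution H ν α lam β μ X := by
  have hae := hX.ae_fourierCoef_eq (fun k => by rw [hα]) (fun k => by rw [hlam])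
  refine ⟨fun t => hae.mono fun ω hω => (hω t).1, fun s t hst => hae.mono fun ω hω k => ?_⟩
  refine ⟨expStieltjes (ν * α k) (fun u => β k u ω) s t, ?_, ?_⟩
  · simpa only [mul_assoc] using
      hasStieltjesIntegral_exp (ha k).le (hβ.ouPath k ω).continuous hst
  · rw [(hω t).2 k, (hω s).2 k, (hβ.ouPath k ω).ou_eq s t, ← mul_assoc (t - s)]
    ring

lemma measurable_path_eval {X : S → PathSpace m} (hX : Measurable X) (t : ℝ) :
    Measurable fun ω => X ω t := (measurable_eval t).comp hX

lemma IsStrictlyStationary.lintegral_eq {X : S → PathSpace m} (h : IsStrictlyStationary μ X)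
    (hX : Measurable X) {g : CmTorus m → ENNReal} (hg : Measurable g) (t r : ℝ) :
    ∫⁻ ω, g (X ω (t + r)) ∂μ = ∫⁻ ω, g (X ω t) ∂μ := by
  have hm : ∀ t, Measurable fun (ω : S) (_ : Fin 1) => X ω t := fun t =>
    measurable_pi_lambda _ fun _ => measurable_path_eval hX t
  have hg' : Measurable fun x : Fin 1 → CmTorus m => g (x 0) := hg.comp (measurable_pi_apply 0)
  have h1 := lintegral_map (μ := μ) hg' (hm (t + r))
  have h2 := lintegral_map (μ := μ) hg' (hm t)
  rw [← h1, ← h2, h 1 (fun _ => t) r]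

/-- Both solutions see the same noise integral, by uniqueness of the Riemann-Stieltjes integral, so
it cancels in the difference. -/
lemma IsMildSolution.ae_fourierCoef_sub {X Y : S → PathSpace m}
    (hX : IsMildSolution H ν α lam β μ X) (hY : IsMildSolution H ν α lam β μ Y) {s t : ℝ}
    (hst : s ≤ t) : ∀ᵐ ω ∂μ, ∀ k : Mode, fourierCoef k.1 (X ω t) - fourierCoef k.1 (Y ω t) =
      (Real.exp (-((t - s) * ν * α k)) : ℂ) *
        (fourierCoef k.1 (X ω s) - fourierCoef k.1 (Y ω s)) := by
  filter_upwards [hX.mild s t hst, hY.mild s t hst] with ω h1 h2 k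
  obtain ⟨I, hI, hI'⟩ := h1 k
  obtain ⟨J, hJ, hJ'⟩ := h2 k
  rw [hI', hJ', hI.unique hst hJ]
  ring

/-- The difference at time t is e^{-nνα_k} times the difference at time t - n. By stationarity the
size of each solution at t - n has a law independent of n, so the product tends to zero in
probability. Truncation by 1 is used because no moments of the solutions are assumed. -/
lemma IsMildSolution.ae_fourierCoef_eq [IsProbabilityMeasure μ] {X Y : S → PathSpace m}
    (hX : IsMildSolution H ν α lam β μ X) (hY : IsMildSolution H ν α lam β μ Y)
    (hXm : Measurable X) (hYm : Measurable Y) (hXs : IsStrictlyStationary μ X)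
    (hYs : IsStrictlyStationary μ Y) (k : Mode) (hk : 0 < ν * α k) (t : ℝ) :
    ∀ᵐ ω ∂μ, fourierCoef k.1 (X ω t) = fourierCoef k.1 (Y ω t) := by
  set c : ℕ → ENNReal := fun n => ENNReal.ofReal (Real.exp (-((n : ℝ) * (ν * α k)))) with hc
  have hc0 : Tendsto c atTop (𝓝 0) := by
    rw [← ENNReal.ofReal_zero]
    refine ENNReal.tendsto_ofReal (Real.tendsto_exp_neg_atTop_nhds_zero.comp ?_)
    exact tendsto_natCast_atTop_atTop.atTop_mul_const hk
  have hL : ∀ f : CmTorus m, fourierCLM m k.1 f = fourierCoef k.1 f := fun f => fourierCLM_apply k.1 f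
  have hg : ∀ n, Measurable fun f : CmTorus m => min (c n * ‖fourierCLM m k.1 f‖ₑ) 1 := fun n =>
    (((fourierCLM m k.1).continuous.measurable.enorm).const_mul _).min measurable_const
  have hlim : ∀ {Z : S → PathSpace m}, Measurable Z → IsStrictlyStationary μ Z →
      Tendsto (fun n : ℕ => ∫⁻ ω, min (c n * ‖fourierCLM m k.1 (Z ω (t - n))‖ₑ) 1 ∂μ) atTop
        (𝓝 0) := by
    intro Z hZ hZs
    have h1 : ∀ n : ℕ, ∫⁻ ω, min (c n * ‖fourierCLM m k.1 (Z ω (t - n))‖ₑ) 1 ∂μ =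
        ∫⁻ ω, min (c n * ‖fourierCLM m k.1 (Z ω t)‖ₑ) 1 ∂μ := fun n => by
      simpa only [sub_eq_add_neg] using hZs.lintegral_eq hZ (hg n) t (-(n : ℝ))
    simp only [h1]
    rw [← lintegral_zero (μ := μ)]
    refine tendsto_lintegral_of_dominated_convergence (fun _ => 1)
      (fun n => (hg n).comp (measurable_path_eval hZ t)) (fun n => .of_forall fun ω => min_le_right _ _)
      (by simp) (.of_forall fun ω => ?_)
    have h2 : Tendsto (fun n => c n * ‖fourierCLM m k.1 (Z ω t)‖ₑ) atTop (𝓝 0) := by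
      simpa using ENNReal.Tendsto.mul_const hc0 (Or.inr enorm_ne_top)
    have h3 := h2.min (tendsto_const_nhds (x := (1 : ENNReal)))
    simpa using h3
  have hbound : ∀ n : ℕ,
      ∫⁻ ω, min ‖fourierCLM m k.1 (X ω t) - fourierCLM m k.1 (Y ω t)‖ₑ 1 ∂μ ≤
      (∫⁻ ω, min (c n * ‖fourierCLM m k.1 (X ω (t - n))‖ₑ) 1 ∂μ) +
        ∫⁻ ω, min (c n * ‖fourierCLM m k.1 (Y ω (t - n))‖ₑ) 1 ∂μ := by
    intro n
    have hXn : Measurable fun ω => min (c n * ‖fourierCLM m k.1 (X ω (t - n))‖ₑ) 1 :=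
      (hg n).comp (measurable_path_eval hXm _)
    rw [← lintegral_add_left hXn]
    refine lintegral_mono_ae ?_
    filter_upwards [hX.ae_fourierCoef_sub hY (sub_le_self t (Nat.cast_nonneg n))] with ω hω
    have e := hω k
    rw [← hL, ← hL, ← hL, ← hL, sub_sub_cancel, mul_assoc] at e
    have hcn : ‖(Real.exp (-((n : ℝ) * (ν * α k))) : ℂ)‖ₑ = c n := by
      rw [← ofReal_norm, Complex.norm_real, Real.norm_of_nonneg (Real.exp_pos _).le]
    rw [e, enorm_mul, hcn]
    have h4 : c n * ‖fourierCLM m k.1 (X ω (t - n)) - fourierCLM m k.1 (Y ω (t - n))‖ₑ ≤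
        c n * ‖fourierCLM m k.1 (X ω (t - n))‖ₑ + c n * ‖fourierCLM m k.1 (Y ω (t - n))‖ₑ := by
      rw [← mul_add]
      exact mul_le_mul_right (enorm_sub_le) _
    refine (min_le_min_right 1 h4).trans ?_
    rcases le_total (c n * ‖fourierCLM m k.1 (X ω (t - n))‖ₑ) 1 with h5 | h5
    · rcases le_total (c n * ‖fourierCLM m k.1 (Y ω (t - n))‖ₑ) 1 with h6 | h6
      · rw [min_eq_left h5, min_eq_left h6]
        exact min_le_left _ _
      · rw [min_eq_right h6]
        exact (min_le_right _ _).trans le_add_self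
    · rw [min_eq_right h5]
      exact (min_le_right _ _).trans le_self_add
  have hzero : ∫⁻ ω, min ‖fourierCLM m k.1 (X ω t) - fourierCLM m k.1 (Y ω t)‖ₑ 1 ∂μ = 0 := by
    have h8 := (hlim hXm hXs).add (hlim hYm hYs)
    rw [add_zero] at h8
    exact le_antisymm (ge_of_tendsto' h8 hbound) zero_le
  have hmeas : Measurable fun ω =>
      min ‖fourierCLM m k.1 (X ω t) - fourierCLM m k.1 (Y ω t)‖ₑ 1 :=
    (((fourierCLM m k.1).continuous.measurable.comp (measurable_path_eval hXm t)).sub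
      ((fourierCLM m k.1).continuous.measurable.comp
        (measurable_path_eval hYm t))).enorm.min measurable_const
  rw [lintegral_eq_zero_iff hmeas] at hzero
  filter_upwards [hzero] with ω hω
  have h7 : ‖fourierCLM m k.1 (X ω t) - fourierCLM m k.1 (Y ω t)‖ₑ = 0 := by
    rcases min_choice ‖fourierCLM m k.1 (X ω t) - fourierCLM m k.1 (Y ω t)‖ₑ 1 with h | h
    · rw [← h]; exact hω
    · exact absurd (h.symm.trans hω) one_ne_zero
  rw [enorm_eq_zero, sub_eq_zero] at h7
  rw [← hL, ← hL, h7]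

/-- Strictly stationary mild solutions are unique. -/
theorem IsMildSolution.ae_eq [IsProbabilityMeasure μ] {X Y : S → PathSpace m}
    (hX : IsMildSolution H ν α lam β μ X) (hY : IsMildSolution H ν α lam β μ Y)
    (hXm : Measurable X) (hYm : Measurable Y) (hXs : IsStrictlyStationary μ X)
    (hYs : IsStrictlyStationary μ Y) (ha : ∀ k, 0 < ν * α k) : X =ᵐ[μ] Y := by
  -- Countably many times and modes share one null set; uniqueness of Fourier coefficients and
  -- continuity of the paths do the rest.
  have h1 : ∀ᵐ ω ∂μ, ∀ q : ℚ, ∀ k : Mode, fourierCoef k.1 (X ω q) = fourierCoef k.1 (Y ω q) :=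
    ae_all_iff.2 fun q => ae_all_iff.2 fun k =>
      hX.ae_fourierCoef_eq hY hXm hYm hXs hYs k (ha k) q
  have h2 : ∀ᵐ ω ∂μ, ∀ q : ℚ, fourierCoef 0 (X ω q) = 0 := ae_all_iff.2 fun q => hX.mean_zero q
  have h3 : ∀ᵐ ω ∂μ, ∀ q : ℚ, fourierCoef 0 (Y ω q) = 0 := ae_all_iff.2 fun q => hY.mean_zero q
  filter_upwards [h1, h2, h3] with ω h1 h2 h3
  have hq : ∀ q : ℚ, X ω q = Y ω q := fun q => by
    refine CmTorus.ext_fourierCoef fun k => ?_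
    by_cases hk : k = 0
    · rw [hk, h2, h3]
    · exact h1 q ⟨k, hk⟩
  refine ContinuousMap.ext fun t => ?_
  exact congrFun ((Rat.denseRange_cast (𝕜 := ℝ)).equalizer (X ω).continuous (Y ω).continuous
    (funext hq)) t

end Mild

/-! ### Stationarity -/

section Increments

/-- The coefficients of the approximation of the Ornstein-Uhlenbeck functional by increments. -/
noncomputable def incrWeight (a : ℝ) (N M : ℕ) : Option (Fin (M + 1)) × Bool → ℝ
  | (none, true) => Real.exp (-(N * a))
  | (none, false) => -Real.exp (-(N * a))
  | (some i, true) => Real.exp (-((0 - uniformPt (-N) 0 (M + 1) i) * a))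
  | (some i, false) => -Real.exp (-((0 - uniformPt (-N) 0 (M + 1) i) * a))

/-- The time shifts in the approximation of the Ornstein-Uhlenbeck functional by increments. -/
noncomputable def incrShift (N M : ℕ) : Option (Fin (M + 1)) × Bool → ℝ
  | (none, true) => -N
  | (none, false) => 0
  | (some i, true) => uniformPt (-N) 0 (M + 1) (i + 1)
  | (some i, false) => uniformPt (-N) 0 (M + 1) i

lemma sum_incrWeight (a : ℝ) (N M : ℕ) : ∑ j, incrWeight a N M j = 0 := by
  simp [Fintype.sum_prod_type, incrWeight]

lemma uniformPt_add (s t r : ℝ) (n i : ℕ) : uniformPt (s + r) (t + r) n i = r + uniformPt s t n i := by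
  unfold uniformPt; ring

variable {a : ℝ} {g : ℝ → ℂ}

/-- The limit of the approximations by increments on `[t - N, t]`. -/
noncomputable def incrLimit (a : ℝ) (g : ℝ → ℂ) (t : ℝ) (N : ℕ) : ℂ :=
  (Real.exp (-(N * a)) : ℂ) * (g (t - N) - g t) + expStieltjes a g (t - N) t

lemma tendsto_sum_incr (ha : 0 ≤ a) (hg : Continuous g) (t : ℝ) (N : ℕ) :
    Tendsto (fun M => ∑ j, (incrWeight a N M j : ℂ) * g (t + incrShift N M j)) atTop
      (𝓝 (incrLimit a g t N)) := by
  have hst : t - (N : ℝ) ≤ t := sub_le_self t (Nat.cast_nonneg N)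
  have h := ((hasStieltjesIntegral_exp ha hg hst).tendsto hst).const_add
    ((Real.exp (-(N * a)) : ℂ) * (g (t - N) - g t))
  refine h.congr fun M => ?_
  have hu : ∀ i, uniformPt (t - N) t (M + 1) i = t + uniformPt (-N) 0 (M + 1) i := fun i => by
    rw [← uniformPt_add]; congr 1 <;> ring
  rw [Fintype.sum_prod_type, Fintype.sum_option, Finset.sum_range]
  simp only [Fintype.sum_bool, incrWeight, incrShift, hu]
  congr 1
  · push_cast
    rw [add_zero, ← sub_eq_add_neg]
    ring
  · refine Finset.sum_congr rfl fun i _ => ?_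
    rw [zero_sub, sub_add_cancel_left]
    push_cast
    ring

/-- Truncating the integral at t - N omits e^{-Na} times the functional at t - N, which contains the
boundary term e^{-Na} g(t - N); integrability alone does not send this to zero. The extra increment
e^{-Na}(g(t - N) - g(t)) cancels it and still has weights of sum zero. The error left is an integral
tail and e^{-Na} g(t). -/
lemma OUPath.tendsto_incrLimit (h : OUPath a g) (ha : 0 < a) (t : ℝ) :
    Tendsto (incrLimit a g t) atTop (𝓝 (ou a g t)) := by
  have hc0 : Tendsto (fun N : ℕ => (Real.exp (-((N : ℝ) * a)) : ℂ)) atTop (𝓝 0) := by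
    have h1 := (Real.tendsto_exp_neg_atTop_nhds_zero.comp
      (tendsto_natCast_atTop_atTop (R := ℝ).atTop_mul_const ha))
    exact_mod_cast (Complex.continuous_ofReal.tendsto 0).comp h1
  have htail : Tendsto (fun N : ℕ => ∫ u in Set.Iic (t - (N : ℝ)), (Real.exp (a * u) : ℂ) * g u)
      atTop (𝓝 0) := by
    have h2 := intervalIntegral_tendsto_integral_Iic t (h.integrableOn_Iic t)
      (tendsto_atBot_add_const_left _ t
        (tendsto_neg_atTop_atBot.comp (tendsto_natCast_atTop_atTop (R := ℝ))))
    have h3 := (tendsto_const_nhds (x := ∫ u in Set.Iic t, (Real.exp (a * u) : ℂ) * g u)).sub h2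
    rw [sub_self] at h3
    refine h3.congr fun N => ?_
    rw [← intervalIntegral.integral_Iic_sub_Iic (h.integrableOn_Iic _) (h.integrableOn_Iic t)]
    simp [sub_eq_add_neg]
  have hlim := ((htail.const_mul ((a * Real.exp (-(t * a)) : ℝ) : ℂ)).sub
    (hc0.mul_const (g t))).const_add (ou a g t)
  simp only [mul_zero, zero_mul, sub_zero, add_zero] at hlim
  refine hlim.congr fun N => ?_
  have h4 := h.ou_eq (t - N) t
  rw [sub_sub_cancel] at h4
  have h5 : expStieltjes a g (t - N) t =
      ou a g t - (Real.exp (-((N : ℝ) * a)) : ℂ) * ou a g (t - N) := by rw [h4]; ring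
  have h6 : (Real.exp (-((N : ℝ) * a)) : ℂ) * ((a * Real.exp (-((t - N) * a)) : ℝ) : ℂ) =
      ((a * Real.exp (-(t * a)) : ℝ) : ℂ) := by
    rw [← Complex.ofReal_mul]
    congr 1
    rw [mul_left_comm, ← Real.exp_add]
    congr 2
    ring
  rw [incrLimit, h5, ou, ou]
  linear_combination (-(∫ u in Set.Iic (t - (N : ℝ)), (Real.exp (a * u) : ℂ) * g u)) * h6

end Increments

/-! ### Shift invariance through characteristic functions. -/

section CharFun

variable {S : Type*} [MeasurableSpace S] {μ : Measure S}

lemma tendsto_integral_cexp [IsProbabilityMeasure μ] {Y : ℕ → S → ℝ} {Z : S → ℝ}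
    (hY : ∀ n, Measurable (Y n)) (h : ∀ᵐ ω ∂μ, Tendsto (fun n => Y n ω) atTop (𝓝 (Z ω))) :
    Tendsto (fun n => ∫ ω, Complex.exp (Y n ω * Complex.I) ∂μ) atTop
      (𝓝 (∫ ω, Complex.exp (Z ω * Complex.I) ∂μ)) := by
  refine tendsto_integral_of_dominated_convergence (fun _ => 1) (fun n => ?_)
    (integrable_const _) (fun n => .of_forall fun ω => ?_) (h.mono fun ω hω => ?_)
  · have := hY n
    exact Measurable.aestronglyMeasurable (by fun_prop)
  · rw [Complex.norm_exp_ofReal_mul_I]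
  · exact ((by fun_prop : Continuous fun x : ℝ => Complex.exp (x * Complex.I)).tendsto _).comp hω

variable {H : ℝ} {a σ : Mode → ℝ} {β : Mode → ℝ → S → ℂ} {J : Type*} [Fintype J]

lemma integral_cexp_eq_of_map_eq {Y Z : S → ℝ} (hY : Measurable Y) (hZ : Measurable Z)
    (h : μ.map Y = μ.map Z) :
    ∫ ω, Complex.exp (Y ω * Complex.I) ∂μ = ∫ ω, Complex.exp (Z ω * Complex.I) ∂μ := by
  have hm : ∀ ρ : Measure ℝ, AEStronglyMeasurable (fun x : ℝ => Complex.exp (x * Complex.I)) ρ :=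
    fun ρ => Continuous.aestronglyMeasurable (by fun_prop)
  rw [← integral_map (f := fun x : ℝ => Complex.exp (x * Complex.I)) hY.aemeasurable (hm _),
    ← integral_map (f := fun x : ℝ => Complex.exp (x * Complex.I)) hZ.aemeasurable (hm _), h]

/-- A functional of a finite combination of shifted paths is again such a functional of the path
itself, with product weights, so the Gaussian law of finite combinations applies to it. -/
lemma pathFunctional_sum {J' : Type*} [Fintype J'] (x y τ : J → ℝ) (w d : J' → ℝ) (z : ℝ → ℂ) :
    pathFunctional x y τ (fun t => ∑ j, (w j : ℂ) * z (t + d j)) =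
      pathFunctional (fun q : J × J' => x q.1 * w q.2) (fun q => y q.1 * w q.2)
        (fun q => τ q.1 + d q.2) z := by
  simp only [pathFunctional, Complex.re_sum, Complex.im_sum, Complex.re_ofReal_mul,
    Complex.im_ofReal_mul, Fintype.sum_prod_type, Finset.mul_sum, mul_assoc]

lemma continuous_pathFunctional (x y τ : J → ℝ) : Continuous (pathFunctional x y τ) := by
  unfold pathFunctional
  fun_prop

lemma measurable_sum_pathFunctional {z : Mode → S → ℝ → ℂ} (hz : ∀ k t, Measurable fun ω => z k ω t)
    (F : Finset Mode) (x y : Mode → J → ℝ) (τ : J → ℝ) :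
    Measurable fun ω => ∑ k ∈ F, pathFunctional (x k) (y k) τ (z k ω) :=
  Finset.measurable_fun_sum _ fun k _ =>
    (measurable_pathFunctional _ _ _).comp (measurable_pi_lambda _ fun t => hz k t)

/-- Shift invariance of the characteristic functions of the finite linear combinations of `z`. -/
def ShiftInvariant (μ : Measure S) (z : Mode → S → ℝ → ℂ) (F : Finset Mode) (x y : Mode → J → ℝ)
    (τ : J → ℝ) (r : ℝ) : Prop :=
  ∫ ω, Complex.exp ((∑ k ∈ F, pathFunctional (x k) (y k) (fun j => τ j + r) (z k ω) : ℝ) *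
      Complex.I) ∂μ =
    ∫ ω, Complex.exp ((∑ k ∈ F, pathFunctional (x k) (y k) τ (z k ω) : ℝ) * Complex.I) ∂μ

lemma ShiftInvariant.of_tendsto [IsProbabilityMeasure μ] {F : Finset Mode} {x y : Mode → J → ℝ}
    {τ : J → ℝ} {r : ℝ} {z : ℕ → Mode → S → ℝ → ℂ} {z' : Mode → S → ℝ → ℂ}
    (h : ∀ n, ShiftInvariant μ (z n) F x y τ r) (hz : ∀ n k t, Measurable fun ω => z n k ω t)
    (hlim : ∀ k ω t, Tendsto (fun n => z n k ω t) atTop (𝓝 (z' k ω t))) :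
    ShiftInvariant μ z' F x y τ r := by
  have hΦ : ∀ (τ : J → ℝ) ω, Tendsto (fun n => ∑ k ∈ F, pathFunctional (x k) (y k) τ (z n k ω)) atTop
      (𝓝 (∑ k ∈ F, pathFunctional (x k) (y k) τ (z' k ω))) := fun τ ω =>
    tendsto_finsetSum _ fun k _ => ((continuous_pathFunctional (x k) (y k) τ).tendsto _).comp
      (tendsto_pi_nhds.2 fun t => hlim k ω t)
  refine tendsto_nhds_unique ((tendsto_integral_cexp (fun n =>
    measurable_sum_pathFunctional (hz n) F x y _) (.of_forall (hΦ _))).congr fun n => h n)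
    (tendsto_integral_cexp (fun n => measurable_sum_pathFunctional (hz n) F x y τ)
      (.of_forall (hΦ τ)))

/-- Two limits, the mesh to zero and then the cutoff N to infinity, reduce the claim to finite
combinations of increments. These are centred Gaussians, and their variances are shift invariant
because the weights sum to zero. -/
lemma IsRegularFBM.shiftInvariant_ou [IsProbabilityMeasure μ] (hβ : IsRegularFBM H a β μ)
    (ha : ∀ k, 0 < a k) {F : Finset Mode} (hF : ∀ k ∈ F, k.neg ∉ F) (x y : Mode → J → ℝ)
    (τ : J → ℝ) (r : ℝ) :
    ShiftInvariant μ (fun k ω => ou (a k) fun u => β k u ω) F x y τ r := by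
  have hm0 : ∀ N M k t, Measurable fun ω =>
      ∑ j, (incrWeight (a k) N M j : ℂ) * β k (t + incrShift N M j) ω := fun N M k t =>
    Finset.measurable_fun_sum _ fun j _ => (hβ.measurable k _).const_mul _
  have hl0 : ∀ N k ω t, Tendsto (fun M => ∑ j, (incrWeight (a k) N M j : ℂ) *
      β k (t + incrShift N M j) ω) atTop (𝓝 (incrLimit (a k) (fun u => β k u ω) t N)) :=
    fun N k ω t => tendsto_sum_incr (ha k).le (hβ.ouPath k ω).continuous t N
  have hm1 : ∀ N k t, Measurable fun ω => incrLimit (a k) (fun u => β k u ω) t N := fun N k t =>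
    measurable_of_tendsto_metrizable (fun M => hm0 N M k t) (tendsto_pi_nhds.2 fun ω => hl0 N k ω t)
  refine ShiftInvariant.of_tendsto (z := fun N k ω t => incrLimit (a k) (fun u => β k u ω) t N)
    (fun N => ?_) hm1 fun k ω t => (hβ.ouPath k ω).tendsto_incrLimit (ha k) t
  refine ShiftInvariant.of_tendsto (z := fun M k ω t => ∑ j, (incrWeight (a k) N M j : ℂ) *
    β k (t + incrShift N M j) ω) (fun M => ?_) (hm0 N) (hl0 N)
  refine integral_cexp_eq_of_map_eq (measurable_sum_pathFunctional (hm0 N M) F x y _)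
    (measurable_sum_pathFunctional (hm0 N M) F x y _) ?_
  have hw : ∀ k (x : J → ℝ), ∑ q : J × (Option (Fin (M + 1)) × Bool),
      x q.1 * incrWeight (a k) N M q.2 = 0 := fun k x => by
    rw [Fintype.sum_prod_type]
    simp [← Finset.mul_sum, sum_incrWeight]
  have hsum := fun k (τ : J → ℝ) ω => pathFunctional_sum (x k) (y k) τ (incrWeight (a k) N M)
    (incrShift N M) (fun t => β k t ω)
  simp only [hsum]
  rw [hβ.toIsInfDimFBM.map_sum_pathFunctional hF, hβ.toIsInfDimFBM.map_sum_pathFunctional hF]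
  congr 2
  refine Finset.sum_congr rfl fun k _ => ?_
  simp only [add_right_comm _ r]
  rw [fbmVar_add_const (hw k (x k)), fbmVar_add_const (hw k (y k))]

end CharFun

/-! ### Stationarity of the series. -/

section Stationarity

variable {S : Type*} [MeasurableSpace S] {μ : Measure S} {H : ℝ} {a σ : Mode → ℝ}
  {β : Mode → ℝ → S → ℂ} {m : ℕ}

/-- The modes depend real-linearly on z, so a functional of the field at finitely many times is a
real combination of the real and imaginary parts of the Ornstein-Uhlenbeck values. -/
lemma dual_field_eq {b : Mode → ℝ → ℂ} (h : ∀ k, OUPath (a k) (b k)) (F : Finset Mode) {n : ℕ}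
    (L : StrongDual ℝ (Fin n → CmTorus m)) (τ : Fin n → ℝ) :
    L (fun i => field m σ h F (τ i)) = ∑ k ∈ F, pathFunctional
      (fun i => L (Pi.single i (mode m k.1 (σ k)))) (fun i => L (Pi.single i (mode m k.1 (σ k * Complex.I))))
      τ (ou (a k) (b k)) := by
  have hmode : ∀ (k : Mode) (z : ℂ), mode m k.1 (σ k * z) =
      z.re • mode m k.1 (σ k) + z.im • mode m k.1 (σ k * Complex.I) := fun k z => by
    rw [← map_smul, ← map_smul, ← map_add]
    congr 1
    simp only [Complex.real_smul]
    nth_rw 1 [← Complex.re_add_im z]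
    ring
  have hpi : (fun i => field m σ h F (τ i)) =
      ∑ i, Pi.single i (field m σ h F (τ i)) := (Finset.univ_sum_single _).symm
  have hs : ∀ (i : Fin n) (c d : ℝ) (f g : CmTorus m), L (Pi.single i (c • f + d • g)) =
      L (Pi.single i f) * c + L (Pi.single i g) * d := fun i c d f g => by
    rw [Pi.single_add, Pi.single_smul, Pi.single_smul, map_add, map_smul, map_smul, smul_eq_mul,
      smul_eq_mul, mul_comm, mul_comm d]
  have hF : ∀ (i : Fin n) (f : Mode → CmTorus m), L (Pi.single i (∑ k ∈ F, f k)) =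
      ∑ k ∈ F, L (Pi.single i (f k)) := fun i f => by
    rw [← map_sum]
    congr 1
    exact map_sum (AddMonoidHom.single (fun _ : Fin n => CmTorus m) i) f F
  rw [hpi, map_sum]
  have hf : ∀ i, field m σ h F (τ i) = ∑ k ∈ F, ((ou (a k) (b k) (τ i)).re • mode m k.1 (σ k) +
      (ou (a k) (b k) (τ i)).im • mode m k.1 (σ k * Complex.I)) := fun i =>
    Finset.sum_congr rfl fun k _ => hmode k _
  simp only [hf, hF, hs]
  rw [Finset.sum_comm]
  refine Finset.sum_congr rfl fun k _ => ?_
  rw [Finset.sum_add_distrib]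
  rfl

/-- Finite-dimensional laws on the separable space C^m are determined by their characteristic
functionals, which are limits of those of the partial sums. -/
lemma IsModeSeries.isStrictlyStationary [IsProbabilityMeasure μ] {hβ : IsRegularFBM H a β μ}
    {F : ℕ → Finset Mode} {X : S → PathSpace m} (hX : IsModeSeries σ hβ F X) (ha : ∀ k, 0 < a k) :
    IsStrictlyStationary μ X := by
  intro n τ r
  have hm : ∀ τ : Fin n → ℝ, Measurable fun ω i => X ω (τ i) := fun τ =>
    measurable_pi_lambda _ fun i => measurable_path_eval hX.measurable _
  have := Measure.isProbabilityMeasure_map (μ := μ) (hm τ).aemeasurable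
  have := Measure.isProbabilityMeasure_map (μ := μ) (hm fun i => τ i + r).aemeasurable
  refine Measure.ext_of_charFunDual (funext fun L => ?_)
  have hL : Continuous L := L.continuous
  have hexp : ∀ ρ : Measure (Fin n → CmTorus m),
      AEStronglyMeasurable (fun v => Complex.exp (L v * Complex.I)) ρ := fun ρ =>
    Continuous.aestronglyMeasurable (by fun_prop)
  rw [charFunDual_apply, charFunDual_apply, integral_map (hm _).aemeasurable (hexp _),
    integral_map (hm _).aemeasurable (hexp _)]
  have hlim : ∀ τ : Fin n → ℝ, Tendsto (fun N => ∫ ω, Complex.exp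
      ((L fun i => field m σ (fun k => hβ.ouPath k ω) (F N) (τ i)) * Complex.I) ∂μ) atTop
      (𝓝 (∫ ω, Complex.exp ((L fun i => X ω (τ i)) * Complex.I) ∂μ)) := fun τ => by
    refine tendsto_integral_cexp (fun N => ?_) (hX.tendsto.mono fun ω hω => ?_)
    · exact hL.measurable.comp (measurable_pi_lambda _ fun i =>
        measurable_path_eval (hβ.measurable_field (F N)) _)
    · exact (hL.tendsto _).comp (tendsto_pi_nhds.2 fun i =>
        ((ContinuousEvalConst.continuous_eval_const (τ i)).tendsto _).comp hω)
  refine tendsto_nhds_unique ((hlim _).congr fun N => ?_) (hlim τ)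
  simp only [dual_field_eq]
  exact hβ.shiftInvariant_ou ha (fun k hk h =>
    Mode.neg_notMem_halfModes (hX.half N k hk) (hX.half N _ h)) _ _ τ r

end Stationarity

/-! ### The law of the stationary solution -/

/-- The moment estimates require γ ≤ H, so γ is lowered to γ' = min(γ, H). This is harmless: |k| ≥ 1
handles the length, and α_k ≥ c gives α_k^{2γ'-2γ} ≤ c^{2γ'-2γ}. The factor ν^{2H} from σ_k² cancels
ν^{-2H} from a_k. -/
lemma summable_weight {H ν γ : ℝ} {m : ℕ} {α lam : Mode → ℝ} (hν : 0 < ν)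
    (hspec : SpectralAssumption α lam)
    (hsum₁ : Summable fun k : Mode => lam k * α k ^ (2 * γ - 2 * H) * k.length ^ (2 * m))
    (hsum₂ : Summable fun k : Mode =>
      lam k * α k ^ (-(2 * H)) * k.length ^ (2 * (m : ℝ) + 2 * γ)) :
    Summable (weight H (min γ H) m (fun k => ν * α k) fun k => Real.sqrt (lam k) * ν ^ H) := by
  obtain ⟨c, hc, hcα⟩ := hspec.alpha_lower
  have hα : ∀ k, 0 < α k := fun k => hc.trans_le (hcα k)
  set γ' := min γ H with hγ'
  have hγ'γ : γ' ≤ γ := min_le_left _ _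
  refine Summable.of_nonneg_of_le
    (weight_nonneg fun k => mul_pos hν (hα k)) (fun k => ?_)
    (hsum₂.add (hsum₁.mul_left (ν ^ (2 * γ') * c ^ (2 * γ' - 2 * γ))))
  have hlam := hspec.lam_nonneg k
  have hl := k.one_le_length
  have hl0 : 0 < k.length := by linarith
  have e1 : (Real.sqrt (lam k) * ν ^ H) ^ 2 = lam k * ν ^ (2 * H) := by
    rw [mul_pow, Real.sq_sqrt hlam, ← Real.rpow_mul_natCast hν.le, mul_comm H]
    norm_num
  have e2 : (ν * α k) ^ (-(2 * H)) = ν ^ (-(2 * H)) * α k ^ (-(2 * H)) :=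
    Real.mul_rpow hν.le (hα k).le
  have e3 : (ν * α k) ^ (2 * γ' - 2 * H) =
      ν ^ (2 * γ') * ν ^ (-(2 * H)) * (α k ^ (2 * γ - 2 * H) * α k ^ (2 * γ' - 2 * γ)) := by
    rw [Real.mul_rpow hν.le (hα k).le, ← Real.rpow_add hν, ← Real.rpow_add (hα k)]
    congr 2; ring
  have e4 : ν ^ (2 * H) * ν ^ (-(2 * H)) = 1 := by
    rw [← Real.rpow_add hν, add_neg_cancel, Real.rpow_zero]
  have e5 : k.length ^ (2 * (m : ℝ) + 2 * γ) = (k.length ^ m) ^ 2 * (k.length ^ γ) ^ 2 := by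
    rw [Real.rpow_add hl0, ← pow_mul, ← Real.rpow_natCast k.length, ← Real.rpow_natCast (k.length ^ γ),
      ← Real.rpow_mul hl0.le]
    push_cast
    rw [mul_comm (m : ℝ), mul_comm γ]
  have e6 : k.length ^ (2 * m) = (k.length ^ m) ^ 2 := by rw [← pow_mul, mul_comm]
  have i1 : (k.length ^ γ') ^ 2 ≤ (k.length ^ γ) ^ 2 :=
    pow_le_pow_left₀ (by positivity) (Real.rpow_le_rpow_of_exponent_le hl hγ'γ) 2
  have i2 : α k ^ (2 * γ' - 2 * γ) ≤ c ^ (2 * γ' - 2 * γ) :=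
    Real.rpow_le_rpow_of_nonpos hc (hcα k) (by linarith)
  have p1 := Real.rpow_pos_of_pos (hα k) (-(2 * H))
  have p2 := Real.rpow_pos_of_pos (hα k) (2 * γ - 2 * H)
  have p3 := Real.rpow_pos_of_pos hν (2 * γ')
  unfold weight
  rw [e1, e2, e3, e5, e6]
  calc lam k * ν ^ (2 * H) * (k.length ^ m) ^ 2 * (ν ^ (-(2 * H)) * α k ^ (-(2 * H)) *
        (k.length ^ γ') ^ 2 + ν ^ (2 * γ') * ν ^ (-(2 * H)) *
          (α k ^ (2 * γ - 2 * H) * α k ^ (2 * γ' - 2 * γ)))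
      = (ν ^ (2 * H) * ν ^ (-(2 * H))) * (lam k * (k.length ^ m) ^ 2 * (α k ^ (-(2 * H)) *
        (k.length ^ γ') ^ 2 + ν ^ (2 * γ') *
          (α k ^ (2 * γ - 2 * H) * α k ^ (2 * γ' - 2 * γ)))) := by ring
    _ = lam k * (k.length ^ m) ^ 2 * (α k ^ (-(2 * H)) *
        (k.length ^ γ') ^ 2 + ν ^ (2 * γ') *
          (α k ^ (2 * γ - 2 * H) * α k ^ (2 * γ' - 2 * γ))) := by rw [e4, one_mul]
    _ ≤ lam k * (k.length ^ m) ^ 2 * (α k ^ (-(2 * H)) *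
        (k.length ^ γ) ^ 2 + ν ^ (2 * γ') *
          (α k ^ (2 * γ - 2 * H) * c ^ (2 * γ' - 2 * γ))) := by gcongr
    _ = _ := by ring

section Law

variable {H ν γ : ℝ} {m : ℕ} {α lam : Mode → ℝ}

/-- The series over the modes is a stationary mild solution driven by `β`. -/
lemma exists_isModeSeries_of_isInfDimFBM (hH : H ∈ Set.Ioo (0 : ℝ) 1) (hν : 0 < ν) (hγ : 0 < γ)
    (hspec : SpectralAssumption α lam)
    (hW : Summable (weight H (min γ H) m (fun k => ν * α k) fun k => Real.sqrt (lam k) * ν ^ H))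
    {S : Type u} [MeasurableSpace S] {μ : Measure S} [IsProbabilityMeasure μ]
    {β : Mode → ℝ → S → ℂ} (hβ : IsInfDimFBM H β μ) :
    ∃ (b : Mode → ℝ → S → ℂ) (hb : IsRegularFBM H (fun k => ν * α k) b μ)
      (F : ℕ → Finset Mode) (X : S → PathSpace m),
      IsModeSeries (fun k => Real.sqrt (lam k) * ν ^ H) hb F X ∧
      IsMildSolution H ν α lam β μ X ∧ IsStrictlyStationary μ X := by
  obtain ⟨c, hc, hcα⟩ := hspec.alpha_lower
  have ha : ∀ k, 0 < ν * α k := fun k => mul_pos hν (hc.trans_le (hcα k))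
  obtain ⟨b, hb, hbβ⟩ := hβ.exists_regular hH ha
  obtain ⟨F, X, hX⟩ := exists_isModeSeries hb hH (lt_min hγ hH.1) (min_le_right γ H) ha hW
  exact ⟨b, hb, F, X, hX, (hX.isMildSolution ha hspec.alpha_symm hspec.lam_symm).congr hbβ,
    hX.isStrictlyStationary ha⟩

lemma IsSolutionLaw.isProbabilityMeasure {P : Measure (PathSpace m)}
    (hP : IsSolutionLaw.{u} H ν α lam P) : IsProbabilityMeasure P := by
  obtain ⟨S, _, μ, β, X, hμ, -, hXm, -, -, rfl⟩ := hP
  exact Measure.isProbabilityMeasure_map hXm.aemeasurable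

/-- Second moments of the supremum norms, uniformly in the position of the time interval. -/
theorem exists_lintegral_supNorm_le (hH : H ∈ Set.Ioo (0 : ℝ) 1) (hν : 0 < ν) (hγ : 0 < γ)
    (hspec : SpectralAssumption α lam)
    (hW : Summable (weight H (min γ H) m (fun k => ν * α k) fun k => Real.sqrt (lam k) * ν ^ H))
    {l : ℝ} (hl : 0 < l) :
    ∃ C : ℝ, 0 < C ∧ ∀ P : Measure (PathSpace m), IsSolutionLaw.{u} H ν α lam P → ∀ T : ℝ,
      ∫⁻ ψ, ENNReal.ofReal (supNorm T (T + l) ψ ^ 2) ∂P ≤ ENNReal.ofReal C := by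
  obtain ⟨c, hc, hcα⟩ := hspec.alpha_lower
  have ha : ∀ k, 0 < ν * α k := fun k => mul_pos hν (hc.trans_le (hcα k))
  obtain ⟨K, hK, hbound⟩ := exists_lintegral_supNorm_field_le.{u} hH (lt_min hγ hH.1)
    (min_le_right γ H) m hl
  set w := weight H (min γ H) m (fun k => ν * α k) fun k => Real.sqrt (lam k) * ν ^ H with hw
  have hw0 : ∀ k, 0 ≤ w k := weight_nonneg ha
  have hA : 0 < ∑' k, w k + 1 := by
    have : 0 ≤ ∑' k, w k := tsum_nonneg hw0
    linarith
  refine ⟨K * (∑' k, w k + 1), by positivity, ?_⟩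
  rintro P ⟨S, _, μ, β, Y, hμ, hβ, hYm, hY, hYs, rfl⟩ T
  obtain ⟨b, hb, F, X, hX, hXmild, hXs⟩ := exists_isModeSeries_of_isInfDimFBM hH hν hγ hspec hW hβ
  -- Uniqueness replaces the given solution by the series, so the constant depends only on the
  -- weights and on l, not on the probability space.
  have hYX := hY.ae_eq hXmild hYm hX.measurable hYs hXs ha
  have hm : Measurable fun ψ : PathSpace m => ENNReal.ofReal (supNorm T (T + l) ψ ^ 2) :=
    ((continuous_supNorm T (T + l)).measurable.pow_const 2).ennreal_ofReal
  rw [lintegral_map hm hYm, lintegral_congr_ae (g := fun ω => ENNReal.ofReal (supNorm T (T + l) (X ω) ^ 2))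
    (hYX.mono fun ω hω => by simp only [hω])]
  refine hX.lintegral_supNorm_le fun n => ?_
  refine hbound hb ha (fun k hk h => Mode.neg_notMem_halfModes (hX.half n k hk) (hX.half n _ h)) T hA ?_
  exact (hW.sum_le_tsum _ fun k _ => hw0 k).trans (by linarith)

/-! ### Sublinear growth of the paths. -/

lemma exists_linear_bound {f : ℕ → ℝ} (hf : ∀ n, 0 ≤ f n)
    (h : Tendsto (fun n => f n ^ 2 / ((n : ℝ) + 1) ^ 2) atTop (𝓝 0)) {δ : ℝ} (hδ : 0 < δ) :
    ∃ C : ℝ, 0 < C ∧ ∀ n, f n ≤ δ * n + C := by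
  obtain ⟨N, hN⟩ := eventually_atTop.1 (h.eventually (gt_mem_nhds (by positivity : 0 < δ ^ 2)))
  refine ⟨δ + ∑ i ∈ Finset.range N, f i, ?_, fun n => ?_⟩
  · have := Finset.sum_nonneg fun i (_ : i ∈ Finset.range N) => hf i
    linarith
  have hs := Finset.sum_nonneg fun i (_ : i ∈ Finset.range N) => hf i
  rcases lt_or_ge n N with hn | hn
  · have := Finset.single_le_sum (fun i _ => hf i) (Finset.mem_range.2 hn)
    have h2 : 0 ≤ δ * n := by positivity
    linarith
  · have h1 := hN n hn
    rw [← div_pow] at h1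
    have h2 := (le_abs_self _).trans_lt (abs_lt_of_sq_lt_sq h1 hδ.le)
    rw [div_lt_iff₀ (by positivity)] at h2
    linarith

lemma mem_sublinearPaths_of_tendsto {ψ : PathSpace m}
    (h₁ : Tendsto (fun n : ℕ => supNorm n (n + 1) ψ ^ 2 / ((n : ℝ) + 1) ^ 2) atTop (𝓝 0))
    (h₂ : Tendsto (fun n : ℕ => supNorm (-((n : ℝ) + 1)) (-((n : ℝ) + 1) + 1) ψ ^ 2 /
      ((n : ℝ) + 1) ^ 2) atTop (𝓝 0)) : ψ ∈ sublinearPaths m := by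
  intro δ hδ
  obtain ⟨C₁, hC₁, hb₁⟩ := exists_linear_bound (fun n => supNorm_nonneg _ _ _) h₁ hδ
  obtain ⟨C₂, hC₂, hb₂⟩ := exists_linear_bound (fun n => supNorm_nonneg _ _ _) h₂ hδ
  refine ⟨C₁ + C₂, by positivity, fun t => ?_⟩
  have h1 := Nat.floor_le (abs_nonneg t)
  have h2 := Nat.lt_floor_add_one |t|
  have h3 := mul_le_mul_of_nonneg_left h1 hδ.le
  rcases le_total 0 t with ht | ht
  · rw [abs_of_nonneg ht] at h1 h2 h3 ⊢
    have := norm_le_supNorm (T₁ := (⌊t⌋₊ : ℝ)) (T₂ := (⌊t⌋₊ : ℝ) + 1) ⟨h1, h2.le⟩ ψ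
    linarith [hb₁ ⌊t⌋₊]
  · rw [abs_of_nonpos ht] at h1 h2 h3 ⊢
    have := norm_le_supNorm (T₁ := -((⌊-t⌋₊ : ℝ) + 1)) (T₂ := -((⌊-t⌋₊ : ℝ) + 1) + 1) (t := t)
      ⟨by linarith, by linarith⟩ ψ
    linarith [hb₂ ⌊-t⌋₊]

/-- The means are at most C/(n + 1)², which is summable, so almost surely the terms themselves form
a convergent series. -/
lemma ae_tendsto_supNorm_div {P : Measure (PathSpace m)} {C : ℝ} (T : ℕ → ℝ)
    (h : ∀ T : ℝ, ∫⁻ ψ, ENNReal.ofReal (supNorm T (T + 1) ψ ^ 2) ∂P ≤ ENNReal.ofReal C) :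
    ∀ᵐ ψ ∂P, Tendsto (fun n : ℕ => supNorm (T n) (T n + 1) ψ ^ 2 / ((n : ℝ) + 1) ^ 2) atTop (𝓝 0) := by
  have hm : ∀ n, Measurable fun ψ : PathSpace m =>
      ENNReal.ofReal (supNorm (T n) (T n + 1) ψ ^ 2 / ((n : ℝ) + 1) ^ 2) := fun n =>
    (((continuous_supNorm (T n) (T n + 1)).measurable.pow_const 2).div_const _).ennreal_ofReal
  have hfin : ∫⁻ ψ, ∑' n : ℕ, ENNReal.ofReal (supNorm (T n) (T n + 1) ψ ^ 2 / ((n : ℝ) + 1) ^ 2) ∂P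
      ≠ ⊤ := by
    rw [lintegral_tsum fun n => (hm n).aemeasurable]
    have hle : ∀ n : ℕ, ∫⁻ ψ, ENNReal.ofReal (supNorm (T n) (T n + 1) ψ ^ 2 / ((n : ℝ) + 1) ^ 2) ∂P ≤
        ENNReal.ofReal (C * (1 / ((n : ℝ) + 1) ^ 2)) := fun n => by
      have hn : (0 : ℝ) ≤ 1 / ((n : ℝ) + 1) ^ 2 := by positivity
      have he : ∀ ψ : PathSpace m,
          ENNReal.ofReal (supNorm (T n) (T n + 1) ψ ^ 2 / ((n : ℝ) + 1) ^ 2) =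
            ENNReal.ofReal (supNorm (T n) (T n + 1) ψ ^ 2) *
              ENNReal.ofReal (1 / ((n : ℝ) + 1) ^ 2) := fun ψ => by
        rw [div_eq_mul_one_div, ENNReal.ofReal_mul' hn]
      rw [lintegral_congr he, ENNReal.ofReal_mul' hn, lintegral_mul_const' _ _ ENNReal.ofReal_ne_top]
      exact mul_le_mul_left (h (T n)) _
    refine ne_top_of_le_ne_top ?_ (ENNReal.tsum_le_tsum hle)
    have hs : Summable fun n : ℕ => 1 / ((n : ℝ) + 1) ^ 2 := by
      have := (summable_nat_add_iff (f := fun n : ℕ => 1 / (n : ℝ) ^ 2) 1).2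
        (Real.summable_one_div_nat_pow.2 one_lt_two)
      exact_mod_cast this
    exact (hs.mul_left C).tsum_ofReal_ne_top
  filter_upwards [ae_lt_top (Measurable.tsum hm) hfin] with ψ hψ
  have hs := (ENNReal.summable_toReal hψ.ne).tendsto_atTop_zero
  refine hs.congr fun n => ENNReal.toReal_ofReal (by positivity)

lemma IsSolutionLaw.measure_sublinearPaths (hH : H ∈ Set.Ioo (0 : ℝ) 1) (hν : 0 < ν) (hγ : 0 < γ)
    (hspec : SpectralAssumption α lam)
    (hW : Summable (weight H (min γ H) m (fun k => ν * α k) fun k => Real.sqrt (lam k) * ν ^ H))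
    {P : Measure (PathSpace m)} (hP : IsSolutionLaw.{u} H ν α lam P) : P (sublinearPaths m) = 1 := by
  have := hP.isProbabilityMeasure
  obtain ⟨C, -, hbound⟩ := exists_lintegral_supNorm_le.{u} hH hν hγ hspec hW one_pos
  rw [← mem_ae_iff_prob_eq_one measurableSet_sublinearPaths]
  filter_upwards [ae_tendsto_supNorm_div (fun n => n) (hbound P hP),
    ae_tendsto_supNorm_div (fun n => -((n : ℝ) + 1)) (hbound P hP)] with ψ h1 h2
  exact mem_sublinearPaths_of_tendsto h1 h2

end Law

end FracField

theorem mainTheorem9 (H ν γ : ℝ) (m : ℕ) (α lam : Mode → ℝ)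
    (hH : H ∈ Set.Ioo (0 : ℝ) 1) (hν : 0 < ν) (hγ : γ ∈ Set.Ioo (0 : ℝ) 1)
    (hspec : SpectralAssumption α lam)
    (hsum₁ : Summable fun k : Mode =>
      lam k * α k ^ (2 * γ - 2 * H) * k.length ^ (2 * m))
    (hsum₂ : Summable fun k : Mode =>
      lam k * α k ^ (-(2 * H)) * k.length ^ (2 * (m : ℝ) + 2 * γ)) :
    -- the law of the solution exists: every infinite-dimensional fractional Brownian motion
    -- drives a strictly stationary mild solution with paths in `C(ℝ, C^m(𝕋²))`
    (∀ (S : Type u) [MeasurableSpace S] (μ : Measure S) [IsProbabilityMeasure μ]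
        (β : Mode → ℝ → S → ℂ), IsInfDimFBM H β μ →
        ∃ X : S → PathSpace m, Measurable X ∧ IsMildSolution H ν α lam β μ X ∧
          IsStrictlyStationary μ X) ∧
    -- (i)
    (∀ t : ℝ, Measurable fun ψ : PathSpace m => ‖ψ t‖) ∧
    (∀ T₁ T₂ : ℝ, T₁ < T₂ → Measurable fun ψ : PathSpace m => supNorm T₁ T₂ ψ) ∧
    (∀ T₁ T₂ : ℝ, T₁ < T₂ → ∃ C : ℝ, 0 < C ∧
      ∀ P : Measure (PathSpace m), IsSolutionLaw.{u} H ν α lam P →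
        ∀ t ∈ Set.Ioo T₁ T₂,
          ∫⁻ ψ, ENNReal.ofReal (‖ψ t‖ ^ 2) ∂P ≤
            ∫⁻ ψ, ENNReal.ofReal (supNorm T₁ T₂ ψ ^ 2) ∂P ∧
          ∫⁻ ψ, ENNReal.ofReal (supNorm T₁ T₂ ψ ^ 2) ∂P ≤ ENNReal.ofReal C) ∧
    -- (ii)
    (∃ Ω₀ : Set (PathSpace m), MeasurableSet Ω₀ ∧
      (∀ t : ℝ, shift t ⁻¹' Ω₀ = Ω₀) ∧
      (∀ P : Measure (PathSpace m), IsSolutionLaw.{u} H ν α lam P → P Ω₀ = 1) ∧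
      (∀ δ : ℝ, 0 < δ → ∀ ψ ∈ Ω₀, ∃ C : ℝ, 0 < C ∧ ∀ t : ℝ, ‖ψ t‖ ≤ δ * |t| + C) ∧
      (∀ τ : ℝ, 0 < τ →
        (∀ ψ ∈ Ω₀, IntegrableOn (fun s : ℝ => Real.exp (s / τ) * ‖ψ s‖ ^ 2) (Set.Iic 0)) ∧
        Measurable (Ω₀.indicator fun ψ : PathSpace m =>
          ∫ s in Set.Iic (0 : ℝ), Real.exp (s / τ) * ‖ψ s‖ ^ 2))) := by
  have hW := summable_weight hν hspec hsum₁ hsum₂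
  -- The set Ω₀ is that of all sublinear paths, which does not refer to the law and so serves all
  -- solution laws at once.
  refine ⟨?_, fun t => (measurable_eval t).norm, fun T₁ T₂ _ => (continuous_supNorm T₁ T₂).measurable,
    fun T₁ T₂ hT => ?_, sublinearPaths m, measurableSet_sublinearPaths,
    shift_preimage_sublinearPaths, fun P hP => hP.measure_sublinearPaths hH hν hγ.1 hspec hW,
    fun δ hδ ψ hψ => hψ δ hδ, fun τ hτ => ⟨fun ψ hψ => integrableOn_exp_mul_sq hψ hτ,
      (measurable_integral_exp_mul_sq τ).indicator measurableSet_sublinearPaths⟩⟩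
  · intro S _ μ _ β hβ
    obtain ⟨_, _, _, X, hX, hmild, hstat⟩ :=
      exists_isModeSeries_of_isInfDimFBM hH hν hγ.1 hspec hW hβ
    exact ⟨X, hX.measurable, hmild, hstat⟩
  · obtain ⟨C, hC, hbound⟩ := exists_lintegral_supNorm_le.{u} hH hν hγ.1 hspec hW (sub_pos.2 hT)
    refine ⟨C, hC, fun P hP t ht => ⟨lintegral_mono fun ψ => ENNReal.ofReal_le_ofReal ?_, ?_⟩⟩
    · exact pow_le_pow_left₀ (norm_nonneg _) (norm_le_supNorm (Set.Ioo_subset_Icc_self ht) ψ) 2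
    · simpa only [add_sub_cancel] using hbound P hP T₁
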